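/- Work over $\mathbb C$ and let $n\ge 2$, $[n]=\{1,\dots,n\}$. Let $p([n])$ and $t([n])$ be the sets of ordered pairs $ij$ and ordered triples $ijk$ of distinct elements of $[n]$, and let $\mathbb A^1$ have coordinate $\varepsilon$. **The deformed Mau–Woodward space.** Let $\mathcal Q_n\subset(\mathbb P^1)^{p([n])}\times(\mathbb P^1)^{t([n])}\times\mathbb A^1$ be the closed subscheme of points $(\nu,\mu,\varepsilon)$ defined by (the multihomogeneous forms of) the equations $$\mu_{ijk}\mu_{ikj}=1,\quad \mu_{ijk}+\mu_{jik}=1,\quad \mu_{ijk}\mu_{ikl}=\mu_{ijl},\quad \mu_{ijk}\nu_{ik}=\nu_{ij},$$ $$\nu_{ij}+\nu_{ji}=\varepsilon,\quad \varepsilon\nu_{ik}+\nu_{ij}\nu_{jk}=\nu_{ik}\nu_{jk}+\nu_{ij}\nu_{ik}$$ for distinct $i,j,k,l$, and let $\overline{\mathfrak C}_n\subset(\mathbb P^1)^{p([n])}\times\mathbb A^1$ be the closed subscheme of points $(\nu,\varepsilon)$ defined by the equations in the last line. Let $\mathcal Q_n^\circ\subset\mathcal Q_n$ and $\mathfrak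 C_n\subset\overline{\mathfrak C}_n$ be the open subschemes where $\nu_{ij}\ne 0,\varepsilon$ for all $ij\in p([n])$. Forgetting $\mu$ gives a morphism $\mathcal Q_n^\circ\to\mathfrak C_n$. In the coordinates $\delta_{ij}=\nu_{ij}^{-1}$ the scheme $\mathfrak C_n$ is affine, with coordinate ring the quotient of $\mathbb C[\varepsilon][\delta_{ij}: ij\in p([n])]$ by the relations $\varepsilon\delta_{ij}\delta_{jk}+\delta_{ik}=\delta_{ij}+\delta_{jk}$ and $\delta_{ij}+\delta_{ji}=\varepsilon\delta_{ij}\delta_{ji}$. (It is the quotient $\mathbb G^n/\mathbb G$, where $\mathbb G=\{(x;\varepsilon):1-\varepsilon x\ne0\}$ is the group scheme over $\mathbb A^1$ with multiplication $x+x'-\varepsilon xx'$, via $\delta_{ij}=\frac{x_i-x_j}{1-\varepsilon x_j}$.) Its identity section is the closed subscheme $\{\delta_{ij}=0 \text{ for all } ij\}$. **The deformed line bundle.** Put $\mathfrak t_n=\mathbb C^n/\mathbb C$, with linear coordinates $u_i-u_1$, $2\le i\le n$. Let $\mathcal E_{n+1}\to\mathfrak C_n$ be the blowup of $\mathfrak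 C_n$ along the identity section, and let $\mathcal E_{n+1}\to\mathbb P(\mathfrak t_n)$ be the morphism which is $[u_i-u_1]_{i\ge 2}=[\delta_{1i}]_{i\ge2}$ off the exceptional divisor. Let $\overline M_{n+1}$ be the Deligne–Mumford space of stable genus $0$ curves with $n+1$ marked points, realised as the de Concini–Procesi wonderful compactification, that is, as the closure of the space of configurations of distinct points $u_1,\dots,u_n\in\mathbb C$ (and $u_{n+1}=\infty$) modulo affine transformations, in the product $\prod_{B\subset[n],\,|B|\ge2}\mathbb P(\mathbb C^B/\mathbb C)$, under $u\mapsto([u|_B])_B$. Let $\overline M_{n+1}\to\mathbb P(\mathfrak t_n)$ be the projection to the factor $B=[n]$, which collapses a curve to its component containing the $(n+1)$-st marked point. The deformed line bundle is $$\widetilde{\mathcal M}_{n+1}:=\overline M_{n+1}\times_{\mathbb P(\mathfrak t_n)}\mathcal E_{n+1},$$ with its morphism $\widetilde{\mathcal M}_{n+1}\to\mathcal E_{n+1}\to\mathfrak C_n$. **Theorem.** For every $n\ge2$ there is an isomorphism of schemes $\mathcal Q_n^\circ\cong\widetilde{\mathcal M}_{n+1}$ compatible with the morphisms of both sides to $\mathfrak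 C_n$. -/

import Mathlib

open CategoryTheory CategoryTheory.Limits AlgebraicGeometry

noncomputable section

namespace MauWoodward

/-! ## Projective spaces over a ring and homogeneous coordinates -/

section Projective

attribute [instance] MvPolynomial.gradedAlgebra

/-- The standard grading of `k[x_i : i ∈ σ]`. -/
abbrev stdGrading (σ k : Type) [CommRing k] : ℕ → Submodule k (MvPolynomial σ k) :=
  MvPolynomial.homogeneousSubmodule σ k

/-- The projective space over `k` with homogeneous coordinates `x_i`, `i ∈ σ`. -/
abbrev PS (σ k : Type) [CommRing k] : Scheme.{0} :=
  Proj (stdGrading σ k)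

/-- The structure morphism of projective space over `k`. -/
def PS.str (σ k : Type) [CommRing k] : PS σ k ⟶ Spec (.of k) :=
  Proj.toSpecZero (stdGrading σ k) ≫
    Spec.map (CommRingCat.ofHom (algebraMap k (stdGrading σ k 0)))

/-- Projective space as an object over `Spec k`. -/
abbrev PS.over (σ k : Type) [CommRing k] : Over (Spec (.of k)) :=
  Over.mk (PS.str σ k)

variable {σ k : Type} [CommRing k]

/-- The ring homomorphism `k → Γ(T, 𝒪_T)` of a scheme `g : T ⟶ Spec k`. -/
def scalars {T : Scheme.{0}} (g : T ⟶ Spec (.of k)) : k →+* Γ(T, ⊤) :=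
  ((Scheme.ΓSpecIso (.of k)).inv ≫ g.appTop).hom

/-- The homomorphism `k[x_i] → Γ(T, 𝒪_T)` over `k` sending `x_i` to `s i`. -/
def evalSections {T : Scheme.{0}} (g : T ⟶ Spec (.of k)) (s : σ → Γ(T, ⊤)) :
    MvPolynomial σ k →+* Γ(T, ⊤) :=
  MvPolynomial.eval₂Hom (scalars g) s

lemma X_mem_irrelevant (i : σ) : (MvPolynomial.X i : MvPolynomial σ k) ∈
    (HomogeneousIdeal.irrelevant (stdGrading σ k)).toIdeal := by
  change _ ∈ HomogeneousIdeal.irrelevant (stdGrading σ k)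
  rw [HomogeneousIdeal.mem_irrelevant_iff, GradedRing.proj_apply,
    DirectSum.decompose_of_mem_ne (stdGrading σ k) (MvPolynomial.isHomogeneous_X k i)
      one_ne_zero]

lemma irrelevant_map_eq_top {T : Scheme.{0}} (g : T ⟶ Spec (.of k)) (s : σ → Γ(T, ⊤))
    (hs : Ideal.span (Set.range s) = ⊤) :
    (HomogeneousIdeal.irrelevant (stdGrading σ k)).toIdeal.map (evalSections g s) = ⊤ := by
  rw [eq_top_iff, ← hs, Ideal.span_le]
  rintro _ ⟨i, rfl⟩
  have := Ideal.mem_map_of_mem (evalSections g s) (X_mem_irrelevant i)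
  simpa [evalSections] using this

/-- The morphism `[s_i]_{i ∈ σ} : T ⟶ ℙ` over `k` given by functions `s_i` on `T` without common
zero. -/
def ofCoords {T : Scheme.{0}} (g : T ⟶ Spec (.of k)) (s : σ → Γ(T, ⊤))
    (hs : Ideal.span (Set.range s) = ⊤) : T ⟶ PS σ k :=
  Proj.fromOfGlobalSections (stdGrading σ k) (evalSections g s) (irrelevant_map_eq_top g s hs)

lemma ofCoords_str {T : Scheme.{0}} (g : T ⟶ Spec (.of k)) (s : σ → Γ(T, ⊤))
    (hs : Ideal.span (Set.range s) = ⊤) : ofCoords g s hs ≫ PS.str σ k = g := by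
  rw [ofCoords, PS.str, Proj.fromOfGlobalSections_toSpecZero_assoc, ← Spec.map_comp,
    ← CommRingCat.ofHom_comp]
  have : ((evalSections g s).comp (algebraMap (stdGrading σ k 0) (MvPolynomial σ k))).comp
      (algebraMap k (stdGrading σ k 0)) = scalars g := by
    ext x
    change evalSections g s (MvPolynomial.C x) = _
    simp [evalSections]
  rw [this]
  simp only [scalars, CommRingCat.ofHom_hom, Spec.map_comp]
  rw [← Scheme.toSpecΓ_naturality_assoc, ← SpecMap_ΓSpecIso_hom, ← Spec.map_comp,
    Iso.inv_hom_id, Spec.map_id, Category.comp_id]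

/-- The functions `s_i` on the open set `U` are homogeneous coordinates of `φ : T ⟶ ℙ` on `U`:
they have no common zero on `U`, and `φ = [s_i]_{i ∈ σ}` on `U`. -/
def IsCoords {T : Scheme.{0}} (φ : T ⟶ PS σ k) (U : T.Opens) (s : σ → Γ(T, U)) : Prop :=
  ∃ hs : Ideal.span (Set.range fun i ↦ U.topIso.inv (s i)) = ⊤,
    U.ι ≫ φ = ofCoords (U.ι ≫ φ ≫ PS.str σ k) (fun i ↦ U.topIso.inv (s i)) hs

end Projective

/-! ## Subschemes of products of projective lines given by multihomogeneous polynomials -/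

section Lines

variable (k : Type) [CommRing k] (C : Type) [Finite C]

/-- The product `(ℙ¹)^C` over `Spec k`. -/
def lines : Over (Spec (.of k)) :=
  ∏ᶜ fun _ : C ↦ PS.over (Fin 2) k

variable {k C}

/-- The `c`-th projection `(ℙ¹)^C ⟶ ℙ¹`. -/
def lines.proj (c : C) : (lines k C).left ⟶ PS (Fin 2) k :=
  (Pi.π (fun _ : C ↦ PS.over (Fin 2) k) c).left

/-- `s (c, 0)`, `s (c, 1)` are homogeneous coordinates, on the open set `U`, of the `c`-th
component of the points of `(ℙ¹)^C`, for all `c`. -/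
def AreCoords (U : (lines k C).left.Opens) (s : C × Fin 2 → Γ((lines k C).left, U)) : Prop :=
  ∀ c : C, IsCoords (lines.proj (k := k) c) U fun a ↦ s (c, a)

/-- The value of a polynomial in the homogeneous coordinates when `s` is substituted for them. -/
def value {U : (lines k C).left.Opens} (s : C × Fin 2 → Γ((lines k C).left, U))
    (f : MvPolynomial (C × Fin 2) k) : Γ((lines k C).left, U) :=
  U.topIso.hom (evalSections (U.ι ≫ (lines k C).hom) (fun a ↦ U.topIso.inv (s a)) f)

/-- The ideal sheaf on `(ℙ¹)^C` generated by the values of a set `F` of multihomogeneous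
polynomials at the local homogeneous coordinates. -/
def vanishingSheaf (F : Set (MvPolynomial (C × Fin 2) k)) :
    (lines k C).left.IdealSheafData :=
  sInf {I | ∀ (U : (lines k C).left.affineOpens) (s : C × Fin 2 → Γ((lines k C).left, U)),
    AreCoords U.1 s → ∀ f ∈ F, value s f ∈ I.ideal U}

/-- The open set of `(ℙ¹)^C` where a multihomogeneous polynomial does not vanish. -/
def nonvanishing (f : MvPolynomial (C × Fin 2) k) : (lines k C).left.Opens :=
  ⨆ (U : (lines k C).left.affineOpens) (s : C × Fin 2 → Γ((lines k C).left, U))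
    (_ : AreCoords U.1 s), (lines k C).left.basicOpen (value s f)


/-- The coordinate `x_c = [num c : den c]` on the `c`-th projective line; thus `x_c = 0` means
`num c = 0`, and `x_c = ∞` means `den c = 0`. -/
abbrev num (c : C) : MvPolynomial (C × Fin 2) k := MvPolynomial.X (c, 0)

/-- See `num`. -/
abbrev den (c : C) : MvPolynomial (C × Fin 2) k := MvPolynomial.X (c, 1)

end Lines

/-! ## The deformed Mau–Woodward space -/

section Q

variable (n : ℕ)

/-- Pairs of distinct indices. -/
abbrev Pairs : Type := {p : Fin n × Fin n // p.1 ≠ p.2}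

/-- Triples of distinct indices. -/
abbrev Triples : Type :=
  {t : Fin n × Fin n × Fin n // t.1 ≠ t.2.1 ∧ t.1 ≠ t.2.2 ∧ t.2.1 ≠ t.2.2}

variable {n}

/-- The index of the coordinate `ν_ij`. -/
abbrev pr (i j : Fin n) (h : i ≠ j) : Pairs n := ⟨(i, j), h⟩

/-- The index of the coordinate `μ_ijk`. -/
abbrev tr (i j k : Fin n) (hij : i ≠ j) (hik : i ≠ k) (hjk : j ≠ k) : Triples n :=
  ⟨(i, j, k), hij, hik, hjk⟩

/-- The ring of functions on the affine line with coordinate `ε`. -/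
abbrev Base : Type := Polynomial ℂ

/-- The coordinate `ε` of the affine line. -/
abbrev eps : Base := Polynomial.X

variable (n)

/-- The equations `ν_ij + ν_ji = ε` and `ε ν_ik + ν_ij ν_jk = ν_ik ν_jk + ν_ij ν_ik`,
for distinct `i, j, k`, in multihomogeneous form. -/
def nuEquations : Set (MvPolynomial (Pairs n × Fin 2) Base) :=
  {f | ∃ (i j : Fin n) (h : i ≠ j),
    f = num (pr i j h) * den (pr j i h.symm) + num (pr j i h.symm) * den (pr i j h)
      - MvPolynomial.C eps * den (pr i j h) * den (pr j i h.symm)} ∪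
  {f | ∃ (i j k : Fin n) (hij : i ≠ j) (hik : i ≠ k) (hjk : j ≠ k),
    f = MvPolynomial.C eps * num (pr i k hik) * den (pr i j hij) * den (pr j k hjk)
      + num (pr i j hij) * num (pr j k hjk) * den (pr i k hik)
      - num (pr i k hik) * num (pr j k hjk) * den (pr i j hij)
      - num (pr i j hij) * num (pr i k hik) * den (pr j k hjk)}

/-- The index set of the coordinates `ν_ij` and `μ_ijk`. -/
abbrev Indices : Type := Pairs n ⊕ Triples n

/-- The equations `μ_ijk μ_ikj = 1`, `μ_ijk + μ_jik = 1` and `μ_ijk μ_ikl = μ_ijl`,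
for distinct `i, j, k, l`, in multihomogeneous form. -/
def muEquations : Set (MvPolynomial (Triples n × Fin 2) Base) :=
  {f | ∃ (i j k : Fin n) (hij : i ≠ j) (hik : i ≠ k) (hjk : j ≠ k),
    f = num (tr i j k hij hik hjk) * num (tr i k j hik hij hjk.symm)
      - den (tr i j k hij hik hjk) * den (tr i k j hik hij hjk.symm)} ∪
  {f | ∃ (i j k : Fin n) (hij : i ≠ j) (hik : i ≠ k) (hjk : j ≠ k),
    f = num (tr i j k hij hik hjk) * den (tr j i k hij.symm hjk hik)
      + num (tr j i k hij.symm hjk hik) * den (tr i j k hij hik hjk)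
      - den (tr i j k hij hik hjk) * den (tr j i k hij.symm hjk hik)} ∪
  {f | ∃ (i j k l : Fin n) (hij : i ≠ j) (hik : i ≠ k) (hil : i ≠ l) (hjk : j ≠ k) (hjl : j ≠ l)
      (hkl : k ≠ l),
    f = num (tr i j k hij hik hjk) * num (tr i k l hik hil hkl) * den (tr i j l hij hil hjl)
      - num (tr i j l hij hil hjl) * den (tr i j k hij hik hjk) * den (tr i k l hik hil hkl)}

/-- The equations `μ_ijk ν_ik = ν_ij`, for distinct `i, j, k`, in multihomogeneous form. -/
def mixedEquations : Set (MvPolynomial (Indices n × Fin 2) Base) :=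
  {f | ∃ (i j k : Fin n) (hij : i ≠ j) (hik : i ≠ k) (hjk : j ≠ k),
    f = num (.inr (tr i j k hij hik hjk)) * num (.inl (pr i k hik)) * den (.inl (pr i j hij))
      - num (.inl (pr i j hij)) * den (.inr (tr i j k hij hik hjk)) * den (.inl (pr i k hik))}

/-- All the equations of the deformed Mau–Woodward space `𝒬_n`. -/
def mwEquations : Set (MvPolynomial (Indices n × Fin 2) Base) :=
  MvPolynomial.rename (Prod.map Sum.inl id) '' nuEquations n ∪
  MvPolynomial.rename (Prod.map Sum.inr id) '' muEquations n ∪ mixedEquations n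

/-- The deformed Mau–Woodward space `𝒬_n`, a closed subscheme of
`(ℙ¹)^{p([n])} × (ℙ¹)^{t([n])} × 𝔸¹`. -/
def Q : Scheme.{0} := (vanishingSheaf (mwEquations n)).subscheme

/-- The closed immersion of `𝒬_n` into `(ℙ¹)^{p([n])} × (ℙ¹)^{t([n])} × 𝔸¹`. -/
def Q.ι : Q n ⟶ (lines Base (Indices n)).left := (vanishingSheaf (mwEquations n)).subschemeι

/-- The open set of `(ℙ¹)^{p([n])} × 𝔸¹` where `ν_ij ≠ 0` and `ν_ij ≠ ε` for all `i ≠ j`. -/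
def nuOpen : (lines Base (Pairs n)).left.Opens :=
  ⨅ c : Pairs n, nonvanishing (num c) ⊓ nonvanishing (num c - MvPolynomial.C eps * den c)

/-- The projection `(ν, μ, ε) ↦ (ν, ε)`. -/
def forgetMu : (lines Base (Indices n)).left ⟶ (lines Base (Pairs n)).left :=
  (Pi.lift fun c : Pairs n ↦ Pi.π (fun _ : Indices n ↦ PS.over (Fin 2) Base) (.inl c) :
    lines Base (Indices n) ⟶ lines Base (Pairs n)).left

/-- The open locus of `𝒬_n` where `ν_ij ≠ 0` and `ν_ij ≠ ε` for all `i ≠ j`. -/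
def Qcirc : (Q n).Opens := (Q.ι n ≫ forgetMu n) ⁻¹ᵁ nuOpen n

/-- The deformed flower space, the closed subscheme of `(ℙ¹)^{p([n])} × 𝔸¹` given by the
equations for the `ν_ij`. -/
def CfBar : Scheme.{0} := (vanishingSheaf (nuEquations n)).subscheme

/-- The closed immersion of the deformed flower space into `(ℙ¹)^{p([n])} × 𝔸¹`. -/
def CfBar.ι : CfBar n ⟶ (lines Base (Pairs n)).left := (vanishingSheaf (nuEquations n)).subschemeι

/-- The open locus `Cf_n` of the deformed flower space where `ν_ij ≠ 0` and `ν_ij ≠ ε` for all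
`i ≠ j`. -/
def Cf : (CfBar n).Opens := CfBar.ι n ⁻¹ᵁ nuOpen n

end Q

/-! ## Blowups of affine schemes -/

section Blowup

open Polynomial

variable {R : Type} [CommRing R] (I : Ideal R)

/-- The grading of the Rees algebra `⊕ I ^ m T ^ m ⊆ R[T]`. -/
def reesGrading (m : ℕ) : Submodule R (reesAlgebra I) where
  carrier := {f | ∀ i ≠ m, (f : R[X]).coeff i = 0}
  add_mem' hf hg i hi := by simp [hf i hi, hg i hi]
  zero_mem' i _ := by simp
  smul_mem' r f hf i hi := by simp [hf i hi]

lemma mem_reesGrading {m : ℕ} {f : reesAlgebra I} :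
    f ∈ reesGrading I m ↔ ∀ i ≠ m, (f : R[X]).coeff i = 0 := Iff.rfl

/-- The element `a T ^ m` of the Rees algebra, for `a ∈ I ^ m`. -/
def reesMonomial (m : ℕ) (a : R) (ha : a ∈ I ^ m) : reesAlgebra I :=
  ⟨monomial m a, reesAlgebra.monomial_mem.2 ha⟩

lemma reesMonomial_mem (m : ℕ) (a : R) (ha : a ∈ I ^ m) :
    reesMonomial I m a ha ∈ reesGrading I m := by
  intro i hi
  simp [reesMonomial, coeff_monomial, hi.symm]

instance reesGrading.gradedMonoid : SetLike.GradedMonoid (reesGrading I) where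
  one_mem i hi := by simp [coeff_one, hi]
  mul_mem {a b} f g hf hg i hi := by
    rw [MulMemClass.coe_mul, coeff_mul]
    refine Finset.sum_eq_zero fun p hp ↦ ?_
    have hp' : p.1 + p.2 = i := Finset.HasAntidiagonal.mem_antidiagonal.1 hp
    by_cases h : p.1 = a
    · rw [hg p.2 (by omega), mul_zero]
    · rw [hf p.1 h, zero_mul]

lemma coeff_coeAddMonoidHom (x : DirectSum ℕ fun i ↦ reesGrading I i) (m : ℕ) :
    ((DirectSum.coeAddMonoidHom (reesGrading I) x : reesAlgebra I) : R[X]).coeff m =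
      ((x m : reesAlgebra I) : R[X]).coeff m := by
  induction x using DirectSum.induction_on with
  | zero => simp
  | of i y =>
    rw [DirectSum.coeAddMonoidHom_of]
    by_cases h : m = i
    · subst h
      rw [DirectSum.of_eq_same]
    · rw [y.2 m h, DirectSum.of_eq_of_ne _ _ _ h]
      simp
  | add x y hx hy => simp [hx, hy]

instance reesGrading.decomposition : DirectSum.Decomposition (reesGrading I) where
  decompose' f := ∑ m ∈ (f : R[X]).support,
    DirectSum.of (fun i ↦ reesGrading I i) m
      ⟨reesMonomial I m ((f : R[X]).coeff m) (f.2 m), reesMonomial_mem I _ _ _⟩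
  left_inv f := by
    apply Subtype.ext
    rw [map_sum, AddSubmonoidClass.coe_finsetSum]
    simp only [DirectSum.coeAddMonoidHom_of]
    exact (as_sum_support (f : R[X])).symm
  right_inv x := by
    have hinj : Function.Injective (DirectSum.coeAddMonoidHom (reesGrading I)) := by
      intro a b hab
      refine DFinsupp.ext fun m ↦ Subtype.ext (Subtype.ext (Polynomial.ext fun i ↦ ?_))
      by_cases h : i = m
      · subst h
        exact (coeff_coeAddMonoidHom I a i).symm.trans
          ((congrArg (fun f : reesAlgebra I ↦ (f : R[X]).coeff i) hab).trans
            (coeff_coeAddMonoidHom I b i))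
      · exact ((a m).2 i h).trans ((b m).2 i h).symm
    apply hinj
    apply Subtype.ext
    rw [map_sum, AddSubmonoidClass.coe_finsetSum]
    simp only [DirectSum.coeAddMonoidHom_of]
    exact (as_sum_support _).symm

instance reesGrading.gradedAlgebra : GradedAlgebra (reesGrading I) where

/-- The blowup of `Spec R` along the closed subscheme `V(I)`: the scheme `Proj (⊕ I ^ m)`. -/
def Blowup : Scheme.{0} := Proj (reesGrading I)

/-- The projection of the blowup onto `Spec R`. -/
def Blowup.toSpec : Blowup I ⟶ Spec (.of R) :=
  Proj.toSpecZero (reesGrading I) ≫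
    Spec.map (CommRingCat.ofHom (algebraMap R (reesGrading I 0)))

/-- The graded homomorphism `k[x_i] → ⊕ I ^ m T ^ m` with `x_i ↦ t_i T`, for `t_i ∈ I`. -/
def coordsToRees {k σ : Type} [CommRing k] [Algebra k R] (t : σ → R) (ht : ∀ i, t i ∈ I) :
    GradedRingHom (stdGrading σ k) (reesGrading I) where
  __ := MvPolynomial.eval₂Hom ((algebraMap R (reesAlgebra I)).comp (algebraMap k R))
    fun i ↦ reesMonomial I 1 (t i) (by simpa using ht i)
  map_mem {m} f hf := by
    have hf' : f.IsHomogeneous m := hf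
    change MvPolynomial.eval₂Hom _ _ f ∈ reesGrading I m
    rw [MvPolynomial.coe_eval₂Hom, MvPolynomial.eval₂_eq]
    refine Submodule.sum_mem _ fun d hd ↦ ?_
    have hdeg : ∑ i ∈ d.support, d i • 1 = m := by
      have := hf' (MvPolynomial.mem_support_iff.1 hd)
      simpa [Finsupp.weight_apply, Finsupp.sum] using this
    rw [RingHom.comp_apply, ← Algebra.smul_def]
    refine Submodule.smul_mem _ _ ?_
    rw [← hdeg]
    exact SetLike.prod_pow_mem_graded _ _ _ _ fun i _ ↦ reesMonomial_mem I _ _ _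

lemma coordsToRees_X {k σ : Type} [CommRing k] [Algebra k R] (t : σ → R) (ht : ∀ i, t i ∈ I)
    (i : σ) : coordsToRees (k := k) I t ht (MvPolynomial.X i) =
      reesMonomial I 1 (t i) (by simpa using ht i) := by
  change MvPolynomial.eval₂Hom _ _ (MvPolynomial.X i) = _
  simp

lemma irrelevant_le_map {k σ : Type} [CommRing k] [Algebra k R] (t : σ → R) (ht : ∀ i, t i ∈ I)
    (hI : I ≤ Ideal.span (Set.range t)) :
    HomogeneousIdeal.irrelevant (reesGrading I) ≤
      HomogeneousIdeal.map (coordsToRees (k := k) I t ht)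
        (HomogeneousIdeal.irrelevant (stdGrading σ k)) := by
  set K := (HomogeneousIdeal.irrelevant (stdGrading σ k)).toIdeal.map
    (coordsToRees (k := k) I t ht) with hK
  have hlin : ∀ x (hx : x ∈ I ^ 1), reesMonomial I 1 x hx ∈ K := by
    intro x hx
    have hx' : x ∈ Ideal.span (Set.range t) := hI (by simpa using hx)
    have key : ∀ y ∈ Ideal.span (Set.range t), ∃ hy : y ∈ I ^ 1, reesMonomial I 1 y hy ∈ K := by
      intro y hy
      induction hy using Submodule.span_induction with
      | mem y hy =>
        obtain ⟨i, rfl⟩ := hy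
        refine ⟨by simpa using ht i, ?_⟩
        rw [← coordsToRees_X (k := k) I t ht i]
        exact Ideal.mem_map_of_mem _ (X_mem_irrelevant i)
      | zero =>
        refine ⟨zero_mem _, ?_⟩
        convert! K.zero_mem
        exact Subtype.ext (by simp [reesMonomial])
      | add y z _ _ hy hz =>
        obtain ⟨hy, hy'⟩ := hy
        obtain ⟨hz, hz'⟩ := hz
        refine ⟨add_mem hy hz, ?_⟩
        convert! K.add_mem hy' hz'
        exact Subtype.ext (by simp [reesMonomial])
      | smul r y _ hy =>
        obtain ⟨hy, hy'⟩ := hy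
        refine ⟨Ideal.mul_mem_left _ _ hy, ?_⟩
        convert! K.mul_mem_left (algebraMap R (reesAlgebra I) r) hy'
        apply Subtype.ext
        simp [reesMonomial, ← C_mul_monomial, C_eq_algebraMap]
    exact (key x hx').2
  have hall : ∀ m, 0 < m → ∀ x (hx : x ∈ I ^ m), reesMonomial I m x hx ∈ K := by
    intro m hm x hx
    obtain ⟨m, rfl⟩ : ∃ l, m = 1 + l := ⟨m - 1, by omega⟩
    have key : ∀ y ∈ I ^ 1 * I ^ m, ∃ hy : y ∈ I ^ (1 + m), reesMonomial I (1 + m) y hy ∈ K := by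
      intro y hy
      refine Submodule.mul_induction_on hy ?_ ?_
      · intro a ha b hb
        refine ⟨by rw [pow_add]; exact Ideal.mul_mem_mul ha hb, ?_⟩
        convert! K.mul_mem_right (reesMonomial I m b hb) (hlin a ha)
        exact Subtype.ext (by simp [reesMonomial, monomial_mul_monomial])
      · rintro y z ⟨hy, hy'⟩ ⟨hz, hz'⟩
        refine ⟨add_mem hy hz, ?_⟩
        convert! K.add_mem hy' hz'
        exact Subtype.ext (by simp [reesMonomial])
    exact (key x (by rwa [← pow_add])).2
  rw [HomogeneousIdeal.irrelevant_le]
  intro m hm f hf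
  have hf' : f ∈ reesGrading I m := hf
  change f ∈ K
  convert! hall m hm _ (f.2 m)
  apply Subtype.ext
  ext i
  by_cases h : i = m
  · subst h
    simp [reesMonomial]
  · simp [reesMonomial, coeff_monomial, Ne.symm h, hf' i h]

/-- The morphism `[t_i]_{i ∈ σ}` over `k` from the blowup of `V(I)` to projective space, where
the `t_i` generate `I`. It extends the morphism `[t_i]_{i ∈ σ}` on the complement of `V(I)`. -/
def Blowup.toPS {k σ : Type} [CommRing k] [Algebra k R] (t : σ → R) (ht : ∀ i, t i ∈ I)
    (hI : I ≤ Ideal.span (Set.range t)) : Blowup I ⟶ PS σ k :=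
  Proj.map (coordsToRees I t ht) (irrelevant_le_map I t ht hI)

end Blowup

/-! ## The family of quotient groups `𝔾^n / 𝔾` and the blowup of its identity section -/

section E

variable (n : ℕ)

/-- The equations `ε δ_ij δ_jk + δ_ik = δ_ij + δ_jk` and `δ_ij + δ_ji = ε δ_ij δ_ji`, for distinct
`i, j, k`. -/
def deltaEquations : Set (MvPolynomial (Pairs n) Base) :=
  {f | ∃ (i j k : Fin n) (hij : i ≠ j) (hik : i ≠ k) (hjk : j ≠ k),
    f = MvPolynomial.C eps * MvPolynomial.X (pr i j hij) * MvPolynomial.X (pr j k hjk)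
      + MvPolynomial.X (pr i k hik)
      - (MvPolynomial.X (pr i j hij) + MvPolynomial.X (pr j k hjk))} ∪
  {f | ∃ (i j : Fin n) (h : i ≠ j),
    f = MvPolynomial.X (pr i j h) + MvPolynomial.X (pr j i h.symm)
      - MvPolynomial.C eps * MvPolynomial.X (pr i j h) * MvPolynomial.X (pr j i h.symm)}

/-- The coordinate ring of `Cf_n`, generated over `ℂ[ε]` by the functions `δ_ij = 1 / ν_ij`. -/
def CfRing : Type := MvPolynomial (Pairs n) Base ⧸ Ideal.span (deltaEquations n)

instance : CommRing (CfRing n) :=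
  inferInstanceAs (CommRing (MvPolynomial (Pairs n) Base ⧸ Ideal.span (deltaEquations n)))

/-- The quotient homomorphism onto the coordinate ring of `Cf_n`. -/
def CfRing.mk : MvPolynomial (Pairs n) Base →+* CfRing n :=
  Ideal.Quotient.mk (Ideal.span (deltaEquations n))

instance : Algebra Base (CfRing n) := ((CfRing.mk n).comp MvPolynomial.C).toAlgebra

instance : Algebra ℂ (CfRing n) :=
  ((algebraMap Base (CfRing n)).comp (algebraMap ℂ Base)).toAlgebra

variable {n}

/-- The function `δ_ij` on `Cf_n`. -/
def delta (c : Pairs n) : CfRing n := CfRing.mk n (MvPolynomial.X c)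

variable (n)

lemma delta_add_delta (i j : Fin n) (h : i ≠ j) :
    delta (pr i j h) + delta (pr j i h.symm) =
      algebraMap Base (CfRing n) eps * delta (pr i j h) * delta (pr j i h.symm) := by
  have : CfRing.mk n _ = 0 :=
    Ideal.Quotient.eq_zero_iff_mem.2 (Ideal.subset_span (Or.inr ⟨i, j, h, rfl⟩))
  rw [← sub_eq_zero]
  simp only [map_sub, map_add, map_mul] at this
  exact this

lemma delta_cocycle (i j k : Fin n) (hij : i ≠ j) (hik : i ≠ k) (hjk : j ≠ k) :
    algebraMap Base (CfRing n) eps * delta (pr i j hij) * delta (pr j k hjk)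
      + delta (pr i k hik) = delta (pr i j hij) + delta (pr j k hjk) := by
  have : CfRing.mk n _ = 0 :=
    Ideal.Quotient.eq_zero_iff_mem.2 (Ideal.subset_span (Or.inl ⟨i, j, k, hij, hik, hjk, rfl⟩))
  rw [← sub_eq_zero]
  simp only [map_sub, map_add, map_mul] at this
  exact this

/-- The immersion `δ ↦ (ν_ij = [1 : δ_ij])` of `Spec` of the coordinate ring into
`(ℙ¹)^{p([n])} × 𝔸¹`. -/
def CfRing.toLines : Spec (.of (CfRing n)) ⟶ (lines Base (Pairs n)).left :=
  (Pi.lift fun c : Pairs n ↦ Over.homMk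
    (ofCoords (Spec.map (CommRingCat.ofHom (algebraMap Base (CfRing n))))
      (fun a : Fin 2 ↦ (Scheme.ΓSpecIso (.of (CfRing n))).inv (if a = 0 then 1 else delta c))
      ((Ideal.eq_top_iff_one _).2 (Ideal.subset_span ⟨0, by simp⟩)))
    (ofCoords_str _ _ _) :
    Over.mk (Spec.map (CommRingCat.ofHom (algebraMap Base (CfRing n)))) ⟶
      lines Base (Pairs n)).left

/-- The ideal of the identity section of `Cf_n ≅ 𝔾^n / 𝔾`, given by `δ_ij = 0` for all `i, j`. -/
def identityIdeal : Ideal (CfRing n) := Ideal.span (Set.range delta)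

/-- The blowup `ℰ_{n+1}` of `Cf_n` along the identity section. -/
def E : Scheme.{0} := Blowup (identityIdeal n)

/-- The blowdown `ℰ_{n+1} ⟶ Cf_n`. -/
def E.toCf : E n ⟶ Spec (.of (CfRing n)) := Blowup.toSpec (identityIdeal n)

end E

/-! ## The projective spaces `ℙ(ℂ^B / ℂ)` and the compactification of the configuration space -/

section M

variable {n : ℕ}

/-- The base point of a set of indices, its smallest element. -/
def base (B : Finset (Fin n)) (hB : B.Nontrivial) : Fin n := B.min' hB.nonempty

/-- The index set of the linear coordinates `u_i - u_b`, `i ∈ B \ {b}`, on `ℂ^B / ℂ`, where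
`b` is the base point of `B`. -/
abbrev Coord (B : Finset (Fin n)) (hB : B.Nontrivial) : Type :=
  {i : Fin n // i ∈ B ∧ i ≠ base B hB}

/-- The projective space `ℙ(ℂ^B / ℂ)` of lines in `ℂ^B / ℂ`, with homogeneous coordinates
`u_i - u_b`. -/
abbrev PB (B : Finset (Fin n)) (hB : B.Nontrivial) : Scheme.{0} := PS (Coord B hB) ℂ

variable (n)

/-- The sets of at least two indices. -/
abbrev Subsets : Type := {B : Finset (Fin n) // B.Nontrivial}

/-- The product of the `ℙ(ℂ^B / ℂ)` for all sets `B` of at least two indices. -/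
def prodPB : Over (Spec (.of ℂ)) :=
  ∏ᶜ fun B : Subsets n ↦ PS.over (Coord B.1 B.2) ℂ

variable {n} in
/-- The linear form `u_i - u_j`. -/
def rootForm (c : Pairs n) : MvPolynomial (Fin n) ℂ :=
  MvPolynomial.X c.1.1 - MvPolynomial.X c.1.2

/-- The product of the `u_i - u_j` over all pairs of distinct indices. -/
def discriminant : MvPolynomial (Fin n) ℂ :=
  ∏ c : Pairs n, rootForm c

/-- The ring of functions on the space `ℂ^n \ Δ` of `n` distinct points `u_1, …, u_n` of `ℂ`. -/
def ConfRing : Type :=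
  Localization.Away (discriminant n)

instance : CommRing (ConfRing n) := inferInstanceAs (CommRing (Localization.Away (discriminant n)))

/-- The localization homomorphism into the ring of functions on `ℂ^n \ Δ`. -/
def ConfRing.of : MvPolynomial (Fin n) ℂ →+* ConfRing n :=
  algebraMap (MvPolynomial (Fin n) ℂ) (Localization.Away (discriminant n))

instance : Algebra ℂ (ConfRing n) := ((ConfRing.of n).comp MvPolynomial.C).toAlgebra

/-- The coordinate function `u_i` on `ℂ^n \ Δ`. -/
def ConfRing.u (i : Fin n) : ConfRing n :=
  ConfRing.of n (MvPolynomial.X i)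

lemma ConfRing.isUnit_sub (i j : Fin n) (h : i ≠ j) :
    IsUnit (ConfRing.u n i - ConfRing.u n j) := by
  have h1 : IsUnit (ConfRing.of n (discriminant n)) :=
    IsLocalization.Away.algebraMap_isUnit (S := Localization.Away (discriminant n))
      (discriminant n)
  have h2 : rootForm (pr i j h) ∣ discriminant n :=
    Finset.dvd_prod_of_mem _ (Finset.mem_univ _)
  have h3 := isUnit_of_dvd_unit (map_dvd (ConfRing.of n) h2) h1
  rw [rootForm, map_sub] at h3
  exact h3

/-- The structure morphism of `ℂ^n \ Δ`. -/
def ConfRing.str : Spec (.of (ConfRing n)) ⟶ Spec (.of ℂ) :=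
  Spec.map (CommRingCat.ofHom (algebraMap ℂ (ConfRing n)))

lemma ConfRing.span_eq_top (B : Subsets n) :
    Ideal.span (Set.range fun i : Coord B.1 B.2 ↦ (Scheme.ΓSpecIso (.of (ConfRing n))).inv
      (ConfRing.u n i.1 - ConfRing.u n (base B.1 B.2))) = ⊤ := by
  obtain ⟨i, hi, hne⟩ := B.2.exists_ne (base B.1 B.2)
  exact Ideal.eq_top_of_isUnit_mem _ (Ideal.subset_span ⟨⟨i, hi, hne⟩, rfl⟩)
    ((ConfRing.isUnit_sub n i _ hne).map (Scheme.ΓSpecIso (.of (ConfRing n))).inv.hom)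

/-- The morphism sending a configuration `u ∈ ℂ^n \ Δ` to the family of classes `[u|_B]`. It
factors through the quotient `(ℂ^n \ Δ) / B = M_{n+1}` by the group of affine transformations
of `ℂ`, and embeds `M_{n+1}`. -/
def ConfRing.toProd : Spec (.of (ConfRing n)) ⟶ (prodPB n).left :=
  (Pi.lift fun B : Subsets n ↦ Over.homMk
    (ofCoords (ConfRing.str n) _ (ConfRing.span_eq_top n B)) (ofCoords_str _ _ _) :
    Over.mk (ConfRing.str n) ⟶ prodPB n).left

/-- The Deligne–Mumford space `M̄_{n+1}` of stable genus `0` curves with `n + 1` marked points, as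
the wonderful compactification of the complement of the projectivized braid arrangement: the
closure of `M_{n+1} = (ℂ^n \ Δ) / B` in the product of the `ℙ(ℂ^B / ℂ)`. -/
def MBar : Scheme.{0} := (ConfRing.toProd n).image

variable (hn : 2 ≤ n)

lemma univ_nontrivial (hn : 2 ≤ n) : (Finset.univ : Finset (Fin n)).Nontrivial := by
  rw [← Finset.one_lt_card_iff_nontrivial]
  simp only [Finset.card_univ, Fintype.card_fin]
  omega

/-- The projective space `ℙ(𝔱_n)`, where `𝔱_n = ℂ^n / ℂ`. -/
abbrev Pt : Scheme.{0} := PB (Finset.univ : Finset (Fin n)) (univ_nontrivial n hn)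

/-- The morphism `M̄_{n+1} ⟶ ℙ(𝔱_n)` collapsing a curve to the component containing `z_{n+1} = ∞`
and remembering the positions of the other marked points: the projection to the factor with
`B = [n]`. -/
def MBar.collapse : MBar n ⟶ Pt n hn :=
  (ConfRing.toProd n).imageι ≫
    (Pi.π (fun B : Subsets n ↦ PS.over (Coord B.1 B.2) ℂ) ⟨_, univ_nontrivial n hn⟩).left

/-- The index `b` which is the base point of `[n]`. -/
abbrev origin : Fin n := base Finset.univ (univ_nontrivial n hn)

/-- The functions `δ_bi`, where `b` is the base point of `[n]`. -/
def originDelta (i : Coord (Finset.univ : Finset (Fin n)) (univ_nontrivial n hn)) : CfRing n :=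
  delta (pr (origin n hn) i.1 i.2.2.symm)

lemma identityIdeal_le :
    identityIdeal n ≤ Ideal.span (Set.range (originDelta n hn)) := by
  set J := Ideal.span (Set.range (originDelta n hn)) with hJ
  have h1 : ∀ (i : Fin n) (h : origin n hn ≠ i), delta (pr _ i h) ∈ J := fun i h ↦
    Ideal.subset_span ⟨⟨i, Finset.mem_univ _, h.symm⟩, rfl⟩
  have h2 : ∀ (i : Fin n) (h : i ≠ origin n hn), delta (pr i _ h) ∈ J := by
    intro i h
    have := delta_add_delta n i _ h
    rw [show delta (pr i _ h) = (algebraMap Base (CfRing n) eps * delta (pr i _ h) - 1) *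
      delta (pr _ i h.symm) by linear_combination this]
    exact J.mul_mem_left _ (h1 i h.symm)
  rw [identityIdeal, Ideal.span_le]
  rintro _ ⟨⟨⟨i, j⟩, hij⟩, rfl⟩
  change delta (pr i j hij) ∈ J
  by_cases hi : i = origin n hn
  · subst hi
    exact h1 j hij
  by_cases hj : j = origin n hn
  · subst hj
    exact h2 i hij
  have := delta_cocycle n i (origin n hn) j hi hij (Ne.symm hj)
  rw [show delta (pr i j hij) = delta (pr i _ hi) + delta (pr _ j (Ne.symm hj)) -
    algebraMap Base (CfRing n) eps * delta (pr i _ hi) * delta (pr _ j (Ne.symm hj)) by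
    linear_combination this]
  exact J.sub_mem (J.add_mem (h2 i hi) (h1 j _))
    (J.mul_mem_left _ (h1 j _))

/-- The morphism `ℰ_{n+1} ⟶ ℙ(𝔱_n)`, given in the homogeneous coordinates `u_i - u_b` by the
functions `δ_bi`. In terms of `(u, y, ε)` with `δ_ij = (u_i - u_j) / (y + ε u_i)` it is
`(u, y, ε) ↦ [u]`, since `y + ε u_b` is a common denominator of the `δ_bi`. -/
def E.toPt : E n ⟶ Pt n hn :=
  Blowup.toPS (k := ℂ) (identityIdeal n) (originDelta n hn)
    (fun _ ↦ Ideal.subset_span ⟨_, rfl⟩) (identityIdeal_le n hn)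

/-- The deformed line bundle `M̄_{n+1} ×_{ℙ(𝔱_n)} ℰ_{n+1}` over `M̄_{n+1}`. -/
def MTilde : Scheme.{0} := pullback (MBar.collapse n hn) (E.toPt n hn)

/-- The morphism from the deformed line bundle to `Cf_n`. -/
def MTilde.toCf : MTilde n hn ⟶ Spec (.of (CfRing n)) :=
  pullback.snd (MBar.collapse n hn) (E.toPt n hn) ≫ E.toCf n

end M

end MauWoodward

end

/-! On `Qcirc` one has `δ_ik = μ_ijk δ_ij`, and `μ_ijk` plays the role of the ratio `(u_i - u_k) /
(u_i - u_j)`. So a point of `Qcirc` is a point of `Cf` with a compatible system of ratios, whereas a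
point of `MTilde` is a point of `Cf`, a point `[w]` of `ℙ(𝔱_n)` attached to it by the blowup, and a
point of `MBar` that collapses to `[w]`. The theorem says that these data are equivalent. Two facts
carry it.

The equations between the `μ_ijk` define `MBar` scheme-theoretically. Since `MBar` is a closure, the
difficulty is to show that a solution with values in an arbitrary local ring `A`, nilpotents
included, lies in it. By `RatioSystem.exists_lifts` such a solution is the image, under a local
homomorphism `D → A` from a domain, of the ratios of differences of distinct points `u_i` of `D`.
The points are added one at a time: if `p` belongs to a smallest cluster, one ratio involving `p`
determines all the others, and it can be lifted to a new variable. The resulting `D`-point is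
generically a configuration, hence lies in the closure (`MBar.exists_lift_of_isDomain`). Conversely,
identities valid for configurations extend to their closure (`ConfRelation.eq_zero`).

The blowup of the identity section is the subscheme of `Cf × ℙ(𝔱_n)` given by `q_i δ_bj = q_j δ_bi`,
because the `δ_bi` are independent coordinates on `Cf` over the `ε`-line. `E.exists_lift` reduces
this to a universal solution in a localized polynomial ring, where `δ_bj` is not a zero divisor;
`E.hom_ext` is the uniqueness.

In one direction, `[u_i - u_b]_{i ∈ B}` is recovered from the `μ_bji` with `j` farthest from `b` in
`B`, and for `B = [n]` it is proportional to the `δ_bi`, which gives the map to the blowup. In the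
other, `μ_ijk` is read off at `B = {i, j, k}`, and the mixed equations follow from the equations of
the blowup and the proportionality of `u|_B` and `u|_[n]`. The two morphisms are inverse to each
other because both sides are determined by `δ` and by coordinates in products of projective spaces,
and these coordinates match. -/

noncomputable section

namespace MauWoodward

/-! ### Functions and morphisms determined locally or on stalks -/

section General

/-- The pullback of global functions along a morphism of schemes. -/
abbrev pull {T' T : Scheme.{0}} (t : T' ⟶ T) : Γ(T, ⊤) →+* Γ(T', ⊤) := t.appTop.hom

lemma pull_comp {T'' T' T : Scheme.{0}} (u : T'' ⟶ T') (t : T' ⟶ T) (a : Γ(T, ⊤)) :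
    pull (u ≫ t) a = pull u (pull t a) := by
  rw [pull, Scheme.Hom.comp_appTop]
  rfl

lemma exists_affine_of_mem {T : Scheme.{0}} {U : T.Opens} {x : T} (hx : x ∈ U) :
    ∃ V : T.affineOpens, x ∈ V.1 ∧ V.1 ≤ U := by
  obtain ⟨_, ⟨V, hV, rfl⟩, hxV, hVU⟩ :=
    T.isBasis_affineOpens.exists_subset_of_mem_open hx U.isOpen
  exact ⟨⟨V, hV⟩, hxV, hVU⟩

lemma eq_of_pull_fromSpecStalk {T : Scheme.{0}} {a b : Γ(T, ⊤)}
    (h : ∀ x : T, pull (T.fromSpecStalk x) a = pull (T.fromSpecStalk x) b) : a = b := by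
  refine TopCat.Presheaf.section_ext T.sheaf _ _ _ fun x hx ↦ ?_
  have := h x
  rw [pull, Scheme.fromSpecStalk_appTop] at this
  have h1 : (homOfLE (le_top (a := (⊤ : (Spec (T.presheaf.stalk x)).Opens)))).op = 𝟙 _ := rfl
  simp only [h1, CategoryTheory.Functor.map_id, Category.comp_id, CommRingCat.hom_comp,
    RingHom.comp_apply] at this
  exact (ConcreteCategory.bijective_of_isIso (Scheme.ΓSpecIso (T.presheaf.stalk x)).inv).1 this

lemma eq_of_pull_opens {T : Scheme.{0}} {a b : Γ(T, ⊤)}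
    (h : ∀ x : T, ∃ U : T.Opens, x ∈ U ∧ pull U.ι a = pull U.ι b) : a = b := by
  refine eq_of_pull_fromSpecStalk fun x ↦ ?_
  obtain ⟨U, hx, hU⟩ := h x
  rw [← Scheme.Opens.fromSpecStalkOfMem_ι U x hx, pull_comp, pull_comp, hU]

lemma hom_ext_of_opens {T Y : Scheme.{0}} {f g : T ⟶ Y}
    (h : ∀ x : T, ∃ U : T.Opens, x ∈ U ∧ U.ι ≫ f = U.ι ≫ g) : f = g :=
  Scheme.hom_ext_of_forall f g h

lemma exists_glue {T Y : Scheme.{0}} {ι : Type*} (U : ι → T.Opens)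
    (hU : ∀ x : T, ∃ i, x ∈ U i) (f : ∀ i, (U i).toScheme ⟶ Y)
    (hf : ∀ i j, T.homOfLE (inf_le_left : U i ⊓ U j ≤ U i) ≫ f i =
      T.homOfLE (inf_le_right : U i ⊓ U j ≤ U j) ≫ f j) :
    ∃ φ : T ⟶ Y, ∀ i, (U i).ι ≫ φ = f i := by
  have hc : TopologicalSpace.IsOpenCover U := by
    refine TopologicalSpace.Opens.ext (Set.eq_univ_of_forall fun x ↦ ?_)
    obtain ⟨i, hi⟩ := hU x
    exact TopologicalSpace.Opens.mem_iSup.2 ⟨i, hi⟩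
  refine ⟨(T.openCoverOfIsOpenCover U hc).glueMorphisms f ?_, ?_⟩
  · intro i j
    change pullback.fst (U i).ι (U j).ι ≫ f i = pullback.snd (U i).ι (U j).ι ≫ f j
    rw [← cancel_epi (isPullback_opens_inf (U i) (U j)).isoPullback.hom,
      IsPullback.isoPullback_hom_fst_assoc, IsPullback.isoPullback_hom_snd_assoc]
    exact hf i j
  · intro i
    exact (T.openCoverOfIsOpenCover U hc).ι_glueMorphisms f _ i

/-- A morphism factors through a closed immersion when it kills the ideal of the latter, and a
section vanishes when its germs do. This reduces every factorization below to local rings, over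
which each point of a projective space has some coordinate equal to `1`. -/
lemma exists_lift_of_stalks {T Y Z : Scheme.{0}} (i : Y ⟶ Z) [IsClosedImmersion i] (f : T ⟶ Z)
    (h : ∀ x : T, ∃ l : Spec (T.presheaf.stalk x) ⟶ Y, l ≫ i = T.fromSpecStalk x ≫ f) :
    ∃ l : T ⟶ Y, l ≫ i = f := by
  refine ⟨IsClosedImmersion.lift i f ?_, IsClosedImmersion.lift_fac _ _ _⟩
  refine Scheme.IdealSheafData.le_ofIdeals_iff.2 fun U a ha ↦ ?_
  have ha' : i.app U.1 a = 0 := i.ideal_ker_le U ha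
  rw [RingHom.mem_ker]
  refine TopCat.Presheaf.section_ext T.sheaf _ _ _ fun x hx ↦ ?_
  obtain ⟨l, hl⟩ := h x
  have h1 : (T.fromSpecStalk x ≫ f).app U.1 a = 0 := by
    rw [← hl]
    change l.app _ (i.app U.1 a) = 0
    rw [ha', map_zero]
  change (T.fromSpecStalk x).app (f ⁻¹ᵁ U.1) (f.app U.1 a) = 0 at h1
  rw [Scheme.fromSpecStalk_app hx] at h1
  -- An open subset of a local scheme that contains the closed point is everything, so vanishing on
  -- it is vanishing of the germ.
  have h2 : T.fromSpecStalk x ⁻¹ᵁ (f ⁻¹ᵁ U.1) = ⊤ :=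
    Scheme.preimage_eq_top_of_closedPoint_mem _ (by simpa using hx)
  have h3 : IsIso ((Spec (T.presheaf.stalk x)).presheaf.map
      (homOfLE (le_top (a := T.fromSpecStalk x ⁻¹ᵁ (f ⁻¹ᵁ U.1)))).op) := by
    have : IsIso (homOfLE (le_top (a := T.fromSpecStalk x ⁻¹ᵁ (f ⁻¹ᵁ U.1)))) :=
      ⟨homOfLE h2.ge, rfl, rfl⟩
    infer_instance
  have h4 := ConcreteCategory.bijective_of_isIso
    ((Scheme.ΓSpecIso (T.presheaf.stalk x)).inv ≫ (Spec (T.presheaf.stalk x)).presheaf.map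
      (homOfLE (le_top (a := T.fromSpecStalk x ⁻¹ᵁ (f ⁻¹ᵁ U.1)))).op)
  have h5 : T.presheaf.germ (f ⁻¹ᵁ U.1) x hx (f.app U.1 a) = 0 :=
    h4.1 (h1.trans (map_zero _).symm)
  exact h5.trans (map_zero (T.presheaf.germ (f ⁻¹ᵁ U.1) x hx).hom).symm

end General

/-! ### Morphisms to `Proj` that land in one standard chart -/

section ProjPoints

variable {σ A : Type} [CommRing A] [SetLike σ A] [AddSubgroupClass σ A] (𝒜 : ℕ → σ)
  [GradedRing 𝒜]

/-- The homomorphism out of the degree zero part of `A_r` induced by a homomorphism out of `A`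
that maps `r` to a unit. -/
def awayLift {B : Type} [CommRing B] (f : A →+* B) {r : A} (hr : IsUnit (f r)) :
    HomogeneousLocalization.Away 𝒜 r →+* B :=
  (IsLocalization.Away.lift r hr : Localization.Away r →+* B).comp
    (algebraMap (HomogeneousLocalization.Away 𝒜 r) (Localization.Away r))

lemma awayLift_mk_mul {B : Type} [CommRing B] (f : A →+* B) {r : A} (hr : IsUnit (f r)) {d : ℕ}
    (hd : r ∈ 𝒜 d) (n : ℕ) (x : A) (hx : x ∈ 𝒜 (n • d)) :
    awayLift 𝒜 f hr (HomogeneousLocalization.Away.mk 𝒜 hd n x hx) * f r ^ n = f x := by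
  rw [awayLift, RingHom.comp_apply, HomogeneousLocalization.algebraMap_apply,
    HomogeneousLocalization.Away.val_mk, Localization.mk_eq_mk']
  have := IsLocalization.mk'_spec (Localization.Away r) x
    (⟨r ^ n, n, rfl⟩ : Submonoid.powers r)
  have := congrArg (IsLocalization.Away.lift r hr : Localization.Away r →+* B) this
  simpa using this

/-- The morphism to `Proj` is glued from its restrictions to the sets where some `f r` is
invertible. If `f r` pulls back to a unit, then `t` lands in a single one of these sets, and the
composite is described by one ring homomorphism out of the degree zero part of `A_r`. -/
theorem comp_fromOfGlobalSections_of_isUnit {X' X : Scheme.{0}} (t : X' ⟶ X) (f : A →+* Γ(X, ⊤))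
    (hf : (HomogeneousIdeal.irrelevant 𝒜).toIdeal.map f = ⊤) {r : A} {n : ℕ} (hn : 0 < n)
    (hr : r ∈ 𝒜 n) (g : A →+* Γ(X', ⊤)) (hg : (pull t).comp f = g) (hu : IsUnit (g r)) :
    t ≫ Proj.fromOfGlobalSections 𝒜 f hf =
      X'.toSpecΓ ≫ Spec.map (CommRingCat.ofHom (awayLift 𝒜 g hu)) ≫ Proj.awayι 𝒜 r hr hn := by
  subst hg
  have hrange : Set.range t ⊆ Set.range (X.basicOpen (f r)).ι := by
    rw [Scheme.Opens.range_ι]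
    rintro _ ⟨x, rfl⟩
    have h := Scheme.preimage_basicOpen t (f r)
    have h' : X'.basicOpen (pull t (f r)) = ⊤ := Scheme.basicOpen_of_isUnit _ hu
    exact ((h.trans h').ge trivial : x ∈ t ⁻¹ᵁ X.basicOpen (f r))
  let t' := IsOpenImmersion.lift (X.basicOpen (f r)).ι t hrange
  have ht' : t' ≫ (X.basicOpen (f r)).ι = t := IsOpenImmersion.lift_fac _ _ _
  let V : (Spec Γ(X, ⊤)).Opens := PrimeSpectrum.basicOpen (f r)
  let a := (X.isoOfEq (X.toSpecΓ_preimage_basicOpen (f r))).inv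
  let b : _ ⟶ V.toScheme := X.toSpecΓ ∣_ V
  let c : V.toScheme ⟶ _ := (basicOpenIsoSpecAway (f r)).hom
  have h2 : (a ≫ b ≫ c) ≫ Spec.map (CommRingCat.ofHom (algebraMap _ (Localization.Away (f r)))) =
      (X.basicOpen (f r)).ι ≫ X.toSpecΓ := by
    rw [Category.assoc, Category.assoc]
    refine (congrArg (fun z ↦ a ≫ b ≫ z) (basicOpenIsoSpecAway_hom_SpecMap (f r))).trans ?_
    exact (congrArg (_ ≫ ·) (morphismRestrict_ι X.toSpecΓ V)).trans
      (Scheme.isoOfEq_inv_ι_assoc X (X.toSpecΓ_preimage_basicOpen (f r)) X.toSpecΓ)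
  let l : Localization.Away (f r) →+* Γ(X', ⊤) := IsLocalization.Away.lift (f r) (g := pull t) hu
  -- Both sides are maps to `Spec` of a localization, which is a monomorphism into `Spec Γ(X, ⊤)`;
  -- it suffices to compare them there.
  have h3 : t' ≫ a ≫ b ≫ c = X'.toSpecΓ ≫ Spec.map (CommRingCat.ofHom l) := by
    have : Mono (Spec.map (CommRingCat.ofHom (algebraMap Γ(X, ⊤) (Localization.Away (f r))))) := by
      have := IsOpenImmersion.of_isLocalization (S := Localization.Away (f r)) (f r)
      infer_instance
    rw [← cancel_mono (Spec.map (CommRingCat.ofHom (algebraMap Γ(X, ⊤) (Localization.Away (f r))))),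
      Category.assoc, h2, Category.assoc, ← Spec.map_comp, ← CommRingCat.ofHom_comp,
      ← Category.assoc, ht', Scheme.toSpecΓ_naturality]
    congr 2
    ext x
    simp [l]
  have h4 : (X.basicOpen (f r)).ι ≫ Proj.fromOfGlobalSections 𝒜 f hf = (a ≫ b ≫ c) ≫
      Spec.map (CommRingCat.ofHom (RingHom.comp
      (IsLocalization.map (M := .powers r) (T := .powers (f r)) (Localization.Away (f r)) f
        (by rw [← Submonoid.map_le_iff_le_comap, Submonoid.map_powers]))
        (algebraMap (HomogeneousLocalization.Away 𝒜 r) (Localization.Away r)))) ≫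
      Proj.awayι 𝒜 r hr hn := by
    refine ((Proj.openCoverOfMapIrrelevantEqTop 𝒜 f hf).ι_glueMorphisms _ _
      ⟨n, r, hn, hr⟩).trans ?_
    simp only [Category.assoc]
    rfl
  have h5 : t ≫ Proj.fromOfGlobalSections 𝒜 f hf =
      t' ≫ (X.basicOpen (f r)).ι ≫ Proj.fromOfGlobalSections 𝒜 f hf := by
    rw [← Category.assoc, ht']
  rw [h5, h4, ← Category.assoc, h3, Category.assoc, ← Spec.map_comp_assoc,
    ← CommRingCat.ofHom_comp]
  congr 4
  rw [awayLift, ← RingHom.comp_assoc]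
  congr 1
  refine IsLocalization.ringHom_ext (M := .powers r) ?_
  ext x
  simp [l]

theorem fromOfGlobalSections_eq_of_isUnit {X : Scheme.{0}} (f : A →+* Γ(X, ⊤))
    (hf : (HomogeneousIdeal.irrelevant 𝒜).toIdeal.map f = ⊤) {r : A} {n : ℕ} (hn : 0 < n)
    (hr : r ∈ 𝒜 n) (hu : IsUnit (f r)) :
    Proj.fromOfGlobalSections 𝒜 f hf =
      X.toSpecΓ ≫ Spec.map (CommRingCat.ofHom (awayLift 𝒜 f hu)) ≫ Proj.awayι 𝒜 r hr hn := by
  rw [← comp_fromOfGlobalSections_of_isUnit 𝒜 (𝟙 X) f hf hn hr f (by ext; simp [pull]) hu,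
    Category.id_comp]

lemma ringHom_eq_of_toSpecΓ_comp {X : Scheme.{0}} {B : Type} [CommRing B] {a b : B →+* Γ(X, ⊤)}
    (h : X.toSpecΓ ≫ Spec.map (CommRingCat.ofHom a) = X.toSpecΓ ≫ Spec.map (CommRingCat.ofHom b)) :
    a = b := by
  have h1 := congrArg (fun z ↦ (Scheme.ΓSpecIso (.of B)).inv ≫ z.appTop) h
  simp only [Scheme.Hom.comp_appTop, ← Scheme.ΓSpecIso_inv_naturality_assoc,
    Scheme.toSpecΓ_appTop, Iso.inv_hom_id, Category.comp_id] at h1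
  exact congrArg CommRingCat.Hom.hom h1

lemma exists_eq_toSpecΓ_comp {X : Scheme.{0}} {B : Type} [CommRing B] (ψ : X ⟶ Spec (.of B)) :
    ∃ a : B →+* Γ(X, ⊤), ψ = X.toSpecΓ ≫ Spec.map (CommRingCat.ofHom a) := by
  refine ⟨((Scheme.ΓSpecIso (.of B)).inv ≫ ψ.appTop).hom, ?_⟩
  simp only [CommRingCat.ofHom_hom, Spec.map_comp]
  rw [← Scheme.toSpecΓ_naturality_assoc, ← SpecMap_ΓSpecIso_hom, ← Spec.map_comp,
    Iso.inv_hom_id, Spec.map_id, Category.comp_id]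

lemma exists_eq_toSpecΓ_comp_awayι {X : Scheme.{0}} (t : X ⟶ Proj 𝒜) {r : A} {n : ℕ} (hn : 0 < n)
    (hr : r ∈ 𝒜 n) (h : t ⁻¹ᵁ Proj.basicOpen 𝒜 r = ⊤) :
    ∃ a : HomogeneousLocalization.Away 𝒜 r →+* Γ(X, ⊤),
      t = X.toSpecΓ ≫ Spec.map (CommRingCat.ofHom a) ≫ Proj.awayι 𝒜 r hr hn := by
  have hrange : Set.range t ⊆ Set.range (Proj.awayι 𝒜 r hr hn) := by
    rintro _ ⟨x, rfl⟩
    have hx : x ∈ t ⁻¹ᵁ Proj.basicOpen 𝒜 r := h.ge trivial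
    rw [← Proj.opensRange_awayι 𝒜 r hr hn] at hx
    exact hx
  obtain ⟨a, ha⟩ := exists_eq_toSpecΓ_comp (IsOpenImmersion.lift (Proj.awayι 𝒜 r hr hn) t hrange)
  refine ⟨a, ?_⟩
  rw [← Category.assoc, ← ha, IsOpenImmersion.lift_fac]

lemma exists_mem_basicOpen {T : Scheme.{0}} {ι : Type*} {s : ι → Γ(T, ⊤)}
    (hs : Ideal.span (Set.range s) = ⊤) (x : T) : ∃ i, x ∈ T.basicOpen (s i) := by
  by_contra! h
  have h1 : Ideal.span (Set.range s) ≤ (IsLocalRing.maximalIdeal (T.presheaf.stalk x)).comap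
      (T.presheaf.germ ⊤ x trivial).hom := by
    rw [Ideal.span_le]
    rintro _ ⟨i, rfl⟩
    have := h i
    rw [Scheme.mem_basicOpen_top] at this
    exact this
  rw [hs] at h1
  have h2 : (1 : Γ(T, ⊤)) ∈ (IsLocalRing.maximalIdeal (T.presheaf.stalk x)).comap
      (T.presheaf.germ ⊤ x trivial).hom := h1 trivial
  exact (Ideal.ne_top_iff_one _).1 (Ideal.IsPrime.ne_top inferInstance) h2

lemma span_range_pull {T' T : Scheme.{0}} {ι : Type*} (t : T' ⟶ T) {s : ι → Γ(T, ⊤)}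
    (hs : Ideal.span (Set.range s) = ⊤) :
    Ideal.span (Set.range fun i ↦ pull t (s i)) = ⊤ := by
  have := congrArg (Ideal.map (pull t)) hs
  rwa [Ideal.map_span, Ideal.map_top, ← Set.range_comp] at this

lemma isUnit_of_forall_mem_basicOpen {T : Scheme.{0}} {a : Γ(T, ⊤)} (h : ∀ x, x ∈ T.basicOpen a) :
    IsUnit a := by
  refine T.toRingedSpace.isUnit_of_isUnit_germ ⊤ a fun x hx ↦ ?_
  exact (Scheme.mem_basicOpen_top _ _ _).1 (h x)

lemma mem_basicOpen_pull {T' T : Scheme.{0}} (t : T' ⟶ T) (a : Γ(T, ⊤)) (x : T') :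
    x ∈ T'.basicOpen (pull t a) ↔ t x ∈ T.basicOpen a :=
  SetLike.ext_iff.1 (Scheme.preimage_basicOpen t a).symm x

lemma isUnit_pull_of_le {T : Scheme.{0}} {U : T.Opens} {a : Γ(T, ⊤)} (h : U ≤ T.basicOpen a) :
    IsUnit (pull U.ι a) :=
  isUnit_of_forall_mem_basicOpen fun x ↦ (mem_basicOpen_pull _ _ _).2 (h x.2)

end ProjPoints

/-! ### The standard charts of projective space -/

section Coords

variable {σ k : Type} [CommRing k]

lemma scalars_comp {T' T : Scheme.{0}} (t : T' ⟶ T) (g : T ⟶ Spec (.of k)) :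
    scalars (t ≫ g) = (pull t).comp (scalars g) := by
  ext x
  simp only [scalars, Scheme.Hom.comp_appTop]
  rfl

lemma pull_evalSections {T' T : Scheme.{0}} (t : T' ⟶ T) (g : T ⟶ Spec (.of k))
    (s : σ → Γ(T, ⊤)) (f : MvPolynomial σ k) :
    pull t (evalSections g s f) = evalSections (t ≫ g) (fun i ↦ pull t (s i)) f := by
  rw [evalSections, evalSections, scalars_comp, MvPolynomial.coe_eval₂Hom,
    MvPolynomial.coe_eval₂Hom, MvPolynomial.eval₂_comp_left]
  rfl

lemma eq_toSpecΓ_comp_scalars {T : Scheme.{0}} (g : T ⟶ Spec (.of k)) :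
    g = T.toSpecΓ ≫ Spec.map (CommRingCat.ofHom (scalars g)) := by
  simp only [scalars, CommRingCat.ofHom_hom, Spec.map_comp]
  rw [← Scheme.toSpecΓ_naturality_assoc, ← SpecMap_ΓSpecIso_hom, ← Spec.map_comp,
    Iso.inv_hom_id, Spec.map_id, Category.comp_id]

lemma scalars_toSpecΓ_comp {T : Scheme.{0}} (b : k →+* Γ(T, ⊤)) :
    scalars (T.toSpecΓ ≫ Spec.map (CommRingCat.ofHom b)) = b :=
  ringHom_eq_of_toSpecΓ_comp (eq_toSpecΓ_comp_scalars _).symm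

/-- The constants in the degree zero part of `k[x_i]_r`. -/
def awayConst (r : MvPolynomial σ k) : k →+* HomogeneousLocalization.Away (stdGrading σ k) r :=
  (HomogeneousLocalization.fromZeroRingHom (stdGrading σ k) (.powers r)).comp
    (algebraMap k (stdGrading σ k 0))

lemma X_mem_stdGrading (i : σ) : (MvPolynomial.X i : MvPolynomial σ k) ∈ stdGrading σ k 1 :=
  MvPolynomial.isHomogeneous_X k i

/-- The function `x_j / x_i`. -/
def ratio (i j : σ) : HomogeneousLocalization.Away (stdGrading σ k) (MvPolynomial.X i) :=
  HomogeneousLocalization.Away.mk (stdGrading σ k) (d := 1) (X_mem_stdGrading i) 1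
    (MvPolynomial.X j) (by simpa using MvPolynomial.isHomogeneous_X k j)

lemma eval₂_smul_of_isHomogeneous {B : Type*} [CommRing B] (g : k →+* B) (s : σ → B) (c : B)
    {f : MvPolynomial σ k} {n : ℕ} (hf : f.IsHomogeneous n) :
    MvPolynomial.eval₂ g (fun i ↦ c * s i) f = c ^ n * MvPolynomial.eval₂ g s f := by
  rw [MvPolynomial.eval₂_eq, MvPolynomial.eval₂_eq, Finset.mul_sum]
  refine Finset.sum_congr rfl fun d hd ↦ ?_
  have hdeg : ∑ i ∈ d.support, d i = n := by
    have := hf (MvPolynomial.mem_support_iff.1 hd)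
    simpa [Finsupp.weight_apply, Finsupp.sum] using this
  simp only [mul_pow, Finset.prod_mul_distrib]
  rw [Finset.prod_pow_eq_pow_sum, hdeg]
  ring

/-- Dehomogenization: by homogeneity `x_i ^ n f(x_j / x_i) = f(x_j)`, and `x_i` can be cancelled in
the localization. Hence the chart is generated over `k` by the ratios `x_j / x_i`, which is what
`away_hom_ext` uses. -/
lemma away_mk_eq_eval₂ (i : σ) (n : ℕ) (f : MvPolynomial σ k) (hf : f ∈ stdGrading σ k (n • 1)) :
    HomogeneousLocalization.Away.mk (stdGrading σ k) (d := 1) (X_mem_stdGrading i)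
      n f hf = MvPolynomial.eval₂ (awayConst (MvPolynomial.X i)) (ratio i) f := by
  apply HomogeneousLocalization.val_injective
  set Q := Localization.Away (MvPolynomial.X i : MvPolynomial σ k) with hQ
  have hu : IsUnit (algebraMap (MvPolynomial σ k) Q (MvPolynomial.X i)) :=
    IsLocalization.Away.algebraMap_isUnit _
  have h1 : (MvPolynomial.eval₂ (awayConst (MvPolynomial.X i)) (ratio i) f).val =
      MvPolynomial.eval₂ ((algebraMap (MvPolynomial σ k) Q).comp MvPolynomial.C)
        (fun j ↦ (ratio i j : HomogeneousLocalization.Away (stdGrading σ k)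
          (MvPolynomial.X i)).val) f := by
    have := MvPolynomial.hom_eval₂ f (awayConst (MvPolynomial.X i))
      (algebraMap (HomogeneousLocalization.Away (stdGrading σ k) (MvPolynomial.X i)) Q) (ratio i)
    rw [HomogeneousLocalization.algebraMap_apply] at this
    rw [this]
    congr 1
  have h2 : ∀ j, algebraMap (MvPolynomial σ k) Q (MvPolynomial.X i) *
      (ratio i j : HomogeneousLocalization.Away (stdGrading σ k) (MvPolynomial.X i)).val =
      algebraMap (MvPolynomial σ k) Q (MvPolynomial.X j) := by
    intro j
    rw [ratio, HomogeneousLocalization.Away.val_mk, Localization.mk_eq_mk', mul_comm]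
    have := IsLocalization.mk'_spec Q (MvPolynomial.X j)
      (⟨MvPolynomial.X i ^ 1, 1, rfl⟩ : Submonoid.powers (MvPolynomial.X i : MvPolynomial σ k))
    simp only [pow_one] at this ⊢
    exact this
  have hf' : f.IsHomogeneous n := by simpa using hf
  have h3 := eval₂_smul_of_isHomogeneous ((algebraMap (MvPolynomial σ k) Q).comp MvPolynomial.C)
    (fun j ↦ (ratio i j : HomogeneousLocalization.Away (stdGrading σ k) (MvPolynomial.X i)).val)
    (algebraMap (MvPolynomial σ k) Q (MvPolynomial.X i)) hf'
  simp only [h2] at h3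
  have h4 : MvPolynomial.eval₂ ((algebraMap (MvPolynomial σ k) Q).comp MvPolynomial.C)
      (fun j ↦ algebraMap (MvPolynomial σ k) Q (MvPolynomial.X j)) f =
      algebraMap (MvPolynomial σ k) Q f := by
    have := MvPolynomial.hom_eval₂ f MvPolynomial.C (algebraMap (MvPolynomial σ k) Q)
      MvPolynomial.X
    rw [MvPolynomial.eval₂_eta] at this
    exact this.symm
  rw [h1]
  refine (hu.pow n).mul_left_cancel ?_
  rw [← h3, h4, HomogeneousLocalization.Away.val_mk, Localization.mk_eq_mk', mul_comm]
  rw [← map_pow]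
  exact IsLocalization.mk'_spec Q f
    (⟨MvPolynomial.X i ^ n, n, rfl⟩ : Submonoid.powers (MvPolynomial.X i : MvPolynomial σ k))

lemma away_hom_ext {B : Type*} [CommRing B] {i : σ}
    {a a' : HomogeneousLocalization.Away (stdGrading σ k) (MvPolynomial.X i) →+* B}
    (hk : ∀ c, a (awayConst _ c) = a' (awayConst _ c)) (hX : ∀ j, a (ratio i j) = a' (ratio i j)) :
    a = a' := by
  ext x
  obtain ⟨n, f, hf, rfl⟩ := HomogeneousLocalization.Away.mk_surjective (stdGrading σ k)
    (d := 1) (X_mem_stdGrading i) x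
  rw [away_mk_eq_eval₂, MvPolynomial.hom_eval₂, MvPolynomial.hom_eval₂]
  congr 1
  · exact RingHom.ext hk
  · exact funext hX

end Coords

/-! ### Homogeneous coordinates of morphisms to projective space -/

section Coords

variable {σ k : Type} [CommRing k]

/-- The global functions `s i` are homogeneous coordinates of `φ`. -/
def Coords {T : Scheme.{0}} (φ : T ⟶ PS σ k) (s : σ → Γ(T, ⊤)) : Prop :=
  ∃ hs : Ideal.span (Set.range s) = ⊤, φ = ofCoords (φ ≫ PS.str σ k) s hs

lemma coords_ofCoords {T : Scheme.{0}} (g : T ⟶ Spec (.of k)) (s : σ → Γ(T, ⊤))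
    (hs : Ideal.span (Set.range s) = ⊤) : Coords (ofCoords g s hs) s :=
  ⟨hs, by simp only [ofCoords_str]⟩

lemma ofCoords_congr {T : Scheme.{0}} {g g' : T ⟶ Spec (.of k)} {s s' : σ → Γ(T, ⊤)}
    (hg : g = g') (h : s = s') (hs : Ideal.span (Set.range s) = ⊤)
    (hs' : Ideal.span (Set.range s') = ⊤) : ofCoords g s hs = ofCoords g' s' hs' := by
  subst h hg; rfl

lemma isUnit_evalSections_X {T : Scheme.{0}} (g : T ⟶ Spec (.of k)) {s : σ → Γ(T, ⊤)} {i : σ}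
    (h : IsUnit (s i)) : IsUnit (evalSections g s (MvPolynomial.X i)) := by
  simpa [evalSections] using h

lemma comp_ofCoords_eq {T' T : Scheme.{0}} (t : T' ⟶ T) (g : T ⟶ Spec (.of k)) (s : σ → Γ(T, ⊤))
    (hs : Ideal.span (Set.range s) = ⊤) {i : σ} (h : IsUnit (pull t (s i))) :
    t ≫ ofCoords g s hs = T'.toSpecΓ ≫ Spec.map (CommRingCat.ofHom (awayLift (stdGrading σ k)
        (evalSections (t ≫ g) fun i ↦ pull t (s i)) (isUnit_evalSections_X _ h))) ≫
      Proj.awayι (stdGrading σ k) _ (X_mem_stdGrading i) one_pos :=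
  comp_fromOfGlobalSections_of_isUnit (stdGrading σ k) t _ _ one_pos (X_mem_stdGrading i) _
    (RingHom.ext fun x ↦ pull_evalSections t g s x) _

lemma ofCoords_eq {T : Scheme.{0}} (g : T ⟶ Spec (.of k)) (s : σ → Γ(T, ⊤))
    (hs : Ideal.span (Set.range s) = ⊤) {i : σ} (h : IsUnit (s i)) :
    ofCoords g s hs = T.toSpecΓ ≫ Spec.map (CommRingCat.ofHom (awayLift (stdGrading σ k)
        (evalSections g s) (isUnit_evalSections_X _ h))) ≫
      Proj.awayι (stdGrading σ k) _ (X_mem_stdGrading i) one_pos :=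
  fromOfGlobalSections_eq_of_isUnit (stdGrading σ k) _ _ one_pos (X_mem_stdGrading i) _

lemma comp_ofCoords {T' T : Scheme.{0}} (t : T' ⟶ T) (g : T ⟶ Spec (.of k)) (s : σ → Γ(T, ⊤))
    (hs : Ideal.span (Set.range s) = ⊤) :
    t ≫ ofCoords g s hs = ofCoords (t ≫ g) (fun i ↦ pull t (s i)) (span_range_pull t hs) := by
  refine hom_ext_of_opens fun x ↦ ?_
  obtain ⟨i, hi⟩ := exists_mem_basicOpen (span_range_pull t hs) x
  refine ⟨_, hi, ?_⟩
  set U := T'.basicOpen (pull t (s i)) with hU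
  have hu : IsUnit (pull U.ι (pull t (s i))) := isUnit_pull_of_le le_rfl
  have hu' : IsUnit (pull (U.ι ≫ t) (s i)) := by rwa [pull_comp]
  rw [comp_ofCoords_eq U.ι _ (fun i ↦ pull t (s i)) _ hu, ← Category.assoc,
    comp_ofCoords_eq (U.ι ≫ t) _ s _ hu']
  have : ∀ i, pull (U.ι ≫ t) (s i) = pull U.ι (pull t (s i)) := fun i ↦ pull_comp _ _ _
  simp only [this, Category.assoc]

lemma Coords.comp {T' T : Scheme.{0}} {φ : T ⟶ PS σ k} {s : σ → Γ(T, ⊤)} (h : Coords φ s)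
    (t : T' ⟶ T) : Coords (t ≫ φ) fun i ↦ pull t (s i) := by
  obtain ⟨hs, h⟩ := h
  refine ⟨span_range_pull t hs, ?_⟩
  conv_lhs => rw [h]
  rw [comp_ofCoords, Category.assoc]

lemma Coords.preimage_basicOpen {T : Scheme.{0}} {φ : T ⟶ PS σ k} {s : σ → Γ(T, ⊤)}
    (h : Coords φ s) (i : σ) :
    φ ⁻¹ᵁ Proj.basicOpen (stdGrading σ k) (MvPolynomial.X i) = T.basicOpen (s i) := by
  obtain ⟨hs, h⟩ := h
  rw [h, ofCoords,
    Proj.fromOfGlobalSections_preimage_basicOpen _ _ _ one_pos (X_mem_stdGrading i)]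
  simp [evalSections]

lemma awayLift_ratio {B : Type} [CommRing B] (f : MvPolynomial σ k →+* B) {i : σ}
    (h : IsUnit (f (MvPolynomial.X i))) (j : σ) :
    awayLift (stdGrading σ k) f h (ratio i j) * f (MvPolynomial.X i) = f (MvPolynomial.X j) := by
  have := awayLift_mk_mul (stdGrading σ k) f h (X_mem_stdGrading i) 1 (MvPolynomial.X j)
    (by simpa using X_mem_stdGrading j)
  rwa [pow_one] at this

lemma awayLift_awayConst {B : Type} [CommRing B] (f : MvPolynomial σ k →+* B)
    {r : MvPolynomial σ k} (h : IsUnit (f r)) (c : k) :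
    awayLift (stdGrading σ k) f h (awayConst r c) = f (MvPolynomial.C c) := by
  rw [awayLift, awayConst, RingHom.comp_apply, HomogeneousLocalization.algebraMap_apply]
  have : (HomogeneousLocalization.val ((HomogeneousLocalization.fromZeroRingHom (stdGrading σ k)
      (.powers r)).comp (algebraMap k (stdGrading σ k 0)) c)) =
      algebraMap (MvPolynomial σ k) (Localization.Away r) (MvPolynomial.C c) := rfl
  rw [this]
  exact IsLocalization.Away.lift_eq r h _

/-- Where `s l` is invertible, both families give the same homomorphism out of the chart `x_l ≠ 0`,
so the ratios `s i / s l` and `s' i / s' l` coincide. Together with `Coords.ext` this says that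
coordinates are unique exactly up to proportionality. -/
lemma Coords.mul_eq_mul {T : Scheme.{0}} {φ : T ⟶ PS σ k} {s s' : σ → Γ(T, ⊤)}
    (h : Coords φ s) (h' : Coords φ s') (i j : σ) : s i * s' j = s j * s' i := by
  refine eq_of_pull_opens fun x ↦ ?_
  obtain ⟨l, hl⟩ := exists_mem_basicOpen h.1 x
  refine ⟨_, hl, ?_⟩
  set U := T.basicOpen (s l) with hU
  have hu : IsUnit (pull U.ι (s l)) := isUnit_pull_of_le le_rfl
  -- The locus where `s l` is invertible is the preimage of the chart `x_l ≠ 0`, hence depends only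
  -- on `φ`.
  have hu' : IsUnit (pull U.ι (s' l)) :=
    isUnit_pull_of_le (by rw [hU, ← h.preimage_basicOpen, h'.preimage_basicOpen])
  obtain ⟨hs, e⟩ := h.comp U.ι
  obtain ⟨hs', e'⟩ := h'.comp U.ι
  rw [ofCoords_eq _ (fun i ↦ pull U.ι (s i)) _ hu] at e
  rw [ofCoords_eq _ (fun i ↦ pull U.ι (s' i)) _ hu'] at e'
  replace e' := e.symm.trans e'
  rw [← Category.assoc, ← Category.assoc, cancel_mono] at e'
  have e2 := ringHom_eq_of_toSpecΓ_comp e'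
  have h1 := awayLift_ratio (evalSections (((U.ι ≫ φ) ≫ PS.str σ k)) fun i ↦ pull U.ι (s i))
    (isUnit_evalSections_X _ hu)
  have h2 := awayLift_ratio (evalSections (((U.ι ≫ φ) ≫ PS.str σ k)) fun i ↦ pull U.ι (s' i))
    (isUnit_evalSections_X _ hu')
  rw [← e2] at h2
  simp only [evalSections, MvPolynomial.coe_eval₂Hom, MvPolynomial.eval₂_X] at h1 h2
  rw [map_mul, map_mul, ← h1 i, ← h1 j, ← h2 i, ← h2 j]
  ring

lemma Coords.ext {T : Scheme.{0}} {φ ψ : T ⟶ PS σ k} {s s' : σ → Γ(T, ⊤)}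
    (h : Coords φ s) (h' : Coords ψ s') (hg : φ ≫ PS.str σ k = ψ ≫ PS.str σ k)
    (hm : ∀ i j, s i * s' j = s j * s' i) : φ = ψ := by
  refine hom_ext_of_opens fun x ↦ ?_
  obtain ⟨l, hl⟩ := exists_mem_basicOpen h.1 x
  obtain ⟨m, hm'⟩ := exists_mem_basicOpen h'.1 x
  refine ⟨T.basicOpen (s l) ⊓ T.basicOpen (s' m), ⟨hl, hm'⟩, ?_⟩
  set U := T.basicOpen (s l) ⊓ T.basicOpen (s' m) with hU
  have hu : IsUnit (pull U.ι (s l)) := isUnit_pull_of_le inf_le_left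
  have hum : IsUnit (pull U.ι (s' m)) := isUnit_pull_of_le inf_le_right
  -- From `s l * s' m = s m * s' l`, whose left-hand side is a unit on `U`.
  have hu' : IsUnit (pull U.ι (s' l)) := by
    have := hu.mul hum
    rw [← map_mul, hm, map_mul] at this
    exact isUnit_of_mul_isUnit_right this
  obtain ⟨hs, e⟩ := h.comp U.ι
  obtain ⟨hs', e'⟩ := h'.comp U.ι
  rw [ofCoords_eq _ (fun i ↦ pull U.ι (s i)) _ hu] at e
  rw [ofCoords_eq _ (fun i ↦ pull U.ι (s' i)) _ hu'] at e'
  rw [e, e']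
  congr 3
  refine congrArg _ (away_hom_ext (fun c ↦ ?_) fun j ↦ ?_)
  · rw [awayLift_awayConst, awayLift_awayConst]
    simp only [Category.assoc, hg, evalSections, MvPolynomial.coe_eval₂Hom, MvPolynomial.eval₂_C]
  · have h1 := awayLift_ratio (evalSections (((U.ι ≫ φ) ≫ PS.str σ k)) fun i ↦ pull U.ι (s i))
      (isUnit_evalSections_X _ hu) j
    have h2 := awayLift_ratio (evalSections (((U.ι ≫ ψ) ≫ PS.str σ k)) fun i ↦ pull U.ι (s' i))
      (isUnit_evalSections_X _ hu') j
    simp only [evalSections, MvPolynomial.coe_eval₂Hom, MvPolynomial.eval₂_X] at h1 h2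
    refine (hu.mul hu').mul_left_cancel ?_
    have := congrArg (pull U.ι) (hm j l)
    rw [map_mul, map_mul] at this
    simp only [evalSections] at h1 h2 ⊢
    linear_combination pull U.ι (s' l) * h1 - pull U.ι (s l) * h2 + this

lemma span_eq_top_of_isUnit {A : Type*} [CommRing A] {s : σ → A} (i : σ) (h : IsUnit (s i)) :
    Ideal.span (Set.range s) = ⊤ :=
  Ideal.eq_top_of_isUnit_mem _ (Ideal.subset_span ⟨i, rfl⟩) h

lemma coords_of_eq_toSpecΓ_comp_awayι {T : Scheme.{0}} {φ : T ⟶ PS σ k} {i : σ}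
    {a : HomogeneousLocalization.Away (stdGrading σ k) (MvPolynomial.X i) →+* Γ(T, ⊤)}
    (ha : φ = T.toSpecΓ ≫ Spec.map (CommRingCat.ofHom a) ≫
      Proj.awayι (stdGrading σ k) _ (X_mem_stdGrading i) one_pos) :
    a (ratio i i) = 1 ∧ Coords φ fun j ↦ a (ratio i j) := by
  have h1 : a (ratio i i) = 1 := by
    rw [← map_one a]
    congr 1
    apply HomogeneousLocalization.val_injective
    rw [ratio, HomogeneousLocalization.Away.val_mk, HomogeneousLocalization.val_one]
    simp
  have hu : IsUnit (a (ratio i i)) := h1 ▸ isUnit_one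
  refine ⟨h1, span_eq_top_of_isUnit i hu, ?_⟩
  rw [ofCoords_eq _ (fun j ↦ a (ratio i j)) _ hu]
  conv_lhs => rw [ha]
  congr 3
  refine congrArg _ (away_hom_ext (fun c ↦ ?_) fun j ↦ ?_)
  · rw [awayLift_awayConst]
    have h2 : φ ≫ PS.str σ k = T.toSpecΓ ≫ Spec.map (CommRingCat.ofHom (a.comp
        (awayConst (MvPolynomial.X i)))) := by
      rw [ha, PS.str]
      simp only [Category.assoc]
      rw [Proj.awayι_toSpecZero_assoc, ← Spec.map_comp, ← Spec.map_comp]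
      rfl
    rw [h2]
    simp only [evalSections, MvPolynomial.coe_eval₂Hom, MvPolynomial.eval₂_C,
      scalars_toSpecΓ_comp]
    rfl
  · have h2 := awayLift_ratio (evalSections (φ ≫ PS.str σ k) fun j ↦ a (ratio i j))
      (isUnit_evalSections_X _ hu) j
    simp only [evalSections, MvPolynomial.coe_eval₂Hom, MvPolynomial.eval₂_X, h1, mul_one] at h2
    exact h2.symm

lemma exists_coords_of_preimage_eq_top {T : Scheme.{0}} (φ : T ⟶ PS σ k) (i : σ)
    (h : φ ⁻¹ᵁ Proj.basicOpen (stdGrading σ k) (MvPolynomial.X i) = ⊤) :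
    ∃ s, s i = 1 ∧ Coords φ s := by
  obtain ⟨a, ha⟩ := exists_eq_toSpecΓ_comp_awayι (stdGrading σ k) φ one_pos (X_mem_stdGrading i) h
  exact ⟨fun j ↦ a (ratio i j), coords_of_eq_toSpecΓ_comp_awayι ha⟩

lemma iSup_basicOpen_X : ⨆ i : σ, Proj.basicOpen (stdGrading σ k) (MvPolynomial.X i) = ⊤ := by
  refine Proj.iSup_basicOpen_eq_top' _ _ (fun i ↦ ⟨1, X_mem_stdGrading i⟩) ?_
  rw [eq_top_iff]
  intro f _
  induction f using MvPolynomial.induction_on with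
  | C a =>
    exact Subalgebra.algebraMap_mem (Algebra.adjoin (stdGrading σ k 0)
      (Set.range (MvPolynomial.X : σ → MvPolynomial σ k)))
      (⟨MvPolynomial.C a, MvPolynomial.isHomogeneous_C σ a⟩ : stdGrading σ k 0)
  | add p q hp hq => exact add_mem (hp trivial) (hq trivial)
  | mul_X p i hp => exact mul_mem (hp trivial) (Algebra.subset_adjoin ⟨i, rfl⟩)

lemma exists_mem_basicOpen_X (x : PS σ k) :
    ∃ i : σ, x ∈ Proj.basicOpen (stdGrading σ k) (MvPolynomial.X i) :=
  TopologicalSpace.Opens.mem_iSup.1 (iSup_basicOpen_X.ge trivial)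

lemma exists_local_coords {T : Scheme.{0}} (φ : T ⟶ PS σ k) (x : T) :
    ∃ U : T.Opens, x ∈ U ∧ ∃ (i : σ) (s : σ → Γ(U, ⊤)), s i = 1 ∧ Coords (U.ι ≫ φ) s := by
  obtain ⟨i, hi⟩ := exists_mem_basicOpen_X (φ x)
  refine ⟨φ ⁻¹ᵁ Proj.basicOpen (stdGrading σ k) (MvPolynomial.X i), hi, i,
    exists_coords_of_preimage_eq_top _ i ?_⟩
  rw [Scheme.Hom.comp_preimage]
  ext y
  exact iff_of_true y.2 trivial

lemma exists_coords_of_isLocalRing {A : CommRingCat.{0}} [IsLocalRing A]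
    (φ : Spec A ⟶ PS σ k) : ∃ (i : σ) (s : σ → Γ(Spec A, ⊤)), s i = 1 ∧ Coords φ s := by
  obtain ⟨i, hi⟩ := exists_mem_basicOpen_X (φ (IsLocalRing.closedPoint A))
  exact ⟨i, exists_coords_of_preimage_eq_top _ i
    (Scheme.preimage_eq_top_of_closedPoint_mem _ (by simpa using hi))⟩

/-- Gluing of a morphism to projective space from local coordinates. The predicate `R` characterizes
the coordinates: it is stable under base change and fixes them up to proportionality, so local
choices agree on overlaps and any family satisfying `R` over any `T'` is again a family of
coordinates. -/
theorem exists_of_coords {T : Scheme.{0}} (g : T ⟶ Spec (.of k))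
    (R : ∀ {T' : Scheme.{0}}, (T' ⟶ T) → (σ → Γ(T', ⊤)) → Prop)
    (hnat : ∀ {T'' T' : Scheme.{0}} (u : T'' ⟶ T') (t : T' ⟶ T) (s : σ → Γ(T', ⊤)), R t s →
      R (u ≫ t) fun i ↦ pull u (s i))
    (hprop : ∀ {T' : Scheme.{0}} (t : T' ⟶ T) (s s' : σ → Γ(T', ⊤)), R t s → R t s' →
      Ideal.span (Set.range s) = ⊤ → Ideal.span (Set.range s') = ⊤ →
      ∀ i j, s i * s' j = s j * s' i)
    (hloc : ∀ x : T, ∃ U : T.Opens, x ∈ U ∧ ∃ s : σ → Γ(U, ⊤),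
      Ideal.span (Set.range s) = ⊤ ∧ R U.ι s) :
    ∃ φ : T ⟶ PS σ k, φ ≫ PS.str σ k = g ∧ ∀ {T' : Scheme.{0}} (t : T' ⟶ T) (s : σ → Γ(T', ⊤)),
      Ideal.span (Set.range s) = ⊤ → R t s → Coords (t ≫ φ) s := by
  choose U hx s hs hR using hloc
  obtain ⟨φ, hφ⟩ := exists_glue U (fun x ↦ ⟨x, hx x⟩)
    (fun x ↦ ofCoords ((U x).ι ≫ g) (s x) (hs x)) fun x y ↦ by
      rw [comp_ofCoords, comp_ofCoords]
      refine (coords_ofCoords _ _ _).ext (coords_ofCoords _ _ _) ?_ ?_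
      · rw [ofCoords_str, ofCoords_str, Scheme.homOfLE_ι_assoc, Scheme.homOfLE_ι_assoc]
      · have h1 := hnat (T.homOfLE (inf_le_left : U x ⊓ U y ≤ U x)) _ _ (hR x)
        have h2 := hnat (T.homOfLE (inf_le_right : U x ⊓ U y ≤ U y)) _ _ (hR y)
        rw [Scheme.homOfLE_ι] at h1 h2
        exact hprop _ _ _ h1 h2 (span_range_pull _ (hs x)) (span_range_pull _ (hs y))
  have hstr : φ ≫ PS.str σ k = g := hom_ext_of_opens fun x ↦ ⟨U x, hx x, by
    rw [← Category.assoc, hφ, ofCoords_str]⟩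
  refine ⟨φ, hstr, fun {T'} t r hr hRr ↦ ⟨hr, hom_ext_of_opens fun y ↦ ?_⟩⟩
  let V : T'.Opens := t ⁻¹ᵁ U (t y)
  refine ⟨V, hx (t y), ?_⟩
  let v : V.toScheme ⟶ (U (t y)).toScheme := t ∣_ U (t y)
  have hv : v ≫ (U (t y)).ι = V.ι ≫ t := morphismRestrict_ι _ _
  have h1 : V.ι ≫ t ≫ φ = v ≫ ofCoords ((U (t y)).ι ≫ g) (s (t y)) (hs (t y)) := by
    rw [← hφ, ← Category.assoc, ← hv, Category.assoc]
  rw [h1, comp_ofCoords, comp_ofCoords]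
  refine (coords_ofCoords _ _ _).ext (coords_ofCoords _ _ _) ?_ ?_
  · rw [ofCoords_str, ofCoords_str, ← Category.assoc, hv]
    simp only [Category.assoc, hstr]
  · have h2 := hnat v _ _ (hR (t y))
    have h3 := hnat V.ι _ _ hRr
    rw [hv] at h2
    exact hprop _ _ _ h2 h3 (span_range_pull _ (hs _)) (span_range_pull _ hr)

lemma isCoords_iff {T : Scheme.{0}} (φ : T ⟶ PS σ k) (U : T.Opens) (s : σ → Γ(T, U)) :
    IsCoords φ U s ↔ Coords (U.ι ≫ φ) fun i ↦ U.topIso.inv (s i) := by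
  simp only [IsCoords, Coords, Category.assoc]

end Coords

/-! ### Composition with the morphism of `Proj` induced by a graded homomorphism -/

section ProjMap

variable {σ k σ' B : Type} [CommRing k] [CommRing B] [SetLike σ' B] [AddSubgroupClass σ' B]
  {ℬ : ℕ → σ'} [GradedRing ℬ]

lemma toSpecΓ_comp_map_comp_map_comp {X Y : Scheme.{0}} {C D : Type} [CommRing C] [CommRing D]
    (a : C →+* Γ(X, ⊤)) (b : D →+* C) (h : Spec (.of D) ⟶ Y) :
    X.toSpecΓ ≫ Spec.map (CommRingCat.ofHom a) ≫ Spec.map (CommRingCat.ofHom b) ≫ h =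
      X.toSpecΓ ≫ Spec.map (CommRingCat.ofHom (a.comp b)) ≫ h := by
  rw [CommRingCat.ofHom_comp, Spec.map_comp, Category.assoc]

lemma awayLift_comp_map (f : GradedRingHom (stdGrading σ k) ℬ) {C : Type} [CommRing C]
    (F : B →+* C) {i : σ} (hu : IsUnit (F (f (MvPolynomial.X i)))) :
    (awayLift ℬ F hu).comp (HomogeneousLocalization.Away.map f (MvPolynomial.X i)) =
      awayLift (stdGrading σ k) (F.comp (f : MvPolynomial σ k →+* B)) hu := by
  refine away_hom_ext (fun c ↦ ?_) fun j ↦ ?_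
  · refine Eq.trans ?_ (awayLift_awayConst (F.comp (f : MvPolynomial σ k →+* B)) hu c).symm
    rw [awayLift, RingHom.comp_apply, RingHom.comp_apply,
      HomogeneousLocalization.algebraMap_apply]
    have : (HomogeneousLocalization.Away.map f (MvPolynomial.X i)
        (awayConst (MvPolynomial.X i) c)).val =
        algebraMap B (Localization.Away (f (MvPolynomial.X i))) (f (MvPolynomial.C c)) := by
      rw [← Localization.mk_one_eq_algebraMap]
      exact congrArg (Localization.mk _) (Subtype.ext (map_one f))
    rw [this]
    exact IsLocalization.Away.lift_eq _ hu _
  · refine hu.mul_right_cancel ?_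
    have h1 := awayLift_ratio (F.comp (f : MvPolynomial σ k →+* B)) hu j
    refine Eq.trans ?_ h1.symm
    have h2 := awayLift_mk_mul ℬ F hu (f.map_mem (X_mem_stdGrading i)) 1 (f (MvPolynomial.X j))
      (by simpa using f.map_mem (X_mem_stdGrading j))
    rw [pow_one] at h2
    exact (congrArg (fun z ↦ awayLift ℬ F hu z * F (f (MvPolynomial.X i)))
      (HomogeneousLocalization.Away.map_mk f _ (X_mem_stdGrading i) 1 (MvPolynomial.X j) _)).trans h2

lemma fromOfGlobalSections_comp_map {T : Scheme.{0}} (f : GradedRingHom (stdGrading σ k) ℬ)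
    (hf : HomogeneousIdeal.irrelevant ℬ ≤
      HomogeneousIdeal.map f (HomogeneousIdeal.irrelevant (stdGrading σ k)))
    (F : B →+* Γ(T, ⊤)) (hF : (HomogeneousIdeal.irrelevant ℬ).toIdeal.map F = ⊤)
    (g : T ⟶ Spec (.of k))
    (hs : Ideal.span (Set.range fun i ↦ F (f (MvPolynomial.X i))) = ⊤)
    (hk : ∀ c, F (f (MvPolynomial.C c)) = scalars g c) :
    Proj.fromOfGlobalSections ℬ F hF ≫ Proj.map f hf = ofCoords g _ hs := by
  refine hom_ext_of_opens fun x ↦ ?_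
  obtain ⟨l, hl⟩ := exists_mem_basicOpen hs x
  refine ⟨_, hl, ?_⟩
  set U := T.basicOpen (F (f (MvPolynomial.X l))) with hU
  have hu : IsUnit (pull U.ι (F (f (MvPolynomial.X l)))) := isUnit_pull_of_le le_rfl
  rw [comp_ofCoords_eq U.ι _ (fun i ↦ F (f (MvPolynomial.X i))) _ hu, ← Category.assoc,
    comp_fromOfGlobalSections_of_isUnit ℬ U.ι F hF one_pos (f.map_mem (X_mem_stdGrading l))
      ((pull U.ι).comp F) rfl hu, Category.assoc, Category.assoc]
  refine (congrArg (fun z ↦ U.toScheme.toSpecΓ ≫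
    Spec.map (CommRingCat.ofHom (awayLift ℬ ((pull U.ι).comp F) hu)) ≫ z)
    (Proj.awayι_comp_map f hf one_pos _ (X_mem_stdGrading l))).trans ?_
  refine (toSpecΓ_comp_map_comp_map_comp (X := U) _ _ _).trans ?_
  rw [awayLift_comp_map]
  congr 4
  have : ((pull U.ι).comp F).comp (f : MvPolynomial σ k →+* B) =
      evalSections (U.ι ≫ g) fun i ↦ pull U.ι (F (f (MvPolynomial.X i))) := by
    refine MvPolynomial.ringHom_ext (fun c ↦ ?_) fun i ↦ ?_
    · simp only [evalSections, MvPolynomial.coe_eval₂Hom, MvPolynomial.eval₂_C, scalars_comp]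
      exact congrArg (pull U.ι) (hk c)
    · simp only [evalSections, MvPolynomial.coe_eval₂Hom, MvPolynomial.eval₂_X]
      rfl
  congr 1
end ProjMap

/-! ### Products over a base and their separatedness -/

section Products

/-- The property of being separated. -/
abbrev separatedMorphisms : MorphismProperty Scheme.{0} := @IsSeparated

instance : separatedMorphisms.HasOfPostcompProperty separatedMorphisms where
  of_postcomp f g _ h := by
    have : IsSeparated (f ≫ g) := h
    exact IsSeparated.of_comp f g

/-- Separated schemes over `S` have finite products, and the forgetful functor to all schemes over
`S` preserves them. Separatedness makes morphisms from affine schemes to the products quasi-compact,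
so that their kernels can be computed on affine opens. -/
lemma isSeparated_pi {S : Scheme.{0}} {ι : Type} [Finite ι] (X : ι → Over S)
    (h : ∀ i, IsSeparated (X i).hom) : IsSeparated (∏ᶜ X).hom := by
  let Y : ι → MorphismProperty.Over separatedMorphisms ⊤ S :=
    fun i ↦ MorphismProperty.Over.mk _ (X i).hom (h i)
  let e : (MorphismProperty.Over.forget separatedMorphisms ⊤ S).obj (∏ᶜ Y) ≅ ∏ᶜ X :=
    PreservesProduct.iso (MorphismProperty.Over.forget separatedMorphisms ⊤ S) Y
  have : IsSeparated ((MorphismProperty.Over.forget separatedMorphisms ⊤ S).obj (∏ᶜ Y)).hom :=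
    (∏ᶜ Y).prop
  have h2 : IsIso e.inv.left := inferInstanceAs (IsIso ((Over.forget S).map e.inv))
  rw [← Over.w e.inv]
  infer_instance

instance (σ k : Type) [CommRing k] : IsSeparated (PS.str σ k) := by
  unfold PS.str
  infer_instance

variable {S : Scheme.{0}} {ι : Type} {X : ι → Over S} [HasProduct X]

lemma pi_hom_ext {T : Scheme.{0}} {f g : T ⟶ (∏ᶜ X).left} (hS : f ≫ (∏ᶜ X).hom = g ≫ (∏ᶜ X).hom)
    (h : ∀ i, f ≫ (Pi.π X i).left = g ≫ (Pi.π X i).left) : f = g := by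
  let f' : Over.mk (f ≫ (∏ᶜ X).hom) ⟶ ∏ᶜ X := Over.homMk f rfl
  let g' : Over.mk (f ≫ (∏ᶜ X).hom) ⟶ ∏ᶜ X := Over.homMk g hS.symm
  have : f' = g' := Pi.hom_ext _ _ fun i ↦ Over.OverMorphism.ext (h i)
  exact congrArg CommaMorphism.left this

lemma exists_pi_lift {T : Scheme.{0}} (g : T ⟶ S) (f : ∀ i, T ⟶ (X i).left)
    (hf : ∀ i, f i ≫ (X i).hom = g) :
    ∃ φ : T ⟶ (∏ᶜ X).left, φ ≫ (∏ᶜ X).hom = g ∧ ∀ i, φ ≫ (Pi.π X i).left = f i := by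
  let φ : Over.mk g ⟶ ∏ᶜ X := Pi.lift fun i ↦ Over.homMk (f i) (hf i)
  refine ⟨φ.left, Over.w φ, fun i ↦ ?_⟩
  have : φ ≫ Pi.π X i = _ := Pi.lift_π _ i
  exact congrArg CommaMorphism.left this

end Products

/-! ### Rescaling of homogeneous coordinates -/

section Homogeneous

variable {k : Type} [CommRing k] {C : Type}

/-- Rescaling the homogeneous coordinates changes the values of `f` by units. -/
def IsMultihomogeneous (f : MvPolynomial (C × Fin 2) k) : Prop :=
  ∀ {A : Type} [CommRing A] (g : k →+* A) (s : C × Fin 2 → A) (l : C → Aˣ), ∃ w : Aˣ,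
    MvPolynomial.eval₂ g (fun p ↦ l p.1 * s p) f = w * MvPolynomial.eval₂ g s f

lemma inv_hom_apply {A B : CommRingCat.{0}} (e : A ≅ B) (x : A) : e.inv (e.hom x) = x :=
  congrArg (fun z ↦ z.hom x) e.hom_inv_id

/-- If `1 = ∑ a_i s_i`, the factor is `l = ∑ a_i s'_i`. It is a unit because it divides every
`s'_i`, and these generate the unit ideal. -/
lemma exists_unit_mul {A ι : Type*} [CommRing A] {s s' : ι → A}
    (hs : Ideal.span (Set.range s) = ⊤) (hs' : Ideal.span (Set.range s') = ⊤)
    (h : ∀ i j, s i * s' j = s j * s' i) : ∃ l : Aˣ, ∀ i, s' i = l * s i := by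
  have h1 : ∀ {s s' : ι → A}, Ideal.span (Set.range s) = ⊤ → (∀ i j, s i * s' j = s j * s' i) →
      ∃ l : A, ∀ i, s' i = l * s i := by
    intro s s' hs h
    have : ∀ x ∈ Ideal.span (Set.range s), ∃ l : A, ∀ i, x * s' i = l * s i := by
      intro x hx
      induction hx using Submodule.span_induction with
      | mem x hx =>
        obtain ⟨i, rfl⟩ := hx
        exact ⟨s' i, fun j ↦ by rw [h]; ring⟩
      | zero => exact ⟨0, by simp⟩
      | add x y _ _ hx hy =>
        obtain ⟨a, ha⟩ := hx
        obtain ⟨b, hb⟩ := hy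
        exact ⟨a + b, fun i ↦ by rw [add_mul, ha, hb, add_mul]⟩
      | smul r x _ hx =>
        obtain ⟨a, ha⟩ := hx
        exact ⟨r * a, fun i ↦ by rw [smul_eq_mul, mul_assoc, ha, mul_assoc]⟩
    obtain ⟨l, hl⟩ := this 1 (hs ▸ trivial)
    exact ⟨l, fun i ↦ by rw [← hl, one_mul]⟩
  obtain ⟨l, hl⟩ := h1 hs h
  have hu : IsUnit l := by
    rw [← Ideal.span_singleton_eq_top, ← top_le_iff, ← hs', Ideal.span_le]
    rintro _ ⟨i, rfl⟩
    rw [hl i]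
    exact Ideal.mul_mem_right _ _ (Ideal.mem_span_singleton_self l)
  exact ⟨hu.unit, hl⟩

end Homogeneous

/-! ### Points of closed subschemes of `(ℙ¹)^C` given by multihomogeneous equations -/

section Lines

variable {k : Type} [CommRing k] {C : Type} [Finite C]

instance : IsSeparated (lines k C).hom :=
  isSeparated_pi _ fun _ ↦ inferInstanceAs (IsSeparated (PS.str (Fin 2) k))

lemma lines.proj_str (c : C) : lines.proj (k := k) c ≫ PS.str (Fin 2) k = (lines k C).hom :=
  Over.w (Pi.π (fun _ : C ↦ PS.over (Fin 2) k) c)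

lemma lines.hom_ext {T : Scheme.{0}} {f g : T ⟶ (lines k C).left}
    (hS : f ≫ (lines k C).hom = g ≫ (lines k C).hom)
    (h : ∀ c, f ≫ lines.proj c = g ≫ lines.proj c) : f = g :=
  pi_hom_ext hS h

lemma lines.exists_lift {T : Scheme.{0}} (g : T ⟶ Spec (.of k)) (f : C → (T ⟶ PS (Fin 2) k))
    (hf : ∀ c, f c ≫ PS.str (Fin 2) k = g) :
    ∃ φ : T ⟶ (lines k C).left, φ ≫ (lines k C).hom = g ∧ ∀ c, φ ≫ lines.proj c = f c :=
  exists_pi_lift (X := fun _ : C ↦ PS.over (Fin 2) k) g f hf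

/-- The functions `s (c, 0)`, `s (c, 1)` are homogeneous coordinates of the components of `h`. -/
def LCoords {T : Scheme.{0}} (h : T ⟶ (lines k C).left) (s : C × Fin 2 → Γ(T, ⊤)) : Prop :=
  ∀ c, Coords (h ≫ lines.proj c) fun a ↦ s (c, a)

lemma LCoords.comp {T' T : Scheme.{0}} {h : T ⟶ (lines k C).left} {s : C × Fin 2 → Γ(T, ⊤)}
    (H : LCoords h s) (t : T' ⟶ T) : LCoords (t ≫ h) fun p ↦ pull t (s p) := fun c ↦ by
  rw [Category.assoc]
  exact (H c).comp t

lemma LCoords.ext {T : Scheme.{0}} {h h' : T ⟶ (lines k C).left} {s s' : C × Fin 2 → Γ(T, ⊤)}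
    (H : LCoords h s) (H' : LCoords h' s') (hS : h ≫ (lines k C).hom = h' ≫ (lines k C).hom)
    (hm : ∀ c, s (c, 0) * s' (c, 1) = s (c, 1) * s' (c, 0)) : h = h' := by
  refine lines.hom_ext hS fun c ↦ (H c).ext (H' c) ?_ ?_
  · rw [Category.assoc, Category.assoc, lines.proj_str, hS]
  · intro i j
    have := hm c
    fin_cases i <;> fin_cases j <;> simp <;> first | rfl | exact hm c | (rw [hm c])

lemma evalSections_eq {T : Scheme.{0}} (g : T ⟶ Spec (.of k)) {σ : Type} (s : σ → Γ(T, ⊤))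
    (f : MvPolynomial σ k) : evalSections g s f = MvPolynomial.eval₂ (scalars g) s f := rfl

lemma LCoords.exists_unit {T : Scheme.{0}} {h : T ⟶ (lines k C).left}
    {s s' : C × Fin 2 → Γ(T, ⊤)} (H : LCoords h s) (H' : LCoords h s')
    {f : MvPolynomial (C × Fin 2) k} (hf : IsMultihomogeneous f) (g : T ⟶ Spec (.of k)) :
    ∃ w : Γ(T, ⊤)ˣ, evalSections g s' f = w * evalSections g s f := by
  choose l hl using fun c ↦ exists_unit_mul (H c).1 (H' c).1 ((H c).mul_eq_mul (H' c))
  obtain ⟨w, hw⟩ := hf (scalars g) s l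
  refine ⟨w, ?_⟩
  rw [evalSections_eq, evalSections_eq, ← hw]
  congr 1
  ext p
  exact hl p.1 p.2

lemma exists_local_lcoords {T : Scheme.{0}} (h : T ⟶ (lines k C).left) (x : T) :
    ∃ U : T.Opens, x ∈ U ∧ ∃ s : C × Fin 2 → Γ(U, ⊤), LCoords (U.ι ≫ h) s ∧
      ∃ a : C → Fin 2, ∀ c, s (c, a c) = 1 := by
  choose U hx a s hs hc using fun c ↦ exists_local_coords (h ≫ lines.proj c) x
  refine ⟨⨅ c, U c, by
    rw [← SetLike.mem_coe, TopologicalSpace.Opens.coe_iInf]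
    exact Set.mem_iInter.2 hx, fun p ↦
    pull (T.homOfLE (iInf_le U p.1)) (s p.1 p.2), fun c ↦ ?_, a, fun c ↦ ?_⟩
  · have := (hc c).comp (T.homOfLE (iInf_le U c))
    rw [Scheme.homOfLE_ι_assoc] at this
    rwa [Category.assoc]
  · change pull _ (s c (a c)) = 1
    rw [hs, map_one]

lemma exists_lcoords_of_isLocalRing {A : CommRingCat.{0}} [IsLocalRing A]
    (h : Spec A ⟶ (lines k C).left) : ∃ s : C × Fin 2 → Γ(Spec A, ⊤), LCoords h s ∧
      ∃ a : C → Fin 2, ∀ c, s (c, a c) = 1 := by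
  choose a s hs hc using fun c ↦ exists_coords_of_isLocalRing (h ≫ lines.proj c)
  exact ⟨fun p ↦ s p.1 p.2, hc, a, hs⟩

lemma areCoords_iff {U : (lines k C).left.Opens} (s : C × Fin 2 → Γ((lines k C).left, U)) :
    AreCoords U s ↔ LCoords U.ι fun p ↦ U.topIso.inv (s p) :=
  forall_congr' fun _ ↦ isCoords_iff _ _ _

lemma topIso_inv_value {U : (lines k C).left.Opens} (s : C × Fin 2 → Γ((lines k C).left, U))
    (f : MvPolynomial (C × Fin 2) k) : U.topIso.inv (value s f) =
      evalSections (U.ι ≫ (lines k C).hom) (fun p ↦ U.topIso.inv (s p)) f := by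
  exact inv_hom_apply _ _

lemma exists_affine_areCoords (z : (lines k C).left) :
    ∃ U : (lines k C).left.affineOpens, z ∈ U.1 ∧
      ∃ s : C × Fin 2 → Γ((lines k C).left, U), AreCoords U.1 s := by
  obtain ⟨U, hU, s, hs, -⟩ := exists_local_lcoords (𝟙 (lines k C).left) z
  obtain ⟨V, hV, hVU⟩ := exists_affine_of_mem hU
  refine ⟨V, hV, fun p ↦ V.1.topIso.hom (pull ((lines k C).left.homOfLE hVU) (s p)), ?_⟩
  rw [areCoords_iff]
  have := hs.comp ((lines k C).left.homOfLE hVU)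
  rw [Scheme.homOfLE_ι_assoc, Category.comp_id] at this
  simpa only [inv_hom_apply] using this

lemma pull_restrict {T Y : Scheme.{0}} (h : T ⟶ Y) (U : Y.Opens) (a : Γ(Y, U)) :
    pull (h ∣_ U) (U.topIso.inv a) = (h ⁻¹ᵁ U).topIso.inv (h.app U a) := by
  have : U.topIso.inv ≫ (h ∣_ U).appTop = h.app U ≫ (h ⁻¹ᵁ U).topIso.inv := by
    rw [morphismRestrict_appTop]
    exact (Scheme.Hom.naturality_assoc h _ _).trans
      (congrArg (h.app U ≫ ·) (T.presheaf.map_comp _ _).symm)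
  exact congrArg (fun z ↦ z.hom a) this

variable {F : Set (MvPolynomial (C × Fin 2) k)}

lemma app_value_eq_zero {T : Scheme.{0}} {h : T ⟶ (lines k C).left} {s : C × Fin 2 → Γ(T, ⊤)}
    (H : LCoords h s) {f : MvPolynomial (C × Fin 2) k} (hf : IsMultihomogeneous f)
    (h0 : evalSections (h ≫ (lines k C).hom) s f = 0) {U : (lines k C).left.Opens}
    {s' : C × Fin 2 → Γ((lines k C).left, U)} (H' : AreCoords U s') :
    h.app U (value s' f) = 0 := by
  rw [areCoords_iff] at H'
  have h1 := H'.comp (h ∣_ U)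
  rw [morphismRestrict_ι] at h1
  have h2 := H.comp (h ⁻¹ᵁ U).ι
  obtain ⟨w, hw⟩ := h2.exists_unit h1 hf ((h ⁻¹ᵁ U).ι ≫ h ≫ (lines k C).hom)
  rw [← pull_evalSections, h0, map_zero, mul_zero] at hw
  have h3 := pull_restrict h U (value s' f)
  rw [topIso_inv_value, pull_evalSections, ← Category.assoc, morphismRestrict_ι, Category.assoc,
    hw] at h3
  exact (ConcreteCategory.bijective_of_isIso (h ⁻¹ᵁ U).topIso.inv).1 (h3.symm.trans (map_zero _).symm)

lemma quasiCompact_to_lines {T : Scheme.{0}} [IsAffine T] (h : T ⟶ (lines k C).left) :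
    QuasiCompact h := by
  have : QuasiCompact (h ≫ (lines k C).hom) := inferInstance
  exact QuasiCompact.of_comp h (lines k C).hom

lemma exists_of_lcoords {T : Scheme.{0}} (g : T ⟶ Spec (.of k)) (s : C × Fin 2 → Γ(T, ⊤))
    (hs : ∀ c, Ideal.span (Set.range fun a ↦ s (c, a)) = ⊤) :
    ∃ h : T ⟶ (lines k C).left, h ≫ (lines k C).hom = g ∧ LCoords h s := by
  obtain ⟨h, h1, h2⟩ := lines.exists_lift g (fun c ↦ ofCoords g _ (hs c)) fun c ↦ ofCoords_str _ _ _
  exact ⟨h, h1, fun c ↦ h2 c ▸ coords_ofCoords _ _ _⟩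

lemma value_mem_ker {T : Scheme.{0}} {h : T ⟶ (lines k C).left} [QuasiCompact h]
    {s : C × Fin 2 → Γ(T, ⊤)} (H : LCoords h s) (hF : ∀ f ∈ F, IsMultihomogeneous f)
    (h0 : ∀ f ∈ F, evalSections (h ≫ (lines k C).hom) s f = 0)
    (U : (lines k C).left.affineOpens) (s' : C × Fin 2 → Γ((lines k C).left, U))
    (H' : AreCoords U.1 s') (f : MvPolynomial (C × Fin 2) k) (hf : f ∈ F) :
    value s' f ∈ h.ker.ideal U := by
  rw [Scheme.Hom.ker_apply]
  exact app_value_eq_zero H (hF f hf) (h0 f hf) H'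

/-- If the equations hold in some coordinates over a local ring, they hold in all of them, so the
kernel of the point is one of the ideal sheaves whose infimum is `vanishingSheaf F`. -/
theorem exists_lift_vanishingSheaf (hF : ∀ f ∈ F, IsMultihomogeneous f) {T : Scheme.{0}}
    (h : T ⟶ (lines k C).left) (h0 : ∀ x : T, ∃ s, LCoords (T.fromSpecStalk x ≫ h) s ∧
      ∀ f ∈ F, evalSections ((T.fromSpecStalk x ≫ h) ≫ (lines k C).hom) s f = 0) :
    ∃ l, l ≫ (vanishingSheaf F).subschemeι = h := by
  refine exists_lift_of_stalks _ h fun x ↦ ?_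
  obtain ⟨s, H, hs⟩ := h0 x
  have := quasiCompact_to_lines (T.fromSpecStalk x ≫ h)
  refine ⟨IsClosedImmersion.lift (vanishingSheaf F).subschemeι (T.fromSpecStalk x ≫ h) ?_,
    IsClosedImmersion.lift_fac _ _ _⟩
  rw [Scheme.IdealSheafData.ker_subschemeι]
  exact sInf_le (value_mem_ker H hF hs)

lemma pull_toSpecΓ_comp {T : Scheme.{0}} {B : Type} [CommRing B] (b : B →+* Γ(T, ⊤)) (x : B) :
    pull (T.toSpecΓ ≫ Spec.map (CommRingCat.ofHom b)) ((Scheme.ΓSpecIso (.of B)).inv x) = b x := by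
  have := RingHom.congr_fun (scalars_toSpecΓ_comp b) x
  exact this

lemma scalars_specMap {B : Type} [CommRing B] (b : k →+* B) (x : k) :
    scalars (Spec.map (CommRingCat.ofHom b)) x = (Scheme.ΓSpecIso (.of B)).inv (b x) := by
  rw [scalars, ← Scheme.ΓSpecIso_inv_naturality]
  rfl

/-- The coordinates on the standard affine chart with `x (c, a c) = 1`. -/
def chartCoords (a : C → Fin 2) (p : C × Fin 2) : MvPolynomial C k :=
  if p.2 = a p.1 then 1 else MvPolynomial.X p.1

variable (F) in
/-- The equations in the standard affine chart. -/
def chartIdeal (a : C → Fin 2) : Ideal (MvPolynomial C k) :=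
  Ideal.span (MvPolynomial.eval₂Hom MvPolynomial.C (chartCoords a) '' F)

variable (F) in
lemma exists_chart (a : C → Fin 2) :
    ∃ h : Spec (.of (MvPolynomial C k ⧸ chartIdeal F a)) ⟶ (lines k C).left,
      h ≫ (lines k C).hom = Spec.map (CommRingCat.ofHom
        ((Ideal.Quotient.mk (chartIdeal F a)).comp MvPolynomial.C)) ∧
      LCoords h fun p ↦ (Scheme.ΓSpecIso (.of (MvPolynomial C k ⧸ chartIdeal F a))).inv
        (Ideal.Quotient.mk (chartIdeal F a) (chartCoords a p)) := by
  refine exists_of_lcoords _ _ fun c ↦ span_eq_top_of_isUnit (a c) ?_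
  simp [chartCoords]

lemma chart_eval (a : C → Fin 2) (f : MvPolynomial (C × Fin 2) k) (hf : f ∈ F) :
    evalSections (Spec.map (CommRingCat.ofHom
        ((Ideal.Quotient.mk (chartIdeal F a)).comp MvPolynomial.C)))
      (fun p ↦ (Scheme.ΓSpecIso (.of (MvPolynomial C k ⧸ chartIdeal F a))).inv
        (Ideal.Quotient.mk (chartIdeal F a) (chartCoords a p))) f = 0 := by
  have h1 : Ideal.Quotient.mk (chartIdeal F a)
      (MvPolynomial.eval₂Hom MvPolynomial.C (chartCoords a) f) = 0 :=
    Ideal.Quotient.eq_zero_iff_mem.2 (Ideal.subset_span ⟨f, hf, rfl⟩)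
  have h2 := congrArg (Scheme.ΓSpecIso (.of (MvPolynomial C k ⧸ chartIdeal F a))).inv h1
  rw [map_zero] at h2
  rw [← h2, evalSections_eq]
  have h3 := MvPolynomial.hom_eval₂ f MvPolynomial.C ((Scheme.ΓSpecIso
    (.of (MvPolynomial C k ⧸ chartIdeal F a))).inv.hom.comp (Ideal.Quotient.mk (chartIdeal F a)))
    (chartCoords a)
  refine Eq.trans ?_ h3.symm
  congr 1
  ext x
  exact scalars_specMap _ x

variable (F) in
/-- The scheme-theoretic closure of the union of the affine pieces. -/
def chartSheaf : (lines k C).left.IdealSheafData :=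
  ⨅ a : C → Fin 2, (exists_chart F a).choose.ker

/-- There are only finitely many charts, and a finite infimum of ideal sheaves is computed on each
affine open. This is not clear for the infimum that defines `vanishingSheaf`, which is why the
latter is compared with `chartSheaf`. -/
lemma chartSheaf_mem (hF : ∀ f ∈ F, IsMultihomogeneous f) (U : (lines k C).left.affineOpens)
    (s : C × Fin 2 → Γ((lines k C).left, U)) (H : AreCoords U.1 s)
    (f : MvPolynomial (C × Fin 2) k) (hf : f ∈ F) : value s f ∈ (chartSheaf F).ideal U := by
  rw [chartSheaf, Scheme.IdealSheafData.ideal_iInf, iInf_apply, Submodule.mem_iInf]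
  intro a
  have := quasiCompact_to_lines (exists_chart F a).choose
  obtain ⟨h1, h2⟩ := (exists_chart F a).choose_spec
  exact value_mem_ker h2 hF (fun f hf ↦ by rw [h1]; exact chart_eval a f hf) U s H f hf

/-- A solution whose coordinates are normalized by `s (c, a c) = 1` is a point of the affine scheme
of the chart `a`, so `h` factors through that chart. -/
lemma chartSheaf_le_ker_of_lcoords {T : Scheme.{0}} (h : T ⟶ (lines k C).left)
    {s : C × Fin 2 → Γ(T, ⊤)} (H : LCoords h s) {a : C → Fin 2} (ha : ∀ c, s (c, a c) = 1)
    (h0 : ∀ f ∈ F, evalSections (h ≫ (lines k C).hom) s f = 0) : chartSheaf F ≤ h.ker := by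
  set g := h ≫ (lines k C).hom with hg
  -- In `Fin 2` the index different from `a c` is `1 - a c`; it carries the affine coordinate of the
  -- chart.
  let b : MvPolynomial C k →+* Γ(T, ⊤) := MvPolynomial.eval₂Hom (scalars g) fun c ↦ s (c, 1 - a c)
  have hb : ∀ p, b (chartCoords a p) = s p := by
    rintro ⟨c, i⟩
    unfold chartCoords
    split_ifs with hi
    · have hi : i = a c := hi
      rw [map_one, hi, ha]
    · have hi : ¬ i = a c := hi
      have : i = 1 - a c := by
        generalize a c = j at hi
        fin_cases i <;> fin_cases j <;> simp_all
      rw [this]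
      simp [b]
  have hb0 : ∀ y ∈ chartIdeal F a, b y = 0 := by
    intro y hy
    have : chartIdeal F a ≤ RingHom.ker b := by
      rw [chartIdeal, Ideal.span_le]
      rintro _ ⟨f, hf, rfl⟩
      rw [SetLike.mem_coe, RingHom.mem_ker, ← h0 f hf, evalSections_eq]
      refine (MvPolynomial.hom_eval₂ f _ b _).trans ?_
      congr 1
      · ext z
        simp [b, hg]
      · exact funext hb
    exact this hy
  let β := Ideal.Quotient.lift (chartIdeal F a) b hb0
  obtain ⟨h1, h2⟩ := (exists_chart F a).choose_spec
  have key : h = (T.toSpecΓ ≫ Spec.map (CommRingCat.ofHom β)) ≫ (exists_chart F a).choose := by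
    refine H.ext (h2.comp _) ?_ fun c ↦ ?_
    · rw [Category.assoc, h1, Category.assoc, ← Spec.map_comp, ← CommRingCat.ofHom_comp]
      refine (eq_toSpecΓ_comp_scalars g).trans ?_
      congr 3
      ext z
      simp [β, b]
    · rw [pull_toSpecΓ_comp, pull_toSpecΓ_comp]
      simp only [β, Ideal.Quotient.lift_mk, hb]
      ring
  rw [key]
  exact (iInf_le _ a).trans (Scheme.Hom.le_ker_comp _ _)

lemma chartSheaf_le_ker {T : Scheme.{0}} (h : T ⟶ (lines k C).left) [QuasiCompact h]
    (h0 : ∀ (U : T.Opens) (s : C × Fin 2 → Γ(U, ⊤)), LCoords (U.ι ≫ h) s →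
      ∀ f ∈ F, evalSections ((U.ι ≫ h) ≫ (lines k C).hom) s f = 0) :
    chartSheaf F ≤ h.ker := by
  choose U hU s H a ha using exists_local_lcoords h
  let 𝒰 := T.openCoverOfIsOpenCover U (TopologicalSpace.Opens.ext (Set.eq_univ_of_forall
    fun x ↦ TopologicalSpace.Opens.mem_iSup.2 ⟨x, hU x⟩))
  rw [← Scheme.Hom.iInf_ker_openCover_map_comp h 𝒰, le_iInf_iff]
  exact fun x ↦ chartSheaf_le_ker_of_lcoords _ (H x) (ha x) (h0 (U x) (s x) (H x))

/-- If `I` contains all the values, the equations hold on the subscheme of `I`. Locally this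
subscheme has normalized coordinates and maps to a chart, hence `chartSheaf F ≤ I`; and `chartSheaf
F` is itself such an `I`. -/
theorem vanishingSheaf_eq_chartSheaf (hF : ∀ f ∈ F, IsMultihomogeneous f) :
    vanishingSheaf F = chartSheaf F := by
  refine le_antisymm (sInf_le (chartSheaf_mem hF)) (le_sInf fun I hI ↦ ?_)
  rw [← Scheme.IdealSheafData.ker_subschemeι I]
  refine chartSheaf_le_ker _ fun U s H f hf ↦ ?_
  refine eq_of_pull_opens fun x ↦ ?_
  obtain ⟨V, hV, s', H'⟩ := exists_affine_areCoords (I.subschemeι (U.ι x))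
  have h1 := (areCoords_iff _).1 H'
  have h2 : I.subschemeι.app V.1 (value s' f) = 0 := by
    have := hI V s' H' f hf
    rw [← Scheme.IdealSheafData.ker_subschemeι I] at this
    exact I.subschemeι.ideal_ker_le V this
  let t := U.ι ≫ I.subschemeι
  have h3 : t.app V.1 (value s' f) = 0 := by
    change U.ι.app _ (I.subschemeι.app V.1 (value s' f)) = 0
    rw [h2, map_zero]
  have h4 := pull_restrict t V.1 (value s' f)
  rw [h3, topIso_inv_value, pull_evalSections, map_zero] at h4
  have h5 := h1.comp (t ∣_ V.1)
  refine ⟨t ⁻¹ᵁ V.1, hV, ?_⟩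
  have h6 := H.comp (t ⁻¹ᵁ V.1).ι
  rw [morphismRestrict_ι] at h5
  obtain ⟨w, hw⟩ := h5.exists_unit h6 (hF f hf) ((t ⁻¹ᵁ V.1).ι ≫ t ≫ (lines k C).hom)
  rw [pull_evalSections, map_zero]
  rw [← Category.assoc, morphismRestrict_ι, Category.assoc] at h4
  rw [h4, mul_zero] at hw
  rw [← hw, Category.assoc]

theorem evalSections_eq_zero_of_lift (hF : ∀ f ∈ F, IsMultihomogeneous f) {T : Scheme.{0}}
    (l : T ⟶ (vanishingSheaf F).subscheme) {s : C × Fin 2 → Γ(T, ⊤)}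
    (H : LCoords (l ≫ (vanishingSheaf F).subschemeι) s) {f : MvPolynomial (C × Fin 2) k}
    (hf : f ∈ F) :
    evalSections ((l ≫ (vanishingSheaf F).subschemeι) ≫ (lines k C).hom) s f = 0 := by
  refine eq_of_pull_opens fun x ↦ ?_
  set t := l ≫ (vanishingSheaf F).subschemeι with ht
  obtain ⟨V, hV, s', H'⟩ := exists_affine_areCoords (t x)
  have h1 := (areCoords_iff _).1 H'
  have h2 : (vanishingSheaf F).subschemeι.app V.1 (value s' f) = 0 := by
    have := chartSheaf_mem hF V s' H' f hf
    rw [← vanishingSheaf_eq_chartSheaf hF,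
      ← Scheme.IdealSheafData.ker_subschemeι (vanishingSheaf F)] at this
    exact (vanishingSheaf F).subschemeι.ideal_ker_le V this
  have h3 : t.app V.1 (value s' f) = 0 := by
    change l.app _ ((vanishingSheaf F).subschemeι.app V.1 (value s' f)) = 0
    rw [h2, map_zero]
  have h4 := pull_restrict t V.1 (value s' f)
  rw [h3, topIso_inv_value, pull_evalSections, map_zero] at h4
  have h5 := h1.comp (t ∣_ V.1)
  refine ⟨t ⁻¹ᵁ V.1, hV, ?_⟩
  have h6 := H.comp (t ⁻¹ᵁ V.1).ι
  rw [morphismRestrict_ι] at h5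
  obtain ⟨w, hw⟩ := h5.exists_unit h6 (hF f hf) ((t ⁻¹ᵁ V.1).ι ≫ t ≫ (lines k C).hom)
  rw [pull_evalSections, map_zero]
  rw [← Category.assoc, morphismRestrict_ι, Category.assoc] at h4
  rw [h4, mul_zero] at hw
  rw [← hw]

/-- A change of coordinates multiplies the value of `f` by a unit, so nonvanishing may be tested in
whichever coordinates are at hand. -/
theorem mem_nonvanishing_iff {T : Scheme.{0}} {h : T ⟶ (lines k C).left}
    {s : C × Fin 2 → Γ(T, ⊤)} (H : LCoords h s) {f : MvPolynomial (C × Fin 2) k}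
    (hf : IsMultihomogeneous f) (x : T) :
    h x ∈ nonvanishing f ↔ x ∈ T.basicOpen (evalSections (h ≫ (lines k C).hom) s f) := by
  have key : ∀ (V : (lines k C).left.affineOpens) (s' : C × Fin 2 → Γ((lines k C).left, V)),
      AreCoords V.1 s' → h x ∈ V.1 → (h x ∈ (lines k C).left.basicOpen (value s' f) ↔
        x ∈ T.basicOpen (evalSections (h ≫ (lines k C).hom) s f)) := by
    intro V s' H' hV
    let y : (h ⁻¹ᵁ V.1).toScheme := ⟨x, hV⟩
    have h1 := ((areCoords_iff _).1 H').comp (h ∣_ V.1)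
    rw [morphismRestrict_ι] at h1
    obtain ⟨w, hw⟩ := h1.exists_unit (H.comp (h ⁻¹ᵁ V.1).ι) hf
      ((h ⁻¹ᵁ V.1).ι ≫ h ≫ (lines k C).hom)
    have h4 := pull_restrict h V.1 (value s' f)
    rw [topIso_inv_value, pull_evalSections, ← Category.assoc, morphismRestrict_ι,
      Category.assoc] at h4
    rw [h4, ← pull_evalSections] at hw
    have h5 := SetLike.ext_iff.1 (Scheme.preimage_basicOpen h (value s' f)) x
    have h6 := SetLike.ext_iff.1 ((h ⁻¹ᵁ V.1).ι_image_basicOpen_topIso_inv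
      (h.app V.1 (value s' f))) x
    have h7 : y ∈ (h ⁻¹ᵁ V.1).toScheme.basicOpen
        (pull (h ⁻¹ᵁ V.1).ι (evalSections (h ≫ (lines k C).hom) s f)) ↔
        x ∈ T.basicOpen (evalSections (h ≫ (lines k C).hom) s f) := mem_basicOpen_pull _ _ y
    have h8 : y ∈ (h ⁻¹ᵁ V.1).toScheme.basicOpen
        ((h ⁻¹ᵁ V.1).topIso.inv (h.app V.1 (value s' f))) ↔ x ∈ (h ⁻¹ᵁ V.1).ι ''ᵁ
        (h ⁻¹ᵁ V.1).toScheme.basicOpen ((h ⁻¹ᵁ V.1).topIso.inv (h.app V.1 (value s' f))) := by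
      refine ⟨fun hy ↦ ⟨y, hy, rfl⟩, ?_⟩
      rintro ⟨z, hz, hzx⟩
      have : z = y := Subtype.ext hzx
      rwa [← this]
    refine h5.trans (h6.symm.trans (h8.symm.trans ?_))
    rw [← h7, hw, Scheme.basicOpen_mul, Scheme.basicOpen_of_isUnit _ w.isUnit, top_inf_eq]
  simp only [nonvanishing, TopologicalSpace.Opens.mem_iSup]
  constructor
  · rintro ⟨V, s', H', hx⟩
    exact (key V s' H' ((lines k C).left.basicOpen_le _ hx)).1 hx
  · intro hx
    obtain ⟨V, hV, s', H'⟩ := exists_affine_areCoords (h x)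
    exact ⟨V, s', H', (key V s' H' hV).2 hx⟩

end Lines

/-! ### Lifting systems of ratios to configurations of points in a domain -/

section Ratios

/-- A system of ratios `r i j k = (u_i - u_k) / (u_i - u_j)`, defined when `F i j k` holds. -/
structure RatioSystem (ι A : Type) [CommRing A] where
  /-- The ratio is defined. -/
  F : ι → ι → ι → Prop
  /-- The ratio. -/
  r : ι → ι → ι → A
  F_right : ∀ i j, F i j j
  r_right : ∀ {i j}, i ≠ j → r i j j = 1
  F_left : ∀ i j, F i j i
  r_left : ∀ {i j}, i ≠ j → r i j i = 0
  total : ∀ {i j k}, i ≠ j → i ≠ k → F i j k ∨ F i k j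
  swap : ∀ {i j k}, i ≠ j → F i j k → F j i k ∧ r j i k = 1 - r i j k
  trans : ∀ {i j k l}, i ≠ j → i ≠ k → F i j k → F i k l →
    F i j l ∧ r i j l = r i j k * r i k l
  inv : ∀ {i j k}, i ≠ j → i ≠ k → F i j k → IsUnit (r i j k) → F i k j

namespace RatioSystem

variable {ι A : Type} [CommRing A] (R : RatioSystem ι A)

/-- The differences of the `u_i` realize the ratio `r a b c`. -/
def Good {D : Type} [CommRing D] (φ : D →+* A) (u : ι → D) (a b c : ι) : Prop :=
  ∃ ρ : D, u a - u c = ρ * (u a - u b) ∧ φ ρ = R.r a b c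

variable {R} {D : Type} [CommRing D] {φ : D →+* A} {u : ι → D} {a b c d : ι}

lemma isUnit_r (hab : a ≠ b) (hac : a ≠ c) (h : R.F a b c) (h' : R.F a c b) :
    IsUnit (R.r a b c) :=
  IsUnit.of_mul_eq_one (R.r a c b) (by rw [← (R.trans hab hac h h').2, R.r_right hab])

lemma good_right (h : a ≠ b) : R.Good φ u a b b := ⟨1, by ring, by rw [R.r_right h, map_one]⟩

lemma good_left (h : a ≠ b) : R.Good φ u a b a := ⟨0, by ring, by rw [R.r_left h, map_zero]⟩

lemma Good.swap (hab : a ≠ b) (hF : R.F a b c) (h : R.Good φ u a b c) : R.Good φ u b a c := by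
  obtain ⟨ρ, h1, h2⟩ := h
  exact ⟨1 - ρ, by linear_combination h1, by rw [map_sub, map_one, h2, (R.swap hab hF).2]⟩

lemma Good.trans (hab : a ≠ b) (hac : a ≠ c) (hF : R.F a b c) (hF' : R.F a c d)
    (h : R.Good φ u a b c) (h' : R.Good φ u a c d) : R.Good φ u a b d := by
  obtain ⟨ρ, h1, h2⟩ := h
  obtain ⟨ρ', h1', h2'⟩ := h'
  exact ⟨ρ * ρ', by linear_combination h1' + ρ' * h1,
    by rw [map_mul, h2, h2', (R.trans hab hac hF hF').2]⟩

/-- The only rule that needs `φ` to be local: a lift of an invertible ratio has to be invertible. -/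
lemma Good.inv [IsLocalHom φ] (hab : a ≠ b) (hac : a ≠ c) (hF : R.F a b c) (hF' : R.F a c b)
    (h : R.Good φ u a b c) : R.Good φ u a c b := by
  obtain ⟨ρ, h1, h2⟩ := h
  have hu : IsUnit ρ := by
    rw [← isUnit_map_iff φ, h2]
    exact isUnit_r hab hac hF hF'
  obtain ⟨v, rfl⟩ := hu
  refine ⟨↑v⁻¹, by rw [h1, ← mul_assoc, Units.inv_mul, one_mul], ?_⟩
  have h3 : φ ↑v⁻¹ * R.r a b c = 1 := by rw [← h2, ← map_mul, Units.inv_mul, map_one]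
  have h4 : R.r a b c * R.r a c b = 1 := by rw [← (R.trans hab hac hF hF').2, R.r_right hab]
  linear_combination R.r a c b * h3 - φ ↑v⁻¹ * h4

lemma Good.map {D' : Type} [CommRing D'] {ψ : D' →+* A} {f : D →+* D'} (hf : ψ.comp f = φ)
    {u' : ι → D'} (ha : u' a = f (u a)) (hb : u' b = f (u b)) (hc : u' c = f (u c))
    (h : R.Good φ u a b c) : R.Good ψ u' a b c := by
  obtain ⟨ρ, h1, h2⟩ := h
  refine ⟨f ρ, by rw [ha, hb, hc, ← map_sub, h1, map_mul, map_sub], ?_⟩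
  rw [← h2, ← hf, RingHom.comp_apply]

/-- All the ratios indexed by elements of `S` are realized. -/
def Lifts (R : RatioSystem ι A) (φ : D →+* A) (u : ι → D) (S : Finset ι) : Prop :=
  Set.InjOn u S ∧ ∀ a ∈ S, ∀ b ∈ S, ∀ c ∈ S, a ≠ b → R.F a b c → R.Good φ u a b c

open Classical in
/-- The cluster of points at least as close to `i` as `p`. -/
def cluster (R : RatioSystem ι A) (S : Finset ι) (i p : ι) : Finset ι := {k ∈ S | R.F i p k}

lemma card_cluster_lt {S : Finset ι} {i p j q k : ι} (hk : k ∈ S) (hkp : R.F i p k)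
    (hkq : ¬ R.F j q k) (h : ∀ l, R.F j q l → R.F i p l) :
    (R.cluster S j q).card < (R.cluster S i p).card := by
  classical
  refine Finset.card_lt_card (Finset.ssubset_iff_of_subset ?_ |>.2 ⟨k, ?_, ?_⟩)
  · exact Finset.monotone_filter_right _ fun l _ hl ↦ h l hl
  · simp [cluster, hk, hkp]
  · simp [cluster, hkq]

/-- The ratios involving a point `p` of a minimal cluster are determined by those relating it to
its neighbours. -/
lemma lifts_insert [IsLocalRing A] [IsLocalHom φ] [DecidableEq ι] {S : Finset ι} {i p : ι}
    (hi : i ∈ S) (hp : p ∈ S) (hip : i ≠ p)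
    (hmin : ∀ a ∈ S, ∀ b ∈ S, a ≠ b → (R.cluster S i p).card ≤ (R.cluster S a b).card)
    (hF : ∀ j ∈ S, j ≠ i → R.F i j p)
    (hinj : Set.InjOn u S)
    (hold : ∀ a ∈ S.erase p, ∀ b ∈ S.erase p, ∀ c ∈ S.erase p, a ≠ b → R.F a b c →
      R.Good φ u a b c)
    (hnew : ∀ j ∈ S.erase p, j ≠ i → R.Good φ u i j p) : R.Lifts φ u S := by
  -- No `j` is strictly closer to `p` than to `i`. Otherwise `r j i p` is not a unit, so `r i j p =
  -- 1 - r j i p` is one and `j` is as close to `i` as `p` is. Then the cluster of `j` with radius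
  -- reaching `p` lies in that of `i` but misses `i`, against minimality.
  have hpi : ∀ j ∈ S.erase p, j ≠ i → R.F j p i := by
    intro j hj hji
    obtain ⟨hjp, hjS⟩ := Finset.mem_erase.1 hj
    obtain ⟨h1, h2⟩ := R.swap hji.symm (hF j hjS hji)
    by_contra hcon
    have h3 : ¬ IsUnit (R.r j i p) := fun h ↦ hcon (R.inv hji hjp h1 h)
    have h4 : IsUnit (R.r i j p) := by
      rcases IsLocalRing.isUnit_or_isUnit_of_add_one
        (show R.r i j p + R.r j i p = 1 by rw [h2]; ring) with h | h
      · exact h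
      · exact absurd h h3
    have h5 := R.inv hji.symm hip (hF j hjS hji) h4
    refine absurd (hmin j hjS p hp hjp) (not_le.2 (card_cluster_lt hi (R.F_left i p) hcon ?_))
    intro l hl
    have h6 := (R.trans hji hjp h1 hl).1
    exact (R.trans hip hji.symm h5 (R.swap hji h6).1).1
  have hjip : ∀ j ∈ S.erase p, j ≠ i → R.F j i p ∧ R.Good φ u j i p := fun j hj hji ↦
    ⟨(R.swap hji.symm (hF j (Finset.mem_of_mem_erase hj) hji)).1,
      (hnew j hj hji).swap hji.symm (hF j (Finset.mem_of_mem_erase hj) hji)⟩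
  have hjpi : ∀ j ∈ S.erase p, j ≠ i → R.Good φ u j p i := fun j hj hji ↦
    (hjip j hj hji).2.inv hji (Finset.ne_of_mem_erase hj) (hjip j hj hji).1 (hpi j hj hji)
  have hiT : i ∈ S.erase p := Finset.mem_erase.2 ⟨hip, hi⟩
  -- The remaining ratios factor through `i`: here `r j k p = r j k i * r j i p`, and in `hB` below
  -- `r j p k = r j p i * r j i k`.
  have hA : ∀ j ∈ S.erase p, ∀ k ∈ S.erase p, j ≠ k → R.F j k p → R.Good φ u j k p := by
    intro j hj k hk hjk h
    by_cases hji : j = i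
    · subst hji
      exact hnew k hk hjk.symm
    by_cases hki : k = i
    · subst hki
      exact (hjip j hj hji).2
    have h1 := (R.trans hjk (Finset.ne_of_mem_erase hj) h (hpi j hj hji)).1
    exact (hold j hj k hk i hiT hjk h1).trans hjk hji h1 (hjip j hj hji).1 (hjip j hj hji).2
  have hB : ∀ j ∈ S.erase p, ∀ k ∈ S.erase p, R.F j p k → R.Good φ u j p k := by
    intro j hj k hk h
    have hjp := Finset.ne_of_mem_erase hj
    by_cases hkj : k = j
    · subst hkj
      exact good_left hjp
    by_cases hji : j = i
    · subst hji
      exact (hnew k hk hkj).inv (Ne.symm hkj) hip (hF k (Finset.mem_of_mem_erase hk) hkj) h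
    by_cases hki : k = i
    · subst hki
      exact hjpi j hj hji
    have h1 := (R.trans hji hjp (hjip j hj hji).1 h).1
    exact (hjpi j hj hji).trans hjp hji (hpi j hj hji) h1 (hold j hj i hiT k hk hji h1)
  refine ⟨hinj, fun a ha b hb c hc hab h ↦ ?_⟩
  by_cases hca : c = a
  · subst hca
    exact good_left hab
  by_cases hcb : c = b
  · subst hcb
    exact good_right hab
  have hm : ∀ {x}, x ∈ S → x ≠ p → x ∈ S.erase p := fun hx h ↦ Finset.mem_erase.2 ⟨h, hx⟩
  by_cases hap : a = p
  · subst hap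
    exact (hB b (hm hb hab.symm) c (hm hc hca) (R.swap hab h).1).swap hab.symm (R.swap hab h).1
  by_cases hbp : b = p
  · subst hbp
    exact hB a (hm ha hab) c (hm hc hcb) h
  by_cases hcp : c = p
  · subst hcp
    exact hA a (hm ha hap) b (hm hb hbp) hab h
  exact hold a (hm ha hap) b (hm hb hbp) c (hm hc hcp) hab h

/-- A free lift `y` of `x`: the ring is `D[X]` localized at the preimage of the maximal ideal of
`A`, with `y = X`. Comparing the coefficients of `1` and `X` shows that `f a = y * f b` only when
`a` and `b` vanish, which will keep a new point distinct from the old ones. -/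
lemma exists_localization [IsLocalRing A] [IsDomain D] (φ : D →+* A) (x : A) :
    ∃ (D' : Type) (_ : CommRing D') (_ : IsDomain D') (f : D →+* D') (ψ : D' →+* A) (y : D'),
      IsLocalRing D' ∧ IsLocalHom ψ ∧ ψ.comp f = φ ∧ ψ y = x ∧
        ∀ a b, f a = y * f b → a = 0 ∧ b = 0 := by
  let g : Polynomial D →+* A := Polynomial.eval₂RingHom φ x
  let P := (IsLocalRing.maximalIdeal A).comap g
  have hP : ∀ s : P.primeCompl, IsUnit (g s) := fun s ↦ by
    by_contra h
    exact s.2 ((IsLocalRing.mem_maximalIdeal _).2 h)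
  let ψ : Localization.AtPrime P →+* A := IsLocalization.lift (M := P.primeCompl) hP
  have hψ : ∀ z, ψ (algebraMap _ _ z) = g z := fun z ↦ IsLocalization.lift_eq _ z
  have hinj : Function.Injective (algebraMap (Polynomial D) (Localization.AtPrime P)) :=
    IsLocalization.injective _ P.primeCompl_le_nonZeroDivisors
  refine ⟨Localization.AtPrime P, inferInstance,
    IsLocalization.isDomain_localization P.primeCompl_le_nonZeroDivisors,
    (algebraMap _ _).comp Polynomial.C, ψ, algebraMap (Polynomial D) _ Polynomial.X, inferInstance, ⟨?_⟩,
    ?_, ?_, ?_⟩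
  · intro z hz
    obtain ⟨a, s, rfl⟩ := IsLocalization.exists_mk'_eq P.primeCompl z
    rw [IsLocalization.AtPrime.isUnit_mk'_iff _ P]
    intro ha
    have h1 := congrArg ψ (IsLocalization.mk'_spec (Localization.AtPrime P) a s)
    rw [map_mul, hψ, hψ] at h1
    have h2 : IsUnit (g a) := h1 ▸ hz.mul (hP s)
    exact (IsLocalRing.mem_maximalIdeal _).1 ha h2
  · ext z
    simp [hψ, g]
  · simp [hψ, g]
  · intro a b h
    rw [RingHom.comp_apply, RingHom.comp_apply, ← map_mul] at h
    have h1 := hinj h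
    have h2 := congrArg (Polynomial.coeff · 0) h1
    have h3 := congrArg (Polynomial.coeff · 1) h1
    simp [Polynomial.coeff_C] at h2 h3
    exact ⟨h2, h3.symm⟩

/-- Induction on the number of points. Remove a point `p` of a smallest cluster, centred at `i`, and
lift the rest. If `h` is the next nearest point to `i`, the ratio `(u_i - u_p) / (u_i - u_h)` is
unconstrained by the old points and is lifted to a new variable, which places `u_p`; by
`lifts_insert` all other ratios follow. -/
theorem exists_lifts {k : Type} [Field k] [IsLocalRing A] (g : k →+* A) (R : RatioSystem ι A)
    (S : Finset ι) : ∃ (D : Type) (_ : CommRing D) (_ : IsDomain D) (c : k →+* D) (φ : D →+* A)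
      (u : ι → D), IsLocalRing D ∧ IsLocalHom φ ∧ φ.comp c = g ∧ R.Lifts φ u S := by
  classical
  induction hn : S.card using Nat.strong_induction_on generalizing S with
  | _ n ih =>
  by_cases hS : S.card ≤ 1
  · refine ⟨k, inferInstance, inferInstance, RingHom.id k, g, 0, inferInstance, inferInstance,
      rfl, ?_, ?_⟩
    · exact fun a ha b hb _ ↦ Finset.card_le_one.1 hS a ha b hb
    · exact fun a ha b hb _ _ hab ↦ absurd (Finset.card_le_one.1 hS a ha b hb) hab
  obtain ⟨i0, hi0, j0, hj0, hij0⟩ := Finset.one_lt_card.1 (not_le.1 hS)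
  obtain ⟨⟨i, p⟩, hmem, hmin⟩ := Finset.exists_min_image S.offDiag
    (fun q ↦ (R.cluster S q.1 q.2).card) ⟨(i0, j0), Finset.mem_offDiag.2 ⟨hi0, hj0, hij0⟩⟩
  obtain ⟨hi, hp, hip⟩ := Finset.mem_offDiag.1 hmem
  have hmin' : ∀ a ∈ S, ∀ b ∈ S, a ≠ b → (R.cluster S i p).card ≤ (R.cluster S a b).card :=
    fun a ha b hb hab ↦ hmin (a, b) (Finset.mem_offDiag.2 ⟨ha, hb, hab⟩)
  dsimp only at hi hp hip
  -- By minimality `p` is nearest to `i`: a strictly closer `j` would give a smaller cluster around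
  -- `i`.
  have hF : ∀ j ∈ S, j ≠ i → R.F i j p := by
    intro j hj hji
    by_contra hcon
    have h1 := (R.total hji.symm hip).resolve_left hcon
    exact absurd (hmin' i hi j hj hji.symm) (not_le.2 (card_cluster_lt hp (R.F_right i p) hcon
      fun l hl ↦ (R.trans hip hji.symm h1 hl).1))
  by_cases hT : ∃ j ∈ S.erase p, j ≠ i
  · obtain ⟨j1, hj1, hj1i⟩ := hT
    obtain ⟨h, hh, hhmin⟩ := Finset.exists_min_image ((S.erase p).erase i)
      (fun q ↦ (R.cluster S i q).card) ⟨j1, Finset.mem_erase.2 ⟨hj1i, hj1⟩⟩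
    obtain ⟨hhi, hhT⟩ := Finset.mem_erase.1 hh
    have hFh : ∀ j ∈ S.erase p, j ≠ i → R.F i j h := by
      intro j hj hji
      by_contra hcon
      have h1 := (R.total hji.symm hhi.symm).resolve_left hcon
      exact absurd (hhmin j (Finset.mem_erase.2 ⟨hji, hj⟩)) (not_le.2 (card_cluster_lt
        (Finset.mem_of_mem_erase hhT) (R.F_right i h) hcon
        fun l hl ↦ (R.trans hhi.symm hji.symm h1 hl).1))
    obtain ⟨D, _, _, c, φ, u, hD, hφ, hc, hu, hgood⟩ := ih _
      (by rw [← hn]; exact Finset.card_erase_lt_of_mem hp) (S.erase p) rfl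
    obtain ⟨D', _, _, f, ψ, x, hD', hψ, hf, hx, hlin⟩ := exists_localization φ (R.r i h p)
    have hfinj : ∀ a, f a = 0 → a = 0 := fun a ha ↦ (hlin a 0 (by rw [ha, map_zero, mul_zero])).1
    -- Chosen so that `u'_i - u'_p = x (u'_i - u'_h)`, with `x` the lift of `r i h p`.
    let u' : ι → D' := fun j ↦ if j = p then f (u i) - x * f (u i - u h) else f (u j)
    have hu' : ∀ j ∈ S.erase p, u' j = f (u j) := fun j hj ↦ if_neg (Finset.ne_of_mem_erase hj)
    have hu'p : u' p = f (u i) - x * f (u i - u h) := if_pos rfl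
    have hiT : i ∈ S.erase p := Finset.mem_erase.2 ⟨hip, hi⟩
    have hnep : ∀ j ∈ S.erase p, u' p ≠ u' j := by
      intro j hj hcon
      rw [hu'p, hu' j hj] at hcon
      have h1 := (hlin (u i - u j) (u i - u h) (by rw [map_sub]; linear_combination hcon)).2
      exact hhi (hu hhT hiT (sub_eq_zero.1 h1).symm)
    refine ⟨D', inferInstance, inferInstance, f.comp c, ψ, u', hD', hψ,
      by rw [← RingHom.comp_assoc, hf, hc], ?_⟩
    refine lifts_insert hi hp hip hmin' hF ?_ ?_ ?_
    · intro a ha b hb hab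
      by_cases hap : a = p
      · by_cases hbp : b = p
        · rw [hap, hbp]
        · exact absurd (hap ▸ hab) (hnep b (Finset.mem_erase.2 ⟨hbp, hb⟩))
      · have ha' := Finset.mem_erase.2 ⟨hap, ha⟩
        by_cases hbp : b = p
        · exact absurd (hbp ▸ hab).symm (hnep a ha')
        · have hb' := Finset.mem_erase.2 ⟨hbp, hb⟩
          rw [hu' a ha', hu' b hb', ← sub_eq_zero, ← map_sub] at hab
          exact hu ha' hb' (sub_eq_zero.1 (hfinj _ hab))
    · intro a ha b hb c hc hab hF
      exact (hgood a ha b hb c hc hab hF).map hf (hu' a ha) (hu' b hb) (hu' c hc)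
    · intro j hj hji
      -- The ratio `r i j p` is `r i j h * r i h p`: the first factor was lifted before, the second
      -- is the new variable.
      have h1 : R.Good ψ u' i h p :=
        ⟨x, by rw [hu'p, hu' i hiT, hu' h hhT, map_sub]; ring, hx⟩
      exact ((hgood i hiT j hj h hhT hji.symm (hFh j hj hji)).map hf (hu' i hiT) (hu' j hj)
        (hu' h hhT)).trans hji.symm hhi.symm (hFh j hj hji)
        (hF h (Finset.mem_of_mem_erase hhT) hhi) h1
  -- Only `i` and `p` are left: any two distinct points of the field, such as `0` and `1`, will do.
  · push Not at hT
    have hall : ∀ a ∈ S, a ≠ p → a = i := fun a ha hap ↦ hT a (Finset.mem_erase.2 ⟨hap, ha⟩)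
    refine ⟨k, inferInstance, inferInstance, RingHom.id k, g, fun j ↦ if j = p then 1 else 0,
      inferInstance, inferInstance, rfl, lifts_insert hi hp hip hmin' hF ?_ ?_ ?_⟩
    · intro a ha b hb hab
      by_cases hap : a = p <;> by_cases hbp : b = p
      · rw [hap, hbp]
      · simp [hap, hbp] at hab
      · simp [hap, hbp] at hab
      · rw [hall a ha hap, hall b hb hbp]
    · intro a ha b hb _ _ hab
      exact absurd ((hT a ha).trans (hT b hb).symm) hab
    · intro j hj hji
      exact absurd (hT j hj) hji

end RatioSystem
end Ratios

/-! ### Multihomogeneity of the equations -/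

section Multihomogeneous

variable {k : Type} [CommRing k] {C : Type}

lemma IsMultihomogeneous.rename {C' : Type} (g : C → C') {f : MvPolynomial (C × Fin 2) k}
    (hf : IsMultihomogeneous f) : IsMultihomogeneous (MvPolynomial.rename (Prod.map g id) f) := by
  intro A _ φ s l
  obtain ⟨w, hw⟩ := hf φ (fun p ↦ s (Prod.map g id p)) fun c ↦ l (g c)
  refine ⟨w, ?_⟩
  rw [MvPolynomial.eval₂_rename, MvPolynomial.eval₂_rename]
  exact hw

lemma isMultihomogeneous_num (c : C) : IsMultihomogeneous (num c : MvPolynomial (C × Fin 2) k) :=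
  fun _ _ l ↦ ⟨l c, by simp⟩

lemma isMultihomogeneous_num_sub (c : C) (a : k) :
    IsMultihomogeneous (num c - MvPolynomial.C a * den c : MvPolynomial (C × Fin 2) k) :=
  fun _ _ l ↦ ⟨l c, by simp; ring⟩

variable {n : ℕ}

lemma isMultihomogeneous_of_mem_nuEquations {f : MvPolynomial (Pairs n × Fin 2) Base}
    (hf : f ∈ nuEquations n) : IsMultihomogeneous f := by
  rcases hf with ⟨i, j, h, rfl⟩ | ⟨i, j, k, hij, hik, hjk, rfl⟩
  · exact fun _ _ l ↦ ⟨l (pr i j h) * l (pr j i h.symm), by simp; ring⟩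
  · exact fun _ _ l ↦ ⟨l (pr i j hij) * l (pr i k hik) * l (pr j k hjk), by simp; ring⟩

lemma isMultihomogeneous_of_mem_muEquations {f : MvPolynomial (Triples n × Fin 2) Base}
    (hf : f ∈ muEquations n) : IsMultihomogeneous f := by
  rcases hf with (⟨i, j, k, hij, hik, hjk, rfl⟩ | ⟨i, j, k, hij, hik, hjk, rfl⟩) |
    ⟨i, j, k, m, hij, hik, him, hjk, hjm, hkm, rfl⟩
  · exact fun _ _ l ↦ ⟨l (tr i j k hij hik hjk) * l (tr i k j hik hij hjk.symm), by simp; ring⟩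
  · exact fun _ _ l ↦ ⟨l (tr i j k hij hik hjk) * l (tr j i k hij.symm hjk hik), by simp; ring⟩
  · exact fun _ _ l ↦ ⟨l (tr i j k hij hik hjk) * l (tr i k m hik him hkm) *
      l (tr i j m hij him hjm), by simp; ring⟩

lemma isMultihomogeneous_of_mem_mwEquations {f : MvPolynomial (Indices n × Fin 2) Base}
    (hf : f ∈ mwEquations n) : IsMultihomogeneous f := by
  rcases hf with (⟨f, hf, rfl⟩ | ⟨f, hf, rfl⟩) | ⟨i, j, k, hij, hik, hjk, rfl⟩
  · exact IsMultihomogeneous.rename _ (isMultihomogeneous_of_mem_nuEquations hf)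
  · exact IsMultihomogeneous.rename _ (isMultihomogeneous_of_mem_muEquations hf)
  · exact fun _ _ l ↦ ⟨l (.inr (tr i j k hij hik hjk)) * l (.inl (pr i k hik)) *
      l (.inl (pr i j hij)), by simp; ring⟩

end Multihomogeneous

/-! ### The identification of `Cf` with the spectrum of `CfRing` -/

section Affine

variable (n : ℕ)

instance : Finite (Pairs n) := inferInstance

lemma nuEquations_eval_iff {A : Type} [CommRing A] (g : Base →+* A) (d : Pairs n → A) :
    (∀ f ∈ nuEquations n, MvPolynomial.eval₂ g (fun p ↦ if p.2 = 0 then 1 else d p.1) f = 0) ↔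
      ∀ f ∈ deltaEquations n, MvPolynomial.eval₂ g d f = 0 := by
  constructor
  · rintro h f (⟨i, j, k, hij, hik, hjk, rfl⟩ | ⟨i, j, hij, rfl⟩)
    · have := h _ (Or.inr ⟨i, j, k, hij, hik, hjk, rfl⟩)
      simp at this ⊢
      linear_combination this
    · have := h _ (Or.inl ⟨i, j, hij, rfl⟩)
      simp at this ⊢
      linear_combination this
  · rintro h f (⟨i, j, hij, rfl⟩ | ⟨i, j, k, hij, hik, hjk, rfl⟩)
    · have := h _ (Or.inr ⟨i, j, hij, rfl⟩)
      simp at this ⊢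
      linear_combination this
    · have := h _ (Or.inl ⟨i, j, k, hij, hik, hjk, rfl⟩)
      simp at this ⊢
      linear_combination this

variable {n}

lemma CfRing.exists_lift {A : Type} [CommRing A] (g : Base →+* A) (d : Pairs n → A)
    (h : ∀ f ∈ deltaEquations n, MvPolynomial.eval₂ g d f = 0) :
    ∃ κ : CfRing n →+* A, κ.comp (algebraMap Base (CfRing n)) = g ∧ ∀ c, κ (delta c) = d c := by
  refine ⟨Ideal.Quotient.lift (Ideal.span (deltaEquations n)) (MvPolynomial.eval₂Hom g d) ?_,
    ?_, ?_⟩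
  · intro a ha
    have : Ideal.span (deltaEquations n) ≤ RingHom.ker (MvPolynomial.eval₂Hom g d) :=
      Ideal.span_le.2 h
    exact this ha
  · ext x
    · exact MvPolynomial.eval₂_C _ _ _
    · exact MvPolynomial.eval₂_C _ _ _
  · intro c
    exact MvPolynomial.eval₂_X _ _ _

lemma CfRing.hom_ext {A : Type} [CommRing A] {κ κ' : CfRing n →+* A}
    (h : κ.comp (algebraMap Base (CfRing n)) = κ'.comp (algebraMap Base (CfRing n)))
    (hd : ∀ c, κ (delta c) = κ' (delta c)) : κ = κ' := by
  refine Ideal.Quotient.ringHom_ext (MvPolynomial.ringHom_ext (fun x ↦ ?_) hd)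
  exact RingHom.congr_fun h x

lemma CfRing.eval_delta {f : MvPolynomial (Pairs n) Base} (hf : f ∈ deltaEquations n) :
    MvPolynomial.eval₂ (algebraMap Base (CfRing n)) delta f = 0 := by
  have h1 : MvPolynomial.eval₂Hom (algebraMap Base (CfRing n)) delta = CfRing.mk n :=
    MvPolynomial.ringHom_ext (fun x ↦ MvPolynomial.eval₂_C _ _ _)
      fun c ↦ MvPolynomial.eval₂_X _ _ _
  have h2 : CfRing.mk n f = 0 := Ideal.Quotient.eq_zero_iff_mem.2 (Ideal.subset_span hf)
  rw [← h1] at h2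
  exact h2

/-- The second relation reads `(1 - ε δ_ij) (1 - ε δ_ji) = 1`. In terms of `ν` this is the condition
`ν_ij ≠ ε`. -/
lemma CfRing.isUnit_one_sub (c : Pairs n) :
    IsUnit (1 - algebraMap Base (CfRing n) eps * delta c) := by
  obtain ⟨⟨i, j⟩, h⟩ := c
  refine IsUnit.of_mul_eq_one (1 - algebraMap Base (CfRing n) eps * delta (pr j i h.symm)) ?_
  have := delta_add_delta n i j h
  linear_combination -algebraMap Base (CfRing n) eps * this

lemma scalars_comp_specMap {T : Scheme.{0}} {A B : Type} [CommRing A] [CommRing B]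
    (κ : T ⟶ Spec (.of A)) (f : B →+* A) (b : B) :
    scalars (κ ≫ Spec.map (CommRingCat.ofHom f)) b = scalars κ (f b) := by
  simp only [scalars, Scheme.Hom.comp_appTop, ← Scheme.ΓSpecIso_inv_naturality_assoc]
  rfl

lemma eq_of_scalars_eq {T : Scheme.{0}} {A : Type} [CommRing A] {κ κ' : T ⟶ Spec (.of A)}
    (h : scalars κ = scalars κ') : κ = κ' := by
  rw [eq_toSpecΓ_comp_scalars κ, eq_toSpecΓ_comp_scalars κ']
  exact congrArg (fun z ↦ T.toSpecΓ ≫ Spec.map (CommRingCat.ofHom z)) h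

lemma CfRing.toLines_hom : CfRing.toLines n ≫ (lines Base (Pairs n)).hom =
    Spec.map (CommRingCat.ofHom (algebraMap Base (CfRing n))) :=
  Over.w (Pi.lift fun _ : Pairs n ↦ Over.homMk (ofCoords _ _ _) (ofCoords_str _ _ _) :
    Over.mk (Spec.map (CommRingCat.ofHom (algebraMap Base (CfRing n)))) ⟶ lines Base (Pairs n))

lemma CfRing.toLines_proj (c : Pairs n) : CfRing.toLines n ≫ lines.proj c =
    ofCoords (Spec.map (CommRingCat.ofHom (algebraMap Base (CfRing n))))
      (fun a : Fin 2 ↦ (Scheme.ΓSpecIso (.of (CfRing n))).inv (if a = 0 then 1 else delta c))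
      ((Ideal.eq_top_iff_one _).2 (Ideal.subset_span ⟨0, by simp⟩)) := by
  have : (Pi.lift fun c : Pairs n ↦ Over.homMk (ofCoords
      (Spec.map (CommRingCat.ofHom (algebraMap Base (CfRing n))))
      (fun a : Fin 2 ↦ (Scheme.ΓSpecIso (.of (CfRing n))).inv (if a = 0 then 1 else delta c))
      ((Ideal.eq_top_iff_one _).2 (Ideal.subset_span ⟨0, by simp⟩))) (ofCoords_str _ _ _) :
    Over.mk (Spec.map (CommRingCat.ofHom (algebraMap Base (CfRing n)))) ⟶ lines Base (Pairs n)) ≫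
      Pi.π (fun _ : Pairs n ↦ PS.over (Fin 2) Base) c = _ := Pi.lift_π _ c
  exact congrArg CommaMorphism.left this

lemma CfRing.coords {T : Scheme.{0}} (κ : T ⟶ Spec (.of (CfRing n))) :
    LCoords (κ ≫ CfRing.toLines n) fun p ↦ if p.2 = 0 then 1 else scalars κ (delta p.1) := by
  intro c
  rw [Category.assoc, CfRing.toLines_proj]
  convert (coords_ofCoords _ _ _).comp κ using 2 with a
  change (if a = 0 then 1 else scalars κ (delta c)) = _
  split_ifs
  · rw [map_one, map_one]
  · rfl

lemma CfRing.eq_of_comp_toLines {T : Scheme.{0}} {κ κ' : T ⟶ Spec (.of (CfRing n))}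
    (h : κ ≫ CfRing.toLines n = κ' ≫ CfRing.toLines n) : κ = κ' := by
  refine eq_of_scalars_eq (CfRing.hom_ext ?_ fun c ↦ ?_)
  · refine RingHom.ext fun x ↦ ?_
    have := congrArg (· ≫ (lines Base (Pairs n)).hom) h
    simp only [Category.assoc, CfRing.toLines_hom] at this
    rw [RingHom.comp_apply, RingHom.comp_apply, ← scalars_comp_specMap, ← scalars_comp_specMap, this]
  · have h1 := CfRing.coords κ c
    have h2 := CfRing.coords κ' c
    rw [h] at h1
    simpa using (h1.mul_eq_mul h2 1 0)

instance : Mono (CfRing.toLines n) := ⟨fun _ _ h ↦ CfRing.eq_of_comp_toLines h⟩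

lemma exists_lcoords_of_mem_nuOpen {T : Scheme.{0}} (h : T ⟶ (lines Base (Pairs n)).left)
    (hnu : ∀ x, h x ∈ nuOpen n) :
    ∃ d : Pairs n → Γ(T, ⊤), LCoords h fun p ↦ if p.2 = 0 then 1 else d p.1 := by
  have : ∀ c : Pairs n, ∃ s : Fin 2 → Γ(T, ⊤), s 0 = 1 ∧ Coords (h ≫ lines.proj c) s := by
    intro c
    refine exists_coords_of_preimage_eq_top _ 0 ?_
    ext x
    refine iff_of_true ?_ trivial
    obtain ⟨U, hU, s, hs, -⟩ := exists_local_lcoords h x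
    have h1 := hnu x
    rw [nuOpen, ← SetLike.mem_coe, TopologicalSpace.Opens.coe_iInf, Set.mem_iInter] at h1
    have h2 := (h1 c).1
    have h3 := (mem_nonvanishing_iff hs (isMultihomogeneous_num c) ⟨x, hU⟩).1 h2
    have h4 := (hs c).preimage_basicOpen 0
    simp only [evalSections_eq, MvPolynomial.eval₂_X] at h3
    rw [← h4] at h3
    rw [Category.assoc] at h3
    exact h3
  choose s hs0 hs using this
  refine ⟨fun c ↦ s c 1, fun c ↦ ?_⟩
  convert hs c using 2 with a
  fin_cases a <;> simp [hs0]

/-- Since `ν_ij ≠ 0`, the coordinates can be normalized to `[1 : δ_ij]`, and with this normalization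
the equations for `ν` are literally those for `δ`. -/
lemma exists_toCfRing {T : Scheme.{0}} (h : T ⟶ (lines Base (Pairs n)).left)
    (hnu : ∀ x, h x ∈ nuOpen n)
    (h0 : ∀ s, LCoords h s → ∀ f ∈ nuEquations n,
      evalSections (h ≫ (lines Base (Pairs n)).hom) s f = 0) :
    ∃ κ : T ⟶ Spec (.of (CfRing n)), κ ≫ CfRing.toLines n = h := by
  obtain ⟨d, hd⟩ := exists_lcoords_of_mem_nuOpen h hnu
  obtain ⟨κ, h1, h2⟩ := CfRing.exists_lift (scalars (h ≫ (lines Base (Pairs n)).hom)) d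
    ((nuEquations_eval_iff n _ d).1 (h0 _ hd))
  refine ⟨T.toSpecΓ ≫ Spec.map (CommRingCat.ofHom κ), ?_⟩
  refine (CfRing.coords _).ext hd ?_ fun c ↦ ?_
  · rw [Category.assoc, CfRing.toLines_hom, Category.assoc, ← Spec.map_comp,
      ← CommRingCat.ofHom_comp, h1]
    exact (eq_toSpecΓ_comp_scalars _).symm
  · simp [scalars_toSpecΓ_comp, h2]

lemma toLines_mem_nuOpen (x : Spec (.of (CfRing n))) : CfRing.toLines n x ∈ nuOpen n := by
  have h := CfRing.coords (𝟙 (Spec (.of (CfRing n))))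
  rw [Category.id_comp] at h
  rw [nuOpen, ← SetLike.mem_coe, TopologicalSpace.Opens.coe_iInf, Set.mem_iInter]
  refine fun c ↦ ⟨?_, ?_⟩
  · refine (mem_nonvanishing_iff h (isMultihomogeneous_num c) x).2 ?_
    rw [Scheme.basicOpen_of_isUnit]
    · trivial
    · simp [evalSections_eq]
  · refine (mem_nonvanishing_iff h (isMultihomogeneous_num_sub c _) x).2 ?_
    rw [Scheme.basicOpen_of_isUnit]
    · trivial
    · have := (CfRing.isUnit_one_sub c).map (scalars (𝟙 (Spec (.of (CfRing n)))))
      have h2 : scalars (𝟙 (Spec (.of (CfRing n)))) (algebraMap Base (CfRing n) eps) =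
          scalars (CfRing.toLines n ≫ (lines Base (Pairs n)).hom) eps := by
        rw [CfRing.toLines_hom, ← scalars_comp_specMap, Category.id_comp]
      simpa [evalSections_eq, h2] using this

lemma eval_nuEquations_toLines {T : Scheme.{0}} (κ : T ⟶ Spec (.of (CfRing n)))
    {f : MvPolynomial (Pairs n × Fin 2) Base} (hf : f ∈ nuEquations n) :
    evalSections ((κ ≫ CfRing.toLines n) ≫ (lines Base (Pairs n)).hom)
      (fun p ↦ if p.2 = 0 then 1 else scalars κ (delta p.1)) f = 0 := by
  refine (nuEquations_eval_iff n (scalars ((κ ≫ CfRing.toLines n) ≫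
    (lines Base (Pairs n)).hom)) (fun c ↦ scalars κ (delta c))).2 (fun f hf ↦ ?_) f hf
  have h1 : scalars ((κ ≫ CfRing.toLines n) ≫ (lines Base (Pairs n)).hom) =
      (scalars κ).comp (algebraMap Base (CfRing n)) := by
    rw [Category.assoc, CfRing.toLines_hom]
    exact RingHom.ext fun x ↦ scalars_comp_specMap _ _ _
  rw [h1]
  have h2 := MvPolynomial.hom_eval₂ f (algebraMap Base (CfRing n)) (scalars κ) delta
  rw [CfRing.eval_delta hf, map_zero] at h2
  exact h2.symm

variable (n)

instance : Mono (CfBar.ι n) := inferInstanceAs (Mono (vanishingSheaf (nuEquations n)).subschemeι)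

lemma exists_toCfBar : ∃ l, l ≫ CfBar.ι n = CfRing.toLines n :=
  exists_lift_vanishingSheaf (fun _ hf ↦ isMultihomogeneous_of_mem_nuEquations hf) _ fun _ ↦
    ⟨_, CfRing.coords _, fun _ hf ↦ eval_nuEquations_toLines _ hf⟩

lemma exists_toCf : ∃ m, m ≫ (Cf n).ι ≫ CfBar.ι n = CfRing.toLines n := by
  obtain ⟨l, hl⟩ := exists_toCfBar n
  have hrange : Set.range l ⊆ Set.range (Cf n).ι := by
    rw [Scheme.Opens.range_ι]
    rintro _ ⟨x, rfl⟩
    change CfBar.ι n (l x) ∈ nuOpen n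
    rw [← Scheme.Hom.comp_apply, hl]
    exact toLines_mem_nuOpen x
  exact ⟨IsOpenImmersion.lift (Cf n).ι l hrange,
    by rw [← Category.assoc, IsOpenImmersion.lift_fac, hl]⟩

lemma exists_cf_toCfRing : ∃ κ, κ ≫ CfRing.toLines n = (Cf n).ι ≫ CfBar.ι n :=
  exists_toCfRing ((Cf n).ι ≫ CfBar.ι n) (fun x ↦ x.2) fun _ hs _ hf ↦
    evalSections_eq_zero_of_lift (fun _ hf ↦ isMultihomogeneous_of_mem_nuEquations hf)
      (Cf n).ι hs hf

/-- Both schemes are subobjects of `(ℙ¹)^{p([n])} × 𝔸¹`, and each factors through the other. -/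
theorem exists_cfIso : ∃ c : (Cf n).toScheme ≅ Spec (.of (CfRing n)),
    c.hom ≫ CfRing.toLines n = (Cf n).ι ≫ CfBar.ι n := by
  obtain ⟨m, hm⟩ := exists_toCf n
  obtain ⟨κ, hκ⟩ := exists_cf_toCfRing n
  refine ⟨⟨κ, m, ?_, ?_⟩, hκ⟩
  · rw [← cancel_mono ((Cf n).ι ≫ CfBar.ι n), Category.assoc, hm, hκ, Category.id_comp]
  · rw [← cancel_mono (CfRing.toLines n), Category.assoc, hκ, hm, Category.id_comp]

end Affine

/-! ### Morphisms to and from the blowup of an ideal -/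

section Blowup

variable {R : Type} [CommRing R] (I : Ideal R)

/-- The constants in the degree zero part of a localization of the Rees algebra. -/
def reesConst (x : reesAlgebra I) : R →+* HomogeneousLocalization.Away (reesGrading I) x :=
  (HomogeneousLocalization.fromZeroRingHom (reesGrading I) (.powers x)).comp
    (algebraMap R (reesGrading I 0))

/-- In the chart where `x T` is inverted, `t = (t T / x T) x`: the ideal `I` becomes generated by
`x`. -/
lemma reesConst_eq {r : reesAlgebra I} (hr : r ∈ reesGrading I 1) {x t : R} (hx : x ∈ I ^ 1)
    (ht : t ∈ I ^ 1) (h : r = reesMonomial I 1 x hx) :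
    reesConst I r t = HomogeneousLocalization.Away.mk (reesGrading I) (d := 1) hr 1
      (reesMonomial I 1 t ht) (by simpa using reesMonomial_mem I 1 t ht) * reesConst I r x := by
  subst h
  apply HomogeneousLocalization.val_injective
  rw [HomogeneousLocalization.val_mul, HomogeneousLocalization.Away.val_mk]
  change Localization.mk (algebraMap R (reesAlgebra I) t) 1 =
    _ * Localization.mk (algebraMap R (reesAlgebra I) x) 1
  rw [Localization.mk_mul, Localization.mk_eq_mk_iff, Localization.r_iff_exists]
  refine ⟨1, ?_⟩
  apply Subtype.ext
  change 1 * (Polynomial.monomial 1 x ^ 1 * 1 * Polynomial.C t : Polynomial R) =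
    1 * (1 * (Polynomial.monomial 1 t * Polynomial.C x))
  rw [pow_one, mul_one, one_mul, one_mul, one_mul, Polynomial.monomial_mul_C,
    Polynomial.monomial_mul_C, mul_comm]

/-- Generators of `I` generate the Rees algebra over `R`, degree by degree. Consequently the charts
of the blowup are generated over `R` by the ratios `t_j / t_i`. -/
lemma exists_eq_coordsToRees {σ : Type} (t : σ → R) (ht : ∀ i, t i ∈ I)
    (hI : I ≤ Ideal.span (Set.range t)) (m : ℕ) (y : R) (hy : y ∈ I ^ m) :
    ∃ f : MvPolynomial σ R, f ∈ stdGrading σ R m ∧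
      coordsToRees (k := R) I t ht f = reesMonomial I m y hy := by
  have h1 : ∀ x (hx : x ∈ I ^ 1), ∃ f : MvPolynomial σ R, f ∈ stdGrading σ R 1 ∧
      coordsToRees (k := R) I t ht f = reesMonomial I 1 x hx := by
    intro x hx
    have : ∀ x ∈ Ideal.span (Set.range t), ∃ (hx : x ∈ I ^ 1) (f : MvPolynomial σ R),
        f ∈ stdGrading σ R 1 ∧ coordsToRees (k := R) I t ht f = reesMonomial I 1 x hx := by
      intro x hx
      induction hx using Submodule.span_induction with
      | mem x hx =>
        obtain ⟨i, rfl⟩ := hx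
        exact ⟨by simpa using ht i, MvPolynomial.X i, X_mem_stdGrading i, coordsToRees_X I t ht i⟩
      | zero =>
        refine ⟨zero_mem _, 0, zero_mem _, ?_⟩
        rw [map_zero]
        exact Subtype.ext (by simp [reesMonomial])
      | add x y _ _ hx hy =>
        obtain ⟨hx, f, hf, hf'⟩ := hx
        obtain ⟨hy, g, hg, hg'⟩ := hy
        refine ⟨add_mem hx hy, f + g, add_mem hf hg, ?_⟩
        rw [map_add, hf', hg']
        exact Subtype.ext (by simp [reesMonomial])
      | smul r x _ hx =>
        obtain ⟨hx, f, hf, hf'⟩ := hx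
        refine ⟨Ideal.mul_mem_left _ _ hx, r • f, Submodule.smul_mem _ _ hf, ?_⟩
        rw [MvPolynomial.smul_eq_C_mul, map_mul, hf']
        have : coordsToRees (k := R) I t ht (MvPolynomial.C r) =
            algebraMap R (reesAlgebra I) r := by
          change MvPolynomial.eval₂Hom _ _ (MvPolynomial.C r) = _
          simp
        rw [this]
        apply Subtype.ext
        simp [reesMonomial, ← Polynomial.C_mul_monomial, Polynomial.C_eq_algebraMap]
    exact (this x (hI (by simpa using hx))).2
  induction m generalizing y with
  | zero =>
    refine ⟨MvPolynomial.C y, MvPolynomial.isHomogeneous_C σ y, ?_⟩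
    change MvPolynomial.eval₂Hom _ _ (MvPolynomial.C y) = _
    rw [MvPolynomial.coe_eval₂Hom, MvPolynomial.eval₂_C]
    apply Subtype.ext
    simp [reesMonomial]
  | succ m ih =>
    have key : ∀ z ∈ I ^ m * I ^ 1, ∃ (hz : z ∈ I ^ (m + 1)) (f : MvPolynomial σ R),
        f ∈ stdGrading σ R (m + 1) ∧
          coordsToRees (k := R) I t ht f = reesMonomial I (m + 1) z hz := by
      intro z hz
      refine Submodule.mul_induction_on hz ?_ ?_
      · intro a ha b hb
        obtain ⟨f, hf, hf'⟩ := ih a ha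
        obtain ⟨g, hg, hg'⟩ := h1 b hb
        refine ⟨by rw [pow_add]; exact Ideal.mul_mem_mul ha hb, f * g,
          SetLike.mul_mem_graded hf hg, ?_⟩
        rw [map_mul, hf', hg']
        exact Subtype.ext (by simp [reesMonomial, Polynomial.monomial_mul_monomial])
      · rintro x y ⟨hx, f, hf, hf'⟩ ⟨hy, g, hg, hg'⟩
        refine ⟨add_mem hx hy, f + g, add_mem hf hg, ?_⟩
        rw [map_add, hf', hg']
        exact Subtype.ext (by simp [reesMonomial])
    exact (key y (by rwa [← pow_add])).2

lemma eq_reesMonomial {m : ℕ} {f : reesAlgebra I} (hf : f ∈ reesGrading I m) :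
    f = reesMonomial I m ((f : Polynomial R).coeff m) (f.2 m) := by
  apply Subtype.ext
  ext i
  by_cases h : i = m
  · subst h
    simp [reesMonomial]
  · simp [reesMonomial, Polynomial.coeff_monomial, Ne.symm h, hf i h]

lemma away_map_reesConst {k σ : Type} [CommRing k] [Algebra k R] (t : σ → R) (ht : ∀ i, t i ∈ I)
    (r : MvPolynomial σ k) (c : k) :
    HomogeneousLocalization.Away.map (coordsToRees (k := k) I t ht) r (awayConst r c) =
      reesConst I _ (algebraMap k R c) := by
  apply HomogeneousLocalization.val_injective
  change Localization.mk _ _ = Localization.mk _ _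
  congr 1
  · change MvPolynomial.eval₂Hom _ _ (MvPolynomial.C c) = _
    rw [MvPolynomial.coe_eval₂Hom, MvPolynomial.eval₂_C]
    rfl
  · exact Subtype.ext (map_one (coordsToRees (k := k) I t ht))

lemma away_map_ratio {k σ : Type} [CommRing k] [Algebra k R] (t : σ → R) (ht : ∀ i, t i ∈ I)
    (i j : σ) : HomogeneousLocalization.Away.map (coordsToRees (k := k) I t ht)
      (MvPolynomial.X i) (ratio i j) = HomogeneousLocalization.Away.mk (reesGrading I) (d := 1)
        ((coordsToRees (k := k) I t ht).map_mem (X_mem_stdGrading i)) 1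
        (reesMonomial I 1 (t j) (by simpa using ht j))
        (by simpa using reesMonomial_mem I 1 (t j) _) := by
  refine (HomogeneousLocalization.Away.map_mk _ _ (X_mem_stdGrading i) 1 (MvPolynomial.X j) _).trans
    ?_
  apply HomogeneousLocalization.val_injective
  rw [HomogeneousLocalization.Away.val_mk, HomogeneousLocalization.Away.val_mk]
  exact congrArg (fun z ↦ Localization.mk z _) (coordsToRees_X I t ht j)

lemma rees_away_hom_ext_of_eq {B σ : Type} [CommRing B] (t : σ → R) (ht : ∀ i, t i ∈ I)
    (hI : I ≤ Ideal.span (Set.range t)) (i : σ) {r : reesAlgebra I} (hr : r ∈ reesGrading I 1)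
    (h : coordsToRees (k := R) I t ht (MvPolynomial.X i) = r)
    {a a' : HomogeneousLocalization.Away (reesGrading I) r →+* B}
    (hR : a.comp (reesConst I _) = a'.comp (reesConst I _))
    (hX : ∀ j, a (HomogeneousLocalization.Away.mk (reesGrading I) (d := 1) hr 1
        (reesMonomial I 1 (t j) (by simpa using ht j))
        (by simpa using reesMonomial_mem I 1 (t j) _)) =
      a' (HomogeneousLocalization.Away.mk (reesGrading I) (d := 1) hr 1
        (reesMonomial I 1 (t j) (by simpa using ht j))
        (by simpa using reesMonomial_mem I 1 (t j) _))) : a = a' := by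
  subst h
  have h1 : a.comp (HomogeneousLocalization.Away.map (coordsToRees (k := R) I t ht) _) =
      a'.comp (HomogeneousLocalization.Away.map (coordsToRees (k := R) I t ht) _) := by
    refine away_hom_ext (fun c ↦ ?_) fun j ↦ ?_
    · rw [RingHom.comp_apply, RingHom.comp_apply, away_map_reesConst]
      exact RingHom.congr_fun hR c
    · rw [RingHom.comp_apply, RingHom.comp_apply, away_map_ratio]
      exact hX j
  ext x
  obtain ⟨m, f, hf, rfl⟩ := HomogeneousLocalization.Away.mk_surjective (reesGrading I)
    (d := 1) hr x
  have hf' : f ∈ reesGrading I m := by simpa using hf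
  obtain ⟨p, hp, hp'⟩ := exists_eq_coordsToRees I t ht hI m _ (f.2 m)
  rw [← eq_reesMonomial I hf'] at hp'
  have h2 := RingHom.congr_fun h1 (HomogeneousLocalization.Away.mk (stdGrading σ R) (d := 1)
    (X_mem_stdGrading i) m p (by simpa using hp))
  rw [RingHom.comp_apply, RingHom.comp_apply, HomogeneousLocalization.Away.map_mk] at h2
  subst hp'
  exact h2

lemma rees_away_hom_ext {B : Type} [CommRing B] {k σ : Type} [CommRing k] [Algebra k R]
    (t : σ → R) (ht : ∀ i, t i ∈ I) (hI : I ≤ Ideal.span (Set.range t)) (i : σ)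
    {a a' : HomogeneousLocalization.Away (reesGrading I)
      (coordsToRees (k := k) I t ht (MvPolynomial.X i)) →+* B}
    (hR : a.comp (reesConst I _) = a'.comp (reesConst I _))
    (hX : a.comp (HomogeneousLocalization.Away.map (coordsToRees (k := k) I t ht) _) =
      a'.comp (HomogeneousLocalization.Away.map (coordsToRees (k := k) I t ht) _)) : a = a' := by
  refine rees_away_hom_ext_of_eq I t ht hI i
    ((coordsToRees (k := k) I t ht).map_mem (X_mem_stdGrading i))
    ((coordsToRees_X I t ht i).trans (coordsToRees_X (k := k) I t ht i).symm) hR fun j ↦ ?_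
  have := RingHom.congr_fun hX (ratio i j)
  rw [RingHom.comp_apply, RingHom.comp_apply, away_map_ratio] at this
  exact this

/-- The restriction of a morphism to the blowup to a chart. -/
lemma exists_rees_chart {k σ : Type} [CommRing k] [Algebra k R] (t : σ → R) (ht : ∀ i, t i ∈ I)
    (hI : I ≤ Ideal.span (Set.range t)) {T : Scheme.{0}} (a : T ⟶ Blowup I) {i : σ}
    (h : (a ≫ Blowup.toPS (k := k) I t ht hI) ⁻¹ᵁ
      Proj.basicOpen (stdGrading σ k) (MvPolynomial.X i) = ⊤) :
    ∃ f : HomogeneousLocalization.Away (reesGrading I)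
      (coordsToRees (k := k) I t ht (MvPolynomial.X i)) →+* Γ(T, ⊤),
      a = T.toSpecΓ ≫ Spec.map (CommRingCat.ofHom f) ≫ Proj.awayι (reesGrading I) _
        ((coordsToRees (k := k) I t ht).map_mem (X_mem_stdGrading i)) one_pos ∧
      a ≫ Blowup.toSpec I =
        T.toSpecΓ ≫ Spec.map (CommRingCat.ofHom (f.comp (reesConst I _))) ∧
      a ≫ Blowup.toPS (k := k) I t ht hI = T.toSpecΓ ≫ Spec.map (CommRingCat.ofHom
        (f.comp (HomogeneousLocalization.Away.map (coordsToRees (k := k) I t ht) _))) ≫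
        Proj.awayι (stdGrading σ k) _ (X_mem_stdGrading i) one_pos := by
  obtain ⟨f, rfl⟩ := exists_eq_toSpecΓ_comp_awayι (𝒜 := reesGrading I) a one_pos
    ((coordsToRees (k := k) I t ht).map_mem (X_mem_stdGrading i)) h
  refine ⟨f, rfl, ?_, ?_⟩
  · change CategoryStruct.comp (Y := Proj (reesGrading I)) _ (Proj.toSpecZero (reesGrading I) ≫
      Spec.map (CommRingCat.ofHom (algebraMap R (reesGrading I 0)))) = _
    rw [Category.assoc, Category.assoc, Proj.awayι_toSpecZero_assoc,
      ← Spec.map_comp, ← Spec.map_comp]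
    rfl
  · change CategoryStruct.comp (Y := Proj (reesGrading I)) _ (Proj.map _ _) = _
    rw [Category.assoc, Category.assoc, CommRingCat.ofHom_comp, Spec.map_comp,
      Category.assoc]
    congr 2
    exact Proj.awayι_comp_map _ _ _ _ _

/-- A morphism to the blowup along `I = (t_i)` is determined by its compositions with the
projections to the base and to projective space. -/
theorem Blowup.hom_ext {k σ : Type} [CommRing k] [Algebra k R] (t : σ → R) (ht : ∀ i, t i ∈ I)
    (hI : I ≤ Ideal.span (Set.range t)) {T : Scheme.{0}} {a a' : T ⟶ Blowup I}
    (h1 : a ≫ Blowup.toSpec I = a' ≫ Blowup.toSpec I)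
    (h2 : a ≫ Blowup.toPS (k := k) I t ht hI = a' ≫ Blowup.toPS (k := k) I t ht hI) : a = a' := by
  refine hom_ext_of_opens fun x ↦ ?_
  obtain ⟨i, hi⟩ := exists_mem_basicOpen_X ((a ≫ Blowup.toPS (k := k) I t ht hI) x)
  have hU : ((((a ≫ Blowup.toPS (k := k) I t ht hI) ⁻¹ᵁ
      Proj.basicOpen (stdGrading σ k) (MvPolynomial.X i)).ι ≫ a) ≫
      Blowup.toPS (k := k) I t ht hI) ⁻¹ᵁ
        Proj.basicOpen (stdGrading σ k) (MvPolynomial.X i) = ⊤ := by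
    rw [Category.assoc]
    exact Scheme.Opens.ι_preimage_self _
  refine ⟨(a ≫ Blowup.toPS (k := k) I t ht hI) ⁻¹ᵁ Proj.basicOpen (stdGrading σ k)
    (MvPolynomial.X i), hi, ?_⟩
  generalize (a ≫ Blowup.toPS (k := k) I t ht hI) ⁻¹ᵁ
    Proj.basicOpen (stdGrading σ k) (MvPolynomial.X i) = U at hU
  obtain ⟨f, hf, hf1, hf2⟩ := exists_rees_chart I t ht hI (U.ι ≫ a) hU
  rw [Category.assoc, h2, ← Category.assoc] at hU
  obtain ⟨f', hf', hf1', hf2'⟩ := exists_rees_chart I t ht hI (U.ι ≫ a') hU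
  suffices h : f = f' by rw [h] at hf; exact hf.trans hf'.symm
  -- The chart is generated by `R` and the ratios `t_j / t_i`: the map to the base determines the
  -- images of the former, the map to projective space those of the latter.
  refine rees_away_hom_ext I t ht hI i ?_ ?_
  · apply ringHom_eq_of_toSpecΓ_comp
    rw [← hf1, ← hf1', Category.assoc, h1, Category.assoc]
  · apply ringHom_eq_of_toSpecΓ_comp
    rw [← cancel_mono (Proj.awayι (stdGrading σ k) _ (X_mem_stdGrading i) one_pos),
      Category.assoc, Category.assoc, ← hf2, ← hf2', Category.assoc, h2, Category.assoc]

/-- The equations `s_i t_j = s_j t_i` hold on any blowup, since in the chart `l` each `t_m` is `t_l`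
times the ratio `t_m / t_l`. That they suffice is special to the identity section and is the content
of `E.exists_lift`. -/
theorem Blowup.mul_eq_mul {k σ : Type} [CommRing k] [Algebra k R] (t : σ → R) (ht : ∀ i, t i ∈ I)
    (hI : I ≤ Ideal.span (Set.range t)) {T : Scheme.{0}} {a : T ⟶ Blowup I} {s : σ → Γ(T, ⊤)}
    (hs : Coords (a ≫ Blowup.toPS (k := k) I t ht hI) s) (i j : σ) :
    s i * scalars (a ≫ Blowup.toSpec I) (t j) = s j * scalars (a ≫ Blowup.toSpec I) (t i) := by
  refine eq_of_pull_opens fun x ↦ ?_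
  obtain ⟨l, hl⟩ := exists_mem_basicOpen hs.1 x
  have hU : (((T.basicOpen (s l)).ι ≫ a) ≫
      Blowup.toPS (k := k) I t ht hI) ⁻¹ᵁ
        Proj.basicOpen (stdGrading σ k) (MvPolynomial.X l) = ⊤ := by
    rw [Category.assoc, ← hs.preimage_basicOpen l]
    exact Scheme.Opens.ι_preimage_self _
  refine ⟨_, hl, ?_⟩
  generalize T.basicOpen (s l) = U at hU
  obtain ⟨f, -, hf1, hf2⟩ := exists_rees_chart I t ht hI (U.ι ≫ a) hU
  have h1 := (coords_of_eq_toSpecΓ_comp_awayι hf2).2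
  rw [Category.assoc] at h1
  have h2 := (hs.comp U.ι).mul_eq_mul h1 i j
  have h3 : ∀ m, pull U.ι (scalars (a ≫ Blowup.toSpec I) (t m)) =
      f (HomogeneousLocalization.Away.map (coordsToRees (k := k) I t ht) _ (ratio l m)) *
        f (reesConst I _ (t l)) := by
    intro m
    rw [away_map_ratio, ← map_mul, ← reesConst_eq I _ (by simpa using ht l) _
      (coordsToRees_X I t ht l)]
    have h4 := congrArg (fun z ↦ scalars z (t m)) hf1
    simp only [scalars_toSpecΓ_comp] at h4
    rw [Category.assoc, scalars_comp] at h4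
    exact h4
  rw [map_mul, map_mul, h3, h3, ← mul_assoc, ← mul_assoc]
  exact congrArg (· * _) h2

/-- A homomorphism `θ : R → P` with `I` mapping into the ideal generated by a nonzerodivisor `t`
extends to the Rees algebra, with `T ↦ 1 / t`. -/
lemma exists_rees_hom {P : Type} [CommRing P] (θ : R →+* P) {t : P} (ht : t ∈ nonZeroDivisors P)
    (hI : I.map θ ≤ Ideal.span {t}) :
    ∃ G : reesAlgebra I →+* P, ∀ m x hx, t ^ m * G (reesMonomial I m x hx) = θ x := by
  let L := Localization.Away t
  let ι : P →+* L := algebraMap P L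
  have hinj : Function.Injective ι :=
    IsLocalization.injective L (Submonoid.powers_le.2 ht)
  let v : L := IsLocalization.Away.invSelf t
  have hv : ι t * v = 1 := IsLocalization.Away.mul_invSelf t
  let G0 : Polynomial R →+* L := Polynomial.eval₂RingHom (ι.comp θ) v
  -- For `x ∈ I ^ m` the image `θ x` is divisible by `t ^ m`, so `x T ^ m ↦ θ x / t ^ m` stays in
  -- `P`, which embeds in `P[1/t]` as `t` is not a zero divisor.
  have hmon : ∀ m x, x ∈ I ^ m → ∃ p : P, θ x = t ^ m * p ∧ G0 (Polynomial.monomial m x) = ι p := by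
    intro m x hx
    have h1 : θ x ∈ Ideal.span {t ^ m} := by
      have := Ideal.mem_map_of_mem θ hx
      rw [Ideal.map_pow] at this
      rw [← Ideal.span_singleton_pow]
      exact Ideal.pow_right_mono hI m this
    obtain ⟨p, hp⟩ := Ideal.mem_span_singleton'.1 h1
    refine ⟨p, by rw [← hp, mul_comm], ?_⟩
    rw [Polynomial.coe_eval₂RingHom, Polynomial.eval₂_monomial, RingHom.comp_apply, ← hp, map_mul,
      map_pow, mul_assoc, ← mul_pow, hv, one_pow, mul_one]
  have hrange : ∀ f : reesAlgebra I, G0 f ∈ ι.range := by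
    intro f
    rw [← Polynomial.sum_monomial_eq (f : Polynomial R), Polynomial.sum, map_sum]
    exact sum_mem fun m _ ↦ let ⟨p, _, hp⟩ := hmon m _ (f.2 m); ⟨p, hp.symm⟩
  let e : P ≃+* ι.range := RingEquiv.ofBijective ι.rangeRestrict
    ⟨fun x y h ↦ hinj (congrArg Subtype.val h), ι.rangeRestrict_surjective⟩
  refine ⟨e.symm.toRingHom.comp ((G0.comp (reesAlgebra I).val.toRingHom).codRestrict ι.range
    hrange), fun m x hx ↦ ?_⟩
  obtain ⟨p, h1, h2⟩ := hmon m x hx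
  rw [h1]
  congr 1
  change e.symm _ = p
  rw [RingEquiv.symm_apply_eq]
  exact Subtype.ext h2

end Blowup

/-! ### Points of the blowup of the identity section -/

section ELift

variable {n : ℕ}

/-- The functions `δ_ij` for all `i, j`, with `δ_ii = 0`. -/
def deltaFn (i j : Fin n) : CfRing n := if h : i = j then 0 else delta (pr i j h)

lemma deltaFn_of_ne {i j : Fin n} (h : i ≠ j) : deltaFn i j = delta (pr i j h) := dif_neg h

lemma deltaFn_self (i : Fin n) : deltaFn i i = 0 := dif_pos rfl

lemma deltaFn_cocycle (i j k : Fin n) : algebraMap Base (CfRing n) eps * deltaFn i j * deltaFn j k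
    + deltaFn i k = deltaFn i j + deltaFn j k := by
  by_cases hij : i = j
  · subst hij
    rw [deltaFn_self]
    ring
  by_cases hjk : j = k
  · subst hjk
    rw [deltaFn_self]
    ring
  rw [deltaFn_of_ne hij, deltaFn_of_ne hjk]
  by_cases hik : i = k
  · subst hik
    rw [deltaFn_self]
    linear_combination -delta_add_delta n i j hij
  · rw [deltaFn_of_ne hik]
    exact delta_cocycle n i j k hij hik hjk

/-- Recovers every `δ_ij` as `(δ_bj - δ_bi) / (1 - ε δ_bi)`; the denominator is a unit, so the
`δ_bi` determine a point of `Cf`. -/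
lemma deltaFn_mul (b i j : Fin n) :
    deltaFn i j * (1 - algebraMap Base (CfRing n) eps * deltaFn b i) =
      deltaFn b j - deltaFn b i := by
  linear_combination -deltaFn_cocycle b i j

lemma isUnit_one_sub_deltaFn (i j : Fin n) :
    IsUnit (1 - algebraMap Base (CfRing n) eps * deltaFn i j) := by
  by_cases h : i = j
  · rw [h, deltaFn_self, mul_zero, sub_zero]
    exact isUnit_one
  · rw [deltaFn_of_ne h]
    exact CfRing.isUnit_one_sub _

/-- The parametrization of `𝔾^n / 𝔾`: elements `D_i` with `1 - ε D_i` invertible, with inverse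
`v_i`, may be prescribed freely. -/
lemma eval_deltaEquations {P : Type} [CommRing P] (g : Base →+* P) (D v : Fin n → P)
    (hv : ∀ i, v i * (1 - g eps * D i) = 1) (f : MvPolynomial (Pairs n) Base)
    (hf : f ∈ deltaEquations n) :
    MvPolynomial.eval₂ g (fun c : Pairs n ↦ (D c.1.2 - D c.1.1) * v c.1.1) f = 0 := by
  obtain ⟨i, j, k, hij, hik, hjk, rfl⟩ | ⟨i, j, hij, rfl⟩ := hf
  · simp only [MvPolynomial.eval₂_sub, MvPolynomial.eval₂_add, MvPolynomial.eval₂_mul,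
      MvPolynomial.eval₂_C, MvPolynomial.eval₂_X]
    linear_combination (D k - D j) * v j * hv i - (D k - D j) * v i * hv j
  · simp only [MvPolynomial.eval₂_sub, MvPolynomial.eval₂_add, MvPolynomial.eval₂_mul,
      MvPolynomial.eval₂_C, MvPolynomial.eval₂_X]
    linear_combination (D j - D i) * v j * hv i - (D j - D i) * v i * hv j

variable (hn : 2 ≤ n)

lemma originDelta_eq (i : Coord (Finset.univ : Finset (Fin n)) (univ_nontrivial n hn)) :
    originDelta n hn i = deltaFn (origin n hn) i.1 :=
  (deltaFn_of_ne i.2.2.symm).symm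

/-- A homomorphism factors through a localization in which an element is invertible if its image
is. -/
lemma exists_localization {B A : Type} [CommRing B] [CommRing A] (g₀ : B →+* A) :
    ∃ (P : Type) (_ : CommRing P) (ι : B →+* P) (g : P →+* A), (∀ x, g (ι x) = g₀ x) ∧
      (∀ x, IsUnit (g₀ x) → IsUnit (ι x)) ∧
      ∀ x ∈ nonZeroDivisors B, ι x ∈ nonZeroDivisors P := by
  let M : Submonoid B := (IsUnit.submonoid A).comap g₀
  refine ⟨Localization M, inferInstance, algebraMap B (Localization M),
    IsLocalization.lift (M := M) (g := g₀) fun y ↦ y.2, fun x ↦ IsLocalization.lift_eq _ _,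
    fun x hx ↦ IsLocalization.map_units (Localization M) (⟨x, hx⟩ : M), fun x hx ↦
    IsLocalization.map_nonZeroDivisors_le M (Localization M) ⟨x, hx, rfl⟩⟩

/-- In `A` the element `δ_bj` may be a zero divisor, so the universal property of the blowup does
not apply directly. It is applied to the universal solution `δ_bi = t w_i`, `w_j = 1`, with `t` and
the other `w_i` independent variables, and the result is specialized to `A`. -/
lemma exists_rees_identityIdeal {A : Type} [CommRing A] (κ : CfRing n →+* A)
    (q : Coord (Finset.univ : Finset (Fin n)) (univ_nontrivial n hn) → A)
    (j : Coord (Finset.univ : Finset (Fin n)) (univ_nontrivial n hn)) (hj : q j = 1)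
    (hq : ∀ i, κ (originDelta n hn i) = q i * κ (originDelta n hn j)) :
    ∃ F : reesAlgebra (identityIdeal n) →+* A, (∀ x, F (algebraMap (CfRing n) _ x) = κ x) ∧
      ∀ i hi, F (reesMonomial (identityIdeal n) 1 (originDelta n hn i) hi) = q i := by
  classical
  let J := Coord (Finset.univ : Finset (Fin n)) (univ_nontrivial n hn)
  let P0 := MvPolynomial (Option J) Base
  let g0 : P0 →+* A := MvPolynomial.eval₂Hom (κ.comp (algebraMap Base (CfRing n)))
    (fun o ↦ o.elim (κ (originDelta n hn j)) q)
  -- Inverting all elements that become units in `A` inverts in particular `1 - ε t w_i`, so that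
  -- the parametrization of `Cf` is available, and keeps `t` a nonzerodivisor.
  obtain ⟨P, _, ι, g, hg, hPu, hPt⟩ := exists_localization g0
  let t0 : P0 := MvPolynomial.X none
  let w0 : Fin n → P0 := fun i ↦ if h : i = origin n hn then 0 else if i = j.1 then 1 else
    MvPolynomial.X (some ⟨i, Finset.mem_univ _, h⟩)
  have hw0 : w0 (origin n hn) = 0 := dif_pos rfl
  have hgw : ∀ i : J, g0 (w0 i.1) = q i := by
    intro i
    simp only [w0]
    rw [dif_neg i.2.2]
    by_cases h : i.1 = j.1
    · rw [if_pos h, map_one, ← hj, Subtype.ext h]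
    · rw [if_neg h]
      exact MvPolynomial.eval₂_X _ _ _
  have hgt : g0 t0 = κ (originDelta n hn j) := MvPolynomial.eval₂_X _ _ _
  have hge : ∀ c, g0 (MvPolynomial.C c) = κ (algebraMap Base (CfRing n) c) :=
    fun c ↦ MvPolynomial.eval₂_C _ _ _
  have hgD : ∀ i, g0 (t0 * w0 i) = κ (deltaFn (origin n hn) i) := by
    intro i
    by_cases h : i = origin n hn
    · rw [h, hw0, mul_zero, map_zero, deltaFn_self, map_zero]
    · have h1 := hgw ⟨i, Finset.mem_univ _, h⟩
      have h2 := hq ⟨i, Finset.mem_univ _, h⟩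
      rw [originDelta_eq] at h2
      rw [map_mul, hgt, h1, h2, mul_comm]
  have hunit : ∀ i, ∃ v, v * (1 - ι (MvPolynomial.C eps) * ι (t0 * w0 i)) = 1 := by
    intro i
    have h1 : g0 (1 - MvPolynomial.C eps * (t0 * w0 i)) =
        κ (1 - algebraMap Base (CfRing n) eps * deltaFn (origin n hn) i) := by
      rw [map_sub, map_one, map_mul, hgD, hge, map_sub, map_one, map_mul]
    have h2 : IsUnit (ι (1 - MvPolynomial.C eps * (t0 * w0 i))) := by
      refine hPu _ ?_
      rw [h1]
      exact (isUnit_one_sub_deltaFn _ _).map κ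
    rw [map_sub, map_one, map_mul] at h2
    exact ⟨_, h2.val_inv_mul⟩
  choose v hv using hunit
  obtain ⟨θ, hθ1, hθ2⟩ := CfRing.exists_lift (ι.comp MvPolynomial.C)
    (fun c : Pairs n ↦ (ι (t0 * w0 c.1.2) - ι (t0 * w0 c.1.1)) * v c.1.1)
    (eval_deltaEquations _ (fun i ↦ ι (t0 * w0 i)) v hv)
  have ht : ι t0 ∈ nonZeroDivisors P :=
    hPt t0 (mem_nonZeroDivisors_of_ne_zero (MvPolynomial.X_ne_zero _))
  -- Each `δ_ik` is sent to `t (w_k - w_i)` times a unit.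
  have hI : (identityIdeal n).map θ ≤ Ideal.span {ι t0} := by
    rw [identityIdeal, Ideal.map_span, Ideal.span_le]
    rintro _ ⟨_, ⟨c, rfl⟩, rfl⟩
    rw [SetLike.mem_coe, Ideal.mem_span_singleton', hθ2]
    refine ⟨(ι (w0 c.1.2) - ι (w0 c.1.1)) * v c.1.1, ?_⟩
    rw [map_mul, map_mul]
    ring
  have hgθ : g.comp θ = κ := by
    refine CfRing.hom_ext ?_ fun c ↦ ?_
    · rw [RingHom.comp_assoc, hθ1]
      ext x
      · exact (hg _).trans (hge _)
      · exact (hg _).trans (hge _)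
    · obtain ⟨⟨i, k⟩, hik⟩ := c
      rw [RingHom.comp_apply, hθ2, map_mul, map_sub, hg, hg, hgD, hgD, ← deltaFn_of_ne hik]
      have h1 := congrArg g (hv i)
      have h2 := congrArg κ (deltaFn_mul (origin n hn) i k)
      rw [map_mul, map_sub, map_mul, hg, hg, hgD, hge, map_one] at h1
      rw [map_mul, map_sub, map_mul, map_one, map_sub] at h2
      linear_combination - g (v i) * h2 + κ (deltaFn i k) * h1
  obtain ⟨G, hG⟩ := exists_rees_hom (identityIdeal n) θ ht hI
  refine ⟨g.comp G, fun x ↦ ?_, fun i hi ↦ ?_⟩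
  · have h1 := hG 0 x (by simp)
    rw [pow_zero, one_mul] at h1
    have h2 : algebraMap (CfRing n) (reesAlgebra (identityIdeal n)) x =
        reesMonomial (identityIdeal n) 0 x (by simp) := Subtype.ext rfl
    rw [h2, RingHom.comp_apply, h1, ← RingHom.comp_apply, hgθ]
  · have h1 := hG 1 _ hi
    have h2 : θ (originDelta n hn i) = ι t0 * ι (w0 i.1) := by
      rw [originDelta, hθ2]
      have h3 : v (origin n hn) = 1 := by
        have h4 := hv (origin n hn)
        rw [hw0, mul_zero, map_zero] at h4
        linear_combination h4
      simp only [h3, hw0, mul_zero, map_zero, map_mul]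
      ring
    rw [pow_one, h2] at h1
    have h3 : G (reesMonomial (identityIdeal n) 1 (originDelta n hn i) hi) = ι (w0 i.1) :=
      (mul_cancel_left_mem_nonZeroDivisors ht).1 h1
    rw [RingHom.comp_apply, h3, hg, hgw]

lemma reesMonomial_mem_irrelevant {R : Type} [CommRing R] (I : Ideal R) {x : R} (hx : x ∈ I ^ 1) :
    reesMonomial I 1 x hx ∈ (HomogeneousIdeal.irrelevant (reesGrading I)).toIdeal := by
  change _ ∈ HomogeneousIdeal.irrelevant (reesGrading I)
  rw [HomogeneousIdeal.mem_irrelevant_iff, GradedRing.proj_apply,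
    DirectSum.decompose_of_mem_ne (reesGrading I) (reesMonomial_mem I 1 x hx) one_ne_zero]

/-- A morphism to the blowup of the identity section is given by a morphism to the base and a
family of functions proportional to the `δ_bi`. -/
theorem E.exists_lift {T : Scheme.{0}} (κ : T ⟶ Spec (.of (CfRing n)))
    (q : Coord (Finset.univ : Finset (Fin n)) (univ_nontrivial n hn) → Γ(T, ⊤))
    (j : Coord (Finset.univ : Finset (Fin n)) (univ_nontrivial n hn)) (hj : q j = 1)
    (hq : ∀ i, scalars κ (originDelta n hn i) = q i * scalars κ (originDelta n hn j)) :
    ∃ a : T ⟶ E n, a ≫ E.toCf n = κ ∧ Coords (a ≫ E.toPt n hn) q := by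
  obtain ⟨F, hF1, hF2⟩ := exists_rees_identityIdeal hn (scalars κ) q j hj hq
  have hmem : ∀ i, originDelta n hn i ∈ identityIdeal n := fun i ↦ Ideal.subset_span ⟨_, rfl⟩
  have hX : (fun i ↦ F (coordsToRees (k := ℂ) (identityIdeal n) (originDelta n hn) hmem
      (MvPolynomial.X i))) = q := by
    funext i
    exact (congrArg F (coordsToRees_X _ _ _ i)).trans (hF2 i _)
  have hs : Ideal.span (Set.range q) = ⊤ := span_eq_top_of_isUnit j (hj ▸ isUnit_one)
  have hF : (HomogeneousIdeal.irrelevant (reesGrading (identityIdeal n))).toIdeal.map F = ⊤ := by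
    rw [Ideal.eq_top_iff_one, ← hj, ← hF2 j (by simpa using hmem j)]
    exact Ideal.mem_map_of_mem _ (reesMonomial_mem_irrelevant _ _)
  refine ⟨Proj.fromOfGlobalSections (reesGrading (identityIdeal n)) F hF, ?_, ?_⟩
  · change Proj.fromOfGlobalSections (reesGrading (identityIdeal n)) F hF ≫
      (Proj.toSpecZero (reesGrading (identityIdeal n)) ≫ _) = _
    rw [Proj.fromOfGlobalSections_toSpecZero_assoc, ← Spec.map_comp, ← CommRingCat.ofHom_comp,
      eq_toSpecΓ_comp_scalars κ]
    congr 3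
    exact RingHom.ext hF1
  · have h1 := fromOfGlobalSections_comp_map (coordsToRees (k := ℂ) (identityIdeal n)
      (originDelta n hn) hmem) (irrelevant_le_map (identityIdeal n) (originDelta n hn) hmem
        (identityIdeal_le n hn)) F hF
      (κ ≫ Spec.map (CommRingCat.ofHom (algebraMap ℂ (CfRing n)))) (by rw [hX]; exact hs) (by
        intro c
        rw [scalars_comp_specMap]
        refine Eq.trans (congrArg F ?_) (hF1 _)
        change MvPolynomial.eval₂Hom _ _ (MvPolynomial.C c) = _
        rw [MvPolynomial.coe_eval₂Hom, MvPolynomial.eval₂_C]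
        rfl)
    have h2 := coords_ofCoords (κ ≫ Spec.map (CommRingCat.ofHom (algebraMap ℂ (CfRing n))))
      _ hs
    rw [← ofCoords_congr rfl hX (by rw [hX]; exact hs) hs, ← h1] at h2
    exact h2

end ELift

/-! ### The system of ratios given by the `μ_ijk` over a local ring -/

section MuSystem

/-- Take `j` with the largest cluster around `b`. A point `i` outside it would be farther than `j`,
and its cluster would contain that of `j` and also `i`. -/
lemma RatioSystem.exists_farthest {ι A : Type} [CommRing A] (R : RatioSystem ι A) {S : Finset ι}
    (hS : S.Nonempty) {b : ι} (hb : b ∉ S) : ∃ j ∈ S, ∀ i ∈ S, R.F b j i := by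
  obtain ⟨j, hj, hmax⟩ := S.exists_max_image (fun j ↦ (R.cluster S b j).card) hS
  refine ⟨j, hj, fun i hi ↦ ?_⟩
  have hbj : b ≠ j := fun h ↦ hb (h ▸ hj)
  have hbi : b ≠ i := fun h ↦ hb (h ▸ hi)
  by_contra hcon
  have h1 : R.F b i j := (R.total hbj hbi).resolve_left hcon
  exact absurd (hmax i hi) (not_le.2 (RatioSystem.card_cluster_lt hi (R.F_right b i) hcon
    fun l hl ↦ (R.trans hbi hbj h1 hl).1))

variable {n : ℕ} {A : Type} [CommRing A]

/-- Homogeneous coordinates of the `μ_ijk` for all `i, j, k`, where `μ_iji = 0` and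
`μ_ijj = 1`. -/
def muExt (m : Triples n × Fin 2 → A) (i j k : Fin n) (a : Fin 2) : A :=
  if k = i ∧ a = 0 then 0 else
    if h : i ≠ j ∧ i ≠ k ∧ j ≠ k then m (⟨(i, j, k), h⟩, a) else 1

lemma muExt_left_zero (m : Triples n × Fin 2 → A) (i j : Fin n) : muExt m i j i 0 = 0 := by
  simp [muExt]

lemma muExt_left_one (m : Triples n × Fin 2 → A) (i j : Fin n) : muExt m i j i 1 = 1 := by
  simp [muExt]

lemma muExt_right (m : Triples n × Fin 2 → A) {i j : Fin n} (h : i ≠ j) (a : Fin 2) :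
    muExt m i j j a = 1 := by
  simp [muExt, h.symm]

lemma muExt_right_one (m : Triples n × Fin 2 → A) (i j : Fin n) : muExt m i j j 1 = 1 := by
  simp [muExt]

lemma muExt_of_ne (m : Triples n × Fin 2 → A) {i j k : Fin n} (hij : i ≠ j) (hik : i ≠ k)
    (hjk : j ≠ k) (a : Fin 2) : muExt m i j k a = m (tr i j k hij hik hjk, a) := by
  simp [muExt, hik.symm, hij, hik, hjk]

lemma map_muExt {B : Type} [CommRing B] (f : A →+* B) (m : Triples n × Fin 2 → A) (i j k : Fin n)
    (a : Fin 2) : f (muExt m i j k a) = muExt (fun p ↦ f (m p)) i j k a := by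
  unfold muExt
  split_ifs <;> simp

/-- A property of pairs of homogeneous coordinates holds for all `μ_ijk` if it does so for distinct
indices and for `0 = [0 : 1]` and `1 = [1 : 1]`. -/
lemma muExt_induction {p : (Fin 2 → A) → Prop} {m : Triples n × Fin 2 → A}
    (h0 : ∀ x : Fin 2 → A, x 1 = 1 → p x) (h : ∀ c, p fun a ↦ m (c, a)) (i j k : Fin n) :
    p (muExt m i j k) := by
  by_cases hki : k = i
  · subst hki
    exact h0 _ (muExt_left_one m _ _)
  by_cases h3 : i ≠ j ∧ i ≠ k ∧ j ≠ k
  · convert! h ⟨(i, j, k), h3⟩ using 1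
    funext a
    simp [muExt, hki, h3]
  · exact h0 _ (by simp [muExt, h3])

/-- The equations `μ_ijk μ_ikj = 1`, `μ_ijk + μ_jik = 1` and `μ_ijk μ_ikl = μ_ijl`. -/
structure MuRel (m : Triples n × Fin 2 → A) : Prop where
  inv : ∀ {i j k}, i ≠ j → i ≠ k →
    muExt m i j k 0 * muExt m i k j 0 = muExt m i j k 1 * muExt m i k j 1
  swap : ∀ {i j} k, i ≠ j →
    muExt m i j k 0 * muExt m j i k 1 + muExt m j i k 0 * muExt m i j k 1 =
      muExt m i j k 1 * muExt m j i k 1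
  trans : ∀ {i j k} l, i ≠ j → i ≠ k →
    muExt m i j k 0 * muExt m i k l 0 * muExt m i j l 1 =
      muExt m i j l 0 * muExt m i j k 1 * muExt m i k l 1

lemma MuRel.map {B : Type} [CommRing B] {m : Triples n × Fin 2 → A} (h : MuRel m) (f : A →+* B) :
    MuRel fun p ↦ f (m p) where
  inv hij hik := by
    simp only [← map_muExt, ← map_mul, h.inv hij hik]
  swap k hij := by
    simp only [← map_muExt, ← map_mul, ← map_add, h.swap k hij]
  trans l hij hik := by
    simp only [← map_muExt, ← map_mul, h.trans l hij hik]

/-- With the conventions `μ_iji = 0` and `μ_ijj = 1`, the equations for coinciding indices add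
nothing: they are trivial, except that `μ_ijk μ_ikl = μ_ijl` with `j = l` is the equation `μ_ijk
μ_ikj = 1`. -/
lemma muRel_iff (g : Base →+* A) (m : Triples n × Fin 2 → A) :
    MuRel m ↔ ∀ f ∈ muEquations n, MvPolynomial.eval₂ g m f = 0 := by
  constructor
  · rintro h f ((⟨i, j, k, hij, hik, hjk, rfl⟩ | ⟨i, j, k, hij, hik, hjk, rfl⟩) |
      ⟨i, j, k, l, hij, hik, hil, hjk, hjl, hkl, rfl⟩)
    · simp only [MvPolynomial.eval₂_sub, MvPolynomial.eval₂_mul, MvPolynomial.eval₂_X,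
        ← muExt_of_ne m]
      linear_combination h.inv hij hik
    · simp only [MvPolynomial.eval₂_sub, MvPolynomial.eval₂_add, MvPolynomial.eval₂_mul,
        MvPolynomial.eval₂_X, ← muExt_of_ne m]
      linear_combination h.swap k hij
    · simp only [MvPolynomial.eval₂_sub, MvPolynomial.eval₂_mul, MvPolynomial.eval₂_X,
        ← muExt_of_ne m]
      linear_combination h.trans l hij hik
  · intro h
    have h1 : ∀ {i j k}, i ≠ j → i ≠ k →
        muExt m i j k 0 * muExt m i k j 0 = muExt m i j k 1 * muExt m i k j 1 := by
      intro i j k hij hik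
      by_cases hjk : j = k
      · subst hjk
        simp only [muExt_right m hij]
      have := h _ (Or.inl (Or.inl ⟨i, j, k, hij, hik, hjk, rfl⟩))
      simp only [MvPolynomial.eval₂_sub, MvPolynomial.eval₂_mul, MvPolynomial.eval₂_X,
        ← muExt_of_ne m] at this
      linear_combination this
    refine ⟨h1, fun {i j} k hij ↦ ?_, fun {i j k} l hij hik ↦ ?_⟩
    · by_cases hik : i = k
      · subst hik
        simp only [muExt_left_zero, muExt_left_one, muExt_right m hij.symm]
        ring
      by_cases hjk : j = k
      · subst hjk
        simp only [muExt_left_zero, muExt_left_one, muExt_right m hij]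
        ring
      have := h _ (Or.inl (Or.inr ⟨i, j, k, hij, hik, hjk, rfl⟩))
      simp only [MvPolynomial.eval₂_sub, MvPolynomial.eval₂_add, MvPolynomial.eval₂_mul,
        MvPolynomial.eval₂_X, ← muExt_of_ne m] at this
      linear_combination this
    · by_cases hil : i = l
      · subst hil
        simp only [muExt_left_zero]
        ring
      by_cases hkl : k = l
      · subst hkl
        simp only [muExt_right m hik]
        ring
      by_cases hjl : j = l
      · subst hjl
        simp only [muExt_right m hij]
        linear_combination h1 hij hik
      by_cases hjk : j = k
      · subst hjk
        simp only [muExt_right m hij]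
        ring
      have := h _ (Or.inr ⟨i, j, k, l, hij, hik, hil, hjk, hjl, hkl, rfl⟩)
      simp only [MvPolynomial.eval₂_sub, MvPolynomial.eval₂_mul, MvPolynomial.eval₂_X,
        ← muExt_of_ne m] at this
      linear_combination this

variable [IsLocalRing A]

open Classical in
/-- The ratios `μ_ijk = (u_i - u_k) / (u_i - u_j)` over a local ring. -/
def muSystem {m : Triples n × Fin 2 → A} (h : MuRel m)
    (hu : ∀ i j k, IsUnit (muExt m i j k 0) ∨ IsUnit (muExt m i j k 1)) :
    RatioSystem (Fin n) A where
  F i j k := IsUnit (muExt m i j k 1)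
  r i j k := muExt m i j k 0 * Ring.inverse (muExt m i j k 1)
  F_right i j := by rw [muExt_right_one]; exact isUnit_one
  r_right hij := by simp [muExt_right m hij]
  F_left i j := by rw [muExt_left_one]; exact isUnit_one
  r_left hij := by rw [muExt_left_zero, zero_mul]
  -- If both denominators were nonunits, both numerators would be units; but the two products are
  -- equal by `μ_ijk μ_ikj = 1`.
  total {i j k} hij hik := by
    by_contra! hcon
    have h1 := ((hu i j k).resolve_right hcon.1).mul ((hu i k j).resolve_right hcon.2)
    rw [h.inv hij hik] at h1
    exact hcon.1 (isUnit_of_mul_isUnit_left h1)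
  swap {i j k} hij hF := by
    have h1 := h.swap k hij
    have h2 : IsUnit (muExt m j i k 1) := by
      refine (hu j i k).elim (fun h3 ↦ ?_) id
      refine isUnit_of_mul_isUnit_left (y := muExt m i j k 1 - muExt m i j k 0) ?_
      rw [show muExt m j i k 1 * (muExt m i j k 1 - muExt m i j k 0) =
        muExt m j i k 0 * muExt m i j k 1 by linear_combination -h1]
      exact h3.mul hF
    refine ⟨h2, (hF.mul h2).mul_right_cancel ?_⟩
    linear_combination muExt m j i k 0 * muExt m i j k 1 * Ring.inverse_mul_cancel _ h2 + h1 +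
      muExt m i j k 0 * muExt m j i k 1 * Ring.inverse_mul_cancel _ hF
  trans {i j k l} hij hik hF hF' := by
    have h1 := h.trans l hij hik
    have h2 : IsUnit (muExt m i j l 1) := by
      refine (hu i j l).elim (fun h3 ↦ ?_) id
      refine isUnit_of_mul_isUnit_right (x := muExt m i j k 0 * muExt m i k l 0) ?_
      rw [h1]
      exact (h3.mul hF).mul hF'
    refine ⟨h2, ((hF.mul h2).mul hF').mul_right_cancel ?_⟩
    linear_combination muExt m i j l 0 * muExt m i j k 1 * muExt m i k l 1 *
      Ring.inverse_mul_cancel _ h2 - h1 - muExt m i j k 0 * muExt m i k l 0 * muExt m i j l 1 *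
      (Ring.inverse (muExt m i k l 1) * muExt m i k l 1 * Ring.inverse_mul_cancel _ hF +
        Ring.inverse_mul_cancel _ hF')
  inv {i j k} hij hik hF hr := by
    have h1 := h.inv hij hik
    refine (hu i k j).elim (fun h2 ↦ ?_) id
    refine isUnit_of_mul_isUnit_right (x := muExt m i j k 1) ?_
    rw [← h1]
    exact (isUnit_of_mul_isUnit_left hr).mul h2

end MuSystem

/-! ### Cancellation of families generating the unit ideal -/

section Unimodular

lemma eq_of_span_eq_top {ι A : Type*} [CommRing A] {x : ι → A} {y z : A}
    (hx : Ideal.span (Set.range x) = ⊤) (h : ∀ a, x a * y = x a * z) : y = z := by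
  have h1 : Ideal.span (Set.range x) ≤ LinearMap.ker (LinearMap.mulRight A (y - z)) := by
    rw [Ideal.span_le]
    rintro _ ⟨a, rfl⟩
    change x a * (y - z) = 0
    rw [mul_sub, h, sub_self]
  rw [hx] at h1
  have h2 : (1 : A) * (y - z) = 0 := h1 (Submodule.mem_top (x := (1 : A)))
  linear_combination h2

lemma exists_isUnit_of_span_eq_top {ι A : Type*} [CommRing A] [IsLocalRing A] {x : ι → A}
    (hx : Ideal.span (Set.range x) = ⊤) : ∃ a, IsUnit (x a) := by
  by_contra! hcon
  have h1 : Ideal.span (Set.range x) ≤ IsLocalRing.maximalIdeal A := by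
    rw [Ideal.span_le]
    rintro _ ⟨a, rfl⟩
    exact hcon a
  exact (IsLocalRing.maximalIdeal.isMaximal A).ne_top (top_le_iff.1 (hx ▸ h1))

lemma isUnit_or_of_span_eq_top {A : Type*} [CommRing A] [IsLocalRing A] {x : Fin 2 → A}
    (hx : Ideal.span (Set.range x) = ⊤) : IsUnit (x 0) ∨ IsUnit (x 1) := by
  obtain ⟨a, ha⟩ := exists_isUnit_of_span_eq_top hx
  fin_cases a
  · exact Or.inl ha
  · exact Or.inr ha

lemma eq_of_span_pair_eq_top {A : Type*} [CommRing A] {x : Fin 2 → A} {y z : A}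
    (hx : Ideal.span (Set.range x) = ⊤) (h0 : x 0 * y = x 0 * z) (h1 : x 1 * y = x 1 * z) :
    y = z := by
  refine eq_of_span_eq_top hx fun a ↦ ?_
  fin_cases a
  · exact h0
  · exact h1

end Unimodular

/-! ### The forgetful morphism from `Qcirc` to `Cf` and the relation between `μ` and `δ` -/

section Qc

variable {n : ℕ}

lemma forgetMu_hom : forgetMu n ≫ (lines Base (Pairs n)).hom = (lines Base (Indices n)).hom :=
  Over.w (Pi.lift fun c : Pairs n ↦ Pi.π (fun _ : Indices n ↦ PS.over (Fin 2) Base) (.inl c) :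
    lines Base (Indices n) ⟶ lines Base (Pairs n))

lemma forgetMu_proj (c : Pairs n) : forgetMu n ≫ lines.proj c = lines.proj (k := Base) (.inl c) := by
  have h : (Pi.lift fun c : Pairs n ↦ Pi.π (fun _ : Indices n ↦ PS.over (Fin 2) Base) (.inl c) :
    lines Base (Indices n) ⟶ lines Base (Pairs n)) ≫ Pi.π (fun _ ↦ PS.over (Fin 2) Base) c =
      Pi.π (fun _ : Indices n ↦ PS.over (Fin 2) Base) (.inl c) := Pi.lift_π _ _
  exact congrArg CommaMorphism.left h

lemma LCoords.forgetMu {T : Scheme.{0}} {h : T ⟶ (lines Base (Indices n)).left}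
    {s : Indices n × Fin 2 → Γ(T, ⊤)} (H : LCoords h s) :
    LCoords (h ≫ forgetMu n) fun p ↦ s (.inl p.1, p.2) := fun c ↦ by
  have := H (.inl c)
  rw [← forgetMu_proj, ← Category.assoc] at this
  exact this

/-- The homogeneous coordinates of the `μ_ijk`. -/
abbrev muPart {A : Type} (s : Indices n × Fin 2 → A) (p : Triples n × Fin 2) : A :=
  s (.inr p.1, p.2)

lemma LCoords.span_muExt {T : Scheme.{0}} {h : T ⟶ (lines Base (Indices n)).left}
    {s : Indices n × Fin 2 → Γ(T, ⊤)} (H : LCoords h s) (i j k : Fin n) :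
    Ideal.span (Set.range (muExt (muPart s) i j k)) = ⊤ :=
  muExt_induction (p := fun x ↦ Ideal.span (Set.range x) = ⊤)
    (fun _ hx ↦ (Ideal.eq_top_iff_one _).2 (Ideal.subset_span ⟨1, hx⟩))
    (fun c ↦ (H (.inr c)).1) i j k

lemma LCoords.muExt_mul {T : Scheme.{0}} {h : T ⟶ (lines Base (Indices n)).left}
    {s s' : Indices n × Fin 2 → Γ(T, ⊤)} (H : LCoords h s) (H' : LCoords h s') (i j k : Fin n) :
    muExt (muPart s) i j k 0 * muExt (muPart s') i j k 1 =
      muExt (muPart s) i j k 1 * muExt (muPart s') i j k 0 := by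
  by_cases hki : k = i
  · subst hki
    simp only [muExt_left_zero, muExt_left_one]
    ring
  by_cases h3 : i ≠ j ∧ i ≠ k ∧ j ≠ k
  · rw [muExt_of_ne _ h3.1 h3.2.1 h3.2.2, muExt_of_ne _ h3.1 h3.2.1 h3.2.2,
      muExt_of_ne _ h3.1 h3.2.1 h3.2.2, muExt_of_ne _ h3.1 h3.2.1 h3.2.2]
    exact (H (.inr _)).mul_eq_mul (H' (.inr _)) 0 1
  · simp [muExt, hki, h3]

variable (n) in
/-- The immersion of the open locus of `𝒬_n` into `(ℙ¹)^{p([n])} × (ℙ¹)^{t([n])} × 𝔸¹`. -/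
def Qcirc.toLines : (Qcirc n).toScheme ⟶ (lines Base (Indices n)).left := (Qcirc n).ι ≫ Q.ι n

instance : Mono (Q.ι n) := inferInstanceAs (Mono (vanishingSheaf (mwEquations n)).subschemeι)

instance : Mono (Qcirc.toLines n) := mono_comp _ _

lemma Qcirc.eval_eq_zero {T : Scheme.{0}} (t : T ⟶ (Qcirc n).toScheme)
    {s : Indices n × Fin 2 → Γ(T, ⊤)} (H : LCoords (t ≫ Qcirc.toLines n) s)
    {f : MvPolynomial (Indices n × Fin 2) Base} (hf : f ∈ mwEquations n) :
    MvPolynomial.eval₂ (scalars ((t ≫ Qcirc.toLines n) ≫ (lines Base (Indices n)).hom)) s f = 0 :=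
  evalSections_eq_zero_of_lift (fun _ ↦ isMultihomogeneous_of_mem_mwEquations)
    (t ≫ (Qcirc n).ι) (s := s) H hf

lemma Qcirc.muRel {T : Scheme.{0}} (t : T ⟶ (Qcirc n).toScheme)
    {s : Indices n × Fin 2 → Γ(T, ⊤)} (H : LCoords (t ≫ Qcirc.toLines n) s) :
    MuRel (muPart s) := by
  refine (muRel_iff (scalars ((t ≫ Qcirc.toLines n) ≫ (lines Base (Indices n)).hom)) _).2
    fun f hf ↦ ?_
  have := Qcirc.eval_eq_zero t H (Or.inl (Or.inr ⟨f, hf, rfl⟩))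
  rw [MvPolynomial.eval₂_rename] at this
  exact this

lemma Qcirc.exists_toCf :
    ∃ κ : (Qcirc n).toScheme ⟶ Spec (.of (CfRing n)),
      κ ≫ CfRing.toLines n = Qcirc.toLines n ≫ forgetMu n := by
  refine exists_toCfRing _ (fun x ↦ ?_) fun s hs f hf ↦ ?_
  · exact x.2
  · refine eq_of_pull_opens fun x ↦ ?_
    obtain ⟨U, hx, s', hs', -⟩ := exists_local_lcoords (Qcirc.toLines n) x
    refine ⟨U, hx, ?_⟩
    have h1 := Qcirc.eval_eq_zero U.ι hs' (Or.inl (Or.inl ⟨f, hf, rfl⟩))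
    rw [MvPolynomial.eval₂_rename, Category.assoc, ← forgetMu_hom] at h1
    have h2 := hs'.forgetMu
    rw [Category.assoc] at h2
    obtain ⟨w, hw⟩ := h2.exists_unit (hs.comp U.ι) (isMultihomogeneous_of_mem_nuEquations hf)
      (U.ι ≫ (Qcirc.toLines n ≫ forgetMu n) ≫ (lines Base (Pairs n)).hom)
    rw [pull_evalSections, map_zero]
    refine hw.trans ?_
    have h3 : evalSections (U.ι ≫ (Qcirc.toLines n ≫ forgetMu n) ≫ (lines Base (Pairs n)).hom)
        (fun p ↦ s' (.inl p.1, p.2)) f = 0 := by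
      rw [Category.assoc]
      exact h1
    rw [h3, mul_zero]

variable (n) in
/-- The projection of the open locus of `𝒬_n` to `Cf_n`. -/
def Qcirc.toCf : (Qcirc n).toScheme ⟶ Spec (.of (CfRing n)) := Qcirc.exists_toCf.choose

lemma Qcirc.toCf_toLines : Qcirc.toCf n ≫ CfRing.toLines n = Qcirc.toLines n ≫ forgetMu n :=
  Qcirc.exists_toCf.choose_spec

/-- The equation `μ_ijk ν_ik = ν_ij` rewritten as `μ_ijk δ_ij = δ_ik`. -/
lemma Qcirc.muExt_mul_delta {T : Scheme.{0}} (t : T ⟶ (Qcirc n).toScheme)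
    {s : Indices n × Fin 2 → Γ(T, ⊤)} (H : LCoords (t ≫ Qcirc.toLines n) s) {i j : Fin n}
    (k : Fin n) (hij : i ≠ j) :
    muExt (muPart s) i j k 0 * scalars (t ≫ Qcirc.toCf n) (deltaFn i j) =
      muExt (muPart s) i j k 1 * scalars (t ≫ Qcirc.toCf n) (deltaFn i k) := by
  by_cases hik : i = k
  · subst hik
    rw [muExt_left_zero, deltaFn_self, map_zero, mul_zero, zero_mul]
  by_cases hjk : j = k
  · subst hjk
    rw [muExt_right _ hij, muExt_right _ hij]
  have h1 := H.forgetMu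
  rw [Category.assoc, ← Qcirc.toCf_toLines, ← Category.assoc] at h1
  have h2 := CfRing.coords (t ≫ Qcirc.toCf n)
  have h3 : ∀ c : Pairs n, s (.inl c, 1) = s (.inl c, 0) * scalars (t ≫ Qcirc.toCf n) (delta c) := by
    intro c
    have := (h1 c).mul_eq_mul (h2 c) 0 1
    simp only [if_true, one_ne_zero, if_false] at this
    rw [this, mul_one]
  -- The second coordinate is `δ` times the first, and together they generate the unit ideal.
  have h4 : ∀ c : Pairs n, IsUnit (s (.inl c, 0)) := by
    intro c
    have h5 : Ideal.span (Set.range fun a ↦ s (.inl c, a)) ≤ Ideal.span {s (.inl c, 0)} := by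
      rw [Ideal.span_le]
      rintro _ ⟨a, rfl⟩
      fin_cases a
      · exact Ideal.mem_span_singleton_self _
      · exact Ideal.mem_span_singleton'.2 ⟨_, (mul_comm _ _).trans (h3 c).symm⟩
    rw [(h1 c).1, top_le_iff, Ideal.span_singleton_eq_top] at h5
    exact h5
  have h6 := Qcirc.eval_eq_zero t H (Or.inr ⟨i, j, k, hij, hik, hjk, rfl⟩)
  simp only [MvPolynomial.eval₂_sub, MvPolynomial.eval₂_mul, MvPolynomial.eval₂_X] at h6
  rw [muExt_of_ne _ hij hik hjk, muExt_of_ne _ hij hik hjk, deltaFn_of_ne hij, deltaFn_of_ne hik]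
  refine ((h4 (pr i j hij)).mul (h4 (pr i k hik))).mul_left_cancel ?_
  rw [h3, h3] at h6
  linear_combination h6

end Qc

/-! ### The morphisms from `Qcirc` to the spaces `ℙ(ℂ^B / ℂ)` -/

section ToPB

variable {n : ℕ}

lemma MuRel.ratio_mul {A : Type} [CommRing A] {m : Triples n × Fin 2 → A} (h : MuRel m)
    {b j k : Fin n} (i : Fin n) (hbj : b ≠ j) (hbk : b ≠ k) (hi : IsUnit (muExt m b j i 1))
    (hk : IsUnit (muExt m b j k 1)) :
    muExt m b j i 0 * Ring.inverse (muExt m b j i 1) * muExt m b k i 1 =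
      muExt m b k i 0 * (muExt m b j k 0 * Ring.inverse (muExt m b j k 1)) := by
  refine (hi.mul hk).mul_left_cancel ?_
  linear_combination muExt m b j i 0 * muExt m b k i 1 * muExt m b j k 1 *
    Ring.mul_inverse_cancel _ hi - muExt m b k i 0 * muExt m b j k 0 * muExt m b j i 1 *
    Ring.mul_inverse_cancel _ hk - h.trans i hbj hbk

/-- The functions `s_i` satisfy the equations `s_i = μ_bji s_j` of the differences `u_b - u_i`. -/
def PBRel (B : Finset (Fin n)) (hB : B.Nontrivial) {T : Scheme.{0}} (t : T ⟶ (Qcirc n).toScheme)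
    (s : Coord B hB → Γ(T, ⊤)) : Prop :=
  ∀ {T' : Scheme.{0}} (u : T' ⟶ T) (m : Indices n × Fin 2 → Γ(T', ⊤)),
    LCoords (u ≫ t ≫ Qcirc.toLines n) m → ∀ i j : Coord B hB,
      pull u (s i) * muExt (muPart m) (base B hB) j.1 i.1 1 =
        muExt (muPart m) (base B hB) j.1 i.1 0 * pull u (s j)

/-- If all `μ_bji` are finite, they are the differences `u_b - u_i` normalized by `u_b - u_j`, and
multiplicativity of the ratios gives the relations for every other pair. The relations are tested
against arbitrary coordinates `m'`, so `m` is exchanged for `m'` by cancelling the unimodular pair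
of its coordinates. -/
lemma pbRel_ratio {B : Finset (Fin n)} {hB : B.Nontrivial} {T : Scheme.{0}}
    (t : T ⟶ (Qcirc n).toScheme) {m : Indices n × Fin 2 → Γ(T, ⊤)}
    (H : LCoords (t ≫ Qcirc.toLines n) m) (j : Coord B hB)
    (hj : ∀ i : Coord B hB, IsUnit (muExt (muPart m) (base B hB) j.1 i.1 1)) :
    PBRel B hB t fun i ↦ muExt (muPart m) (base B hB) j.1 i.1 0 *
      Ring.inverse (muExt (muPart m) (base B hB) j.1 i.1 1) := by
  intro T' u m' H' i k
  have h1 := congrArg (pull u) ((Qcirc.muRel t H).ratio_mul i.1 j.2.2.symm k.2.2.symm (hj i) (hj k))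
  have H1 := H.comp u
  have h2 := H1.muExt_mul H' (base B hB) k.1 i.1
  simp only [map_mul, map_muExt (pull u)] at h1 ⊢
  change muExt (fun p ↦ pull u (muPart m p)) _ _ _ 0 * _ =
      muExt (fun p ↦ pull u (muPart m p)) _ _ _ 1 * _ at h2
  refine eq_of_span_pair_eq_top (H1.span_muExt (base B hB) k.1 i.1) ?_ ?_
  · change muExt (fun p ↦ pull u (muPart m p)) _ _ _ 0 * _ =
      muExt (fun p ↦ pull u (muPart m p)) _ _ _ 0 * _
    linear_combination muExt (fun p ↦ pull u (muPart m p)) (base B hB) j.1 i.1 0 *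
      pull u (Ring.inverse (muExt (muPart m) (base B hB) j.1 i.1 1)) * h2 +
      muExt (muPart m') (base B hB) k.1 i.1 0 * h1
  · change muExt (fun p ↦ pull u (muPart m p)) _ _ _ 1 * _ =
      muExt (fun p ↦ pull u (muPart m p)) _ _ _ 1 * _
    linear_combination muExt (fun p ↦ pull u (muPart m p)) (base B hB) j.1 k.1 0 *
      pull u (Ring.inverse (muExt (muPart m) (base B hB) j.1 k.1 1)) * h2 +
      muExt (muPart m') (base B hB) k.1 i.1 1 * h1

lemma PBRel.mul_eq_mul {B : Finset (Fin n)} {hB : B.Nontrivial} {T : Scheme.{0}}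
    {t : T ⟶ (Qcirc n).toScheme} {s s' : Coord B hB → Γ(T, ⊤)} (h : PBRel B hB t s)
    (h' : PBRel B hB t s') (i j : Coord B hB) : s i * s' j = s j * s' i := by
  refine eq_of_pull_opens fun x ↦ ?_
  obtain ⟨U, hx, m, hm, -⟩ := exists_local_lcoords (t ≫ Qcirc.toLines n) x
  refine ⟨U, hx, ?_⟩
  have h1 := h U.ι m hm i j
  have h2 := h' U.ι m hm i j
  rw [map_mul, map_mul]
  refine eq_of_span_pair_eq_top (hm.span_muExt (base B hB) j.1 i.1) ?_ ?_
  · linear_combination pull U.ι (s' i) * h1 - pull U.ι (s i) * h2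
  · linear_combination pull U.ι (s' j) * h1 - pull U.ι (s j) * h2

/-- The coordinates of the indices of a set `B` different from its base point. -/
lemma coord_finset (B : Finset (Fin n)) (hB : B.Nontrivial) :
    (B.erase (base B hB)).Nonempty ∧ base B hB ∉ B.erase (base B hB) := by
  refine ⟨?_, Finset.notMem_erase _ _⟩
  obtain ⟨i, hi, hne⟩ := hB.exists_ne (base B hB)
  exact ⟨i, Finset.mem_erase.2 ⟨hne, hi⟩⟩

lemma exists_farthest_coord {A : Type} [CommRing A] (R : RatioSystem (Fin n) A)
    (B : Finset (Fin n)) (hB : B.Nontrivial) :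
    ∃ j : Coord B hB, ∀ i : Coord B hB, R.F (base B hB) j.1 i.1 := by
  obtain ⟨j, hj, h⟩ := R.exists_farthest (coord_finset B hB).1 (coord_finset B hB).2
  obtain ⟨h1, h2⟩ := Finset.mem_erase.1 hj
  exact ⟨⟨j, h2, h1⟩, fun i ↦ h i.1 (Finset.mem_erase.2 ⟨i.2.2, i.2.1⟩)⟩

variable (n) in
/-- The structure morphism over `ℂ`. -/
def Qcirc.str : (Qcirc n).toScheme ⟶ Spec (.of ℂ) :=
  Qcirc.toCf n ≫ Spec.map (CommRingCat.ofHom (algebraMap ℂ (CfRing n)))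

lemma exists_nhds_isUnit {X : Scheme.{0}} {U : X.Opens} {x : X} (hx : x ∈ U) {ι : Type} [Finite ι]
    (a : ι → Γ(U, ⊤)) (h : ∀ i, (⟨x, hx⟩ : U) ∈ U.toScheme.basicOpen (a i)) :
    ∃ (W : X.Opens) (hW : W ≤ U), x ∈ W ∧ ∀ i, IsUnit (pull (X.homOfLE hW) (a i)) := by
  let V : U.toScheme.Opens := ⨅ i, U.toScheme.basicOpen (a i)
  have hV : (⟨x, hx⟩ : U) ∈ V := by
    change (⟨x, hx⟩ : U) ∈ ((⨅ i, U.toScheme.basicOpen (a i) : U.toScheme.Opens) : Set U)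
    rw [TopologicalSpace.Opens.coe_iInf]
    exact Set.mem_iInter.2 h
  have hW : U.ι ''ᵁ V ≤ U := by
    rintro _ ⟨v, _, rfl⟩
    exact v.2
  refine ⟨U.ι ''ᵁ V, hW, ⟨_, hV, rfl⟩, fun i ↦ isUnit_of_forall_mem_basicOpen fun w ↦ ?_⟩
  rw [mem_basicOpen_pull]
  obtain ⟨v, hv, hvw⟩ := w.2
  have h1 : (X.homOfLE hW) w = v := by
    apply U.ι.isOpenEmbedding.injective
    refine Eq.trans ?_ hvw.symm
    rw [← Scheme.Hom.comp_apply, Scheme.homOfLE_ι]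
    rfl
  rw [h1]
  exact (iInf_le (fun i ↦ U.toScheme.basicOpen (a i)) i) hv

/-- At a given point choose `j ∈ B` farthest from the base point `b`. Then every `μ_bji` is finite
at the point, hence on a neighbourhood, and the `μ_bji` serve as homogeneous coordinates there;
these local morphisms are glued. -/
lemma Qcirc.exists_toPB (B : Finset (Fin n)) (hB : B.Nontrivial) :
    ∃ φ : (Qcirc n).toScheme ⟶ PB B hB, φ ≫ PS.str _ ℂ = Qcirc.str n ∧
      ∀ {T : Scheme.{0}} (t : T ⟶ (Qcirc n).toScheme) (s : Coord B hB → Γ(T, ⊤)),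
        Ideal.span (Set.range s) = ⊤ → PBRel B hB t s → Coords (t ≫ φ) s := by
  refine exists_of_coords (Qcirc.str n) (fun t s ↦ PBRel B hB t s) ?_ ?_ ?_
  · intro T'' T' u t s h T u' m hm i j
    rw [Category.assoc, ← Category.assoc] at hm
    have := h (u' ≫ u) m hm i j
    rw [pull_comp, pull_comp] at this
    exact this
  · intro T t s s' h h' _ _ i j
    exact h.mul_eq_mul h' i j
  · intro x
    obtain ⟨U, hx, m, hm, -⟩ := exists_local_lcoords (Qcirc.toLines n) x
    let y : U.toScheme := ⟨x, hx⟩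
    let γ : Γ(U, ⊤) →+* U.toScheme.presheaf.stalk y := (U.toScheme.presheaf.germ ⊤ y trivial).hom
    obtain ⟨j, hj⟩ := exists_farthest_coord (muSystem ((Qcirc.muRel U.ι hm).map γ) (by
      intro i j k
      rw [← map_muExt, ← map_muExt]
      refine isUnit_or_of_span_eq_top (x := fun a ↦ γ (muExt (muPart m) i j k a)) ?_
      have := congrArg (Ideal.map γ) (hm.span_muExt i j k)
      rw [Ideal.map_span, Ideal.map_top, ← Set.range_comp] at this
      exact this)) B hB
    have hj' : ∀ i : Coord B hB, (⟨x, hx⟩ : U) ∈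
        U.toScheme.basicOpen (muExt (muPart m) (base B hB) j.1 i.1 1) := by
      intro i
      have := hj i
      change IsUnit (muExt (fun p ↦ γ (muPart m p)) _ _ _ 1) at this
      rw [← map_muExt] at this
      exact (U.toScheme.mem_basicOpen _ _ (TopologicalSpace.Opens.mem_top _)).2 this
    obtain ⟨W, hW, hxW, hu⟩ := exists_nhds_isUnit hx _ hj'
    have H := hm.comp ((Qcirc n).toScheme.homOfLE hW)
    rw [← Category.assoc, Scheme.homOfLE_ι] at H
    simp only [map_muExt] at hu
    refine ⟨W, hxW, _, ?_, pbRel_ratio W.ι H j hu⟩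
    refine span_eq_top_of_isUnit j ?_
    have h1 := muExt_right (muPart fun p ↦ pull ((Qcirc n).toScheme.homOfLE hW) (m p)) j.2.2.symm
    rw [h1, h1, Ring.inverse_one, mul_one]
    exact isUnit_one

end ToPB

/-! ### Generically distinct configurations over a domain lie in `MBar` -/

section MBarLift

variable {n : ℕ}

/-- The components of a morphism to the product of the `ℙ(ℂ^B / ℂ)`. -/
def prodPB.proj (B : Subsets n) : (prodPB n).left ⟶ PB B.1 B.2 :=
  (Pi.π (fun B : Subsets n ↦ PS.over (Coord B.1 B.2) ℂ) B).left

lemma prodPB.proj_str (B : Subsets n) : prodPB.proj B ≫ PS.str _ ℂ = (prodPB n).hom :=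
  Over.w (Pi.π (fun B : Subsets n ↦ PS.over (Coord B.1 B.2) ℂ) B)

lemma prodPB.hom_ext {T : Scheme.{0}} {f g : T ⟶ (prodPB n).left}
    (hS : f ≫ (prodPB n).hom = g ≫ (prodPB n).hom)
    (h : ∀ B, f ≫ prodPB.proj B = g ≫ prodPB.proj B) : f = g :=
  pi_hom_ext hS h

lemma prodPB.exists_lift {T : Scheme.{0}} (g : T ⟶ Spec (.of ℂ))
    (f : ∀ B : Subsets n, T ⟶ PB B.1 B.2) (hf : ∀ B, f B ≫ PS.str _ ℂ = g) :
    ∃ φ : T ⟶ (prodPB n).left, φ ≫ (prodPB n).hom = g ∧ ∀ B, φ ≫ prodPB.proj B = f B :=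
  exists_pi_lift (X := fun B : Subsets n ↦ PS.over (Coord B.1 B.2) ℂ) g f hf

lemma prodPB.comp_proj_str {T : Scheme.{0}} (f : T ⟶ (prodPB n).left) (B : Subsets n) :
    (f ≫ prodPB.proj B) ≫ PS.str _ ℂ = f ≫ (prodPB n).hom := by
  rw [Category.assoc, prodPB.proj_str]

lemma ConfRing.toProd_hom : ConfRing.toProd n ≫ (prodPB n).hom = ConfRing.str n :=
  Over.w (Pi.lift fun B : Subsets n ↦ Over.homMk
    (ofCoords (ConfRing.str n) _ (ConfRing.span_eq_top n B)) (ofCoords_str _ _ _) :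
    Over.mk (ConfRing.str n) ⟶ prodPB n)

lemma ConfRing.toProd_proj (B : Subsets n) : ConfRing.toProd n ≫ prodPB.proj B =
    ofCoords (ConfRing.str n) _ (ConfRing.span_eq_top n B) := by
  have h := Pi.lift_π (fun B : Subsets n ↦ (Over.homMk
    (ofCoords (ConfRing.str n) _ (ConfRing.span_eq_top n B)) (ofCoords_str _ _ _) :
    Over.mk (ConfRing.str n) ⟶ PS.over (Coord B.1 B.2) ℂ)) B
  exact congrArg CommaMorphism.left h

lemma pull_specMap {A B : Type} [CommRing A] [CommRing B] (f : A →+* B) (x : A) :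
    pull (Spec.map (CommRingCat.ofHom f)) ((Scheme.ΓSpecIso (.of A)).inv x) =
      (Scheme.ΓSpecIso (.of B)).inv (f x) :=
  scalars_specMap f x

lemma ker_specMap_eq_bot {A B : Type} [CommRing A] [CommRing B] {f : A →+* B}
    (hf : Function.Injective f) : (Spec.map (CommRingCat.ofHom f)).ker = ⊥ := by
  rw [Scheme.ker_of_isAffine]
  have : RingHom.ker (Spec.map (CommRingCat.ofHom f)).appTop.hom = ⊥ := by
    rw [← RingHom.injective_iff_ker_eq_bot, injective_iff_map_eq_zero]
    intro a ha
    obtain ⟨x, rfl⟩ := (ConcreteCategory.bijective_of_isIso (Scheme.ΓSpecIso (.of A)).inv).2 a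
    have h1 := (pull_specMap f x).symm.trans ha
    rw [map_eq_zero_iff _ (ConcreteCategory.bijective_of_isIso (Scheme.ΓSpecIso (.of B)).inv).1,
      map_eq_zero_iff _ hf] at h1
    rw [h1, map_zero]
  rw [this]
  exact map_bot Scheme.IdealSheafData.equivOfIsAffine.symm

/-- Distinctness of the `u_i` makes the discriminant nonzero, hence invertible in `K`. -/
lemma ConfRing.exists_lift {K : Type} [Field K] (c : ℂ →+* K) {u : Fin n → K}
    (hu : Function.Injective u) : ∃ ψ : ConfRing n →+* K,
      ψ.comp (algebraMap ℂ (ConfRing n)) = c ∧ ∀ i, ψ (ConfRing.u n i) = u i := by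
  have hd : IsUnit (MvPolynomial.eval₂Hom c u (discriminant n)) := by
    rw [discriminant, map_prod, isUnit_iff_ne_zero, Finset.prod_ne_zero_iff]
    rintro ⟨⟨i, j⟩, hij⟩ _
    rw [rootForm, map_sub, MvPolynomial.coe_eval₂Hom, MvPolynomial.eval₂_X, MvPolynomial.eval₂_X,
      sub_ne_zero]
    exact fun h ↦ hij (hu h)
  let ψ : Localization.Away (discriminant n) →+* K := IsLocalization.Away.lift _ hd
  have hψ : ∀ x, ψ (algebraMap _ _ x) = MvPolynomial.eval₂Hom c u x :=
    fun x ↦ IsLocalization.Away.lift_eq _ hd x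
  exact ⟨ψ, RingHom.ext fun x ↦ (hψ (MvPolynomial.C x)).trans (MvPolynomial.eval₂_C _ _ _),
    fun i ↦ (hψ (MvPolynomial.X i)).trans (MvPolynomial.eval₂_X _ _ _)⟩

variable (n) in
/-- The closed immersion of `M̄_{n+1}` into the product of the `ℙ(ℂ^B / ℂ)`. -/
def MBar.ι : MBar n ⟶ (prodPB n).left := (ConfRing.toProd n).imageι

instance : IsClosedImmersion (MBar.ι n) :=
  inferInstanceAs (IsClosedImmersion (ConfRing.toProd n).ker.subschemeι)

/-- A family of points `[u|_B]` with values in a field lies in `M_{n+1}`. -/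
lemma ConfRing.exists_comp_toProd {D K : Type} [CommRing D] [Field K] {ι : D →+* K}
    (hι : Function.Injective ι) (c : ℂ →+* D)
    {u : Fin n → D} (hu : Function.Injective u) {h : Spec (.of D) ⟶ (prodPB n).left}
    (hh : h ≫ (prodPB n).hom = Spec.map (CommRingCat.ofHom c))
    {ρ : ∀ B : Subsets n, Coord B.1 B.2 → D} {j : ∀ B : Subsets n, Coord B.1 B.2}
    (hρ : ∀ B, Coords (h ≫ prodPB.proj B) fun i ↦ (Scheme.ΓSpecIso (.of D)).inv (ρ B i))
    (hr : ∀ (B : Subsets n) i,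
      u (base B.1 B.2) - u i.1 = ρ B i * (u (base B.1 B.2) - u (j B).1)) :
    ∃ ψ : ConfRing n →+* K, Spec.map (CommRingCat.ofHom ι) ≫ h =
      Spec.map (CommRingCat.ofHom ψ) ≫ ConfRing.toProd n := by
  obtain ⟨ψ, hψ, hψu⟩ := ConfRing.exists_lift (ι.comp c) (u := fun i ↦ ι (u i))
    (hι.comp hu)
  refine ⟨ψ, ?_⟩
  have hS : (Spec.map (CommRingCat.ofHom ι) ≫ h) ≫ (prodPB n).hom =
      (Spec.map (CommRingCat.ofHom ψ) ≫ ConfRing.toProd n) ≫ (prodPB n).hom := by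
    rw [Category.assoc, hh, Category.assoc, ConfRing.toProd_hom, ConfRing.str, ← Spec.map_comp,
      ← Spec.map_comp, ← CommRingCat.ofHom_comp, ← CommRingCat.ofHom_comp, hψ]
  refine prodPB.hom_ext hS fun B ↦ ?_
  have h1 := (hρ B).comp (Spec.map (CommRingCat.ofHom ι))
  have h2 := (coords_ofCoords (ConfRing.str n) _ (ConfRing.span_eq_top n B)).comp
    (Spec.map (CommRingCat.ofHom ψ))
  rw [← ConfRing.toProd_proj, ← Category.assoc] at h2
  rw [← Category.assoc] at h1
  refine h1.ext h2 ?_ fun i k ↦ ?_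
  · rw [prodPB.comp_proj_str, prodPB.comp_proj_str]
    exact hS
  · have h3 := fun x ↦ pull_specMap ι x
    have h4 := fun x ↦ pull_specMap ψ x
    refine (congrArg₂ (· * ·) (h3 _) (h4 _)).trans
      (Eq.trans ?_ (congrArg₂ (· * ·) (h3 _) (h4 _)).symm)
    have h5 : ι (ρ B i) * ψ (ConfRing.u n k - ConfRing.u n (base B.1 B.2)) =
        ι (ρ B k) * ψ (ConfRing.u n i - ConfRing.u n (base B.1 B.2)) := by
      rw [map_sub, map_sub, hψu, hψu, hψu, ← map_sub, ← map_sub, ← map_mul, ← map_mul]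
      congr 1
      linear_combination ρ B k * hr B i - ρ B i * hr B k
    have h6 := congrArg (Scheme.ΓSpecIso (.of K)).inv.hom h5
    rw [map_mul, map_mul] at h6
    exact h6

/-- A point of the product of the `ℙ(ℂ^B / ℂ)` with values in a domain which is generically a
configuration of distinct points lies in `M̄_{n+1}`. -/
lemma MBar.exists_lift_of_isDomain {D : Type} [CommRing D] [IsDomain D] (c : ℂ →+* D)
    {u : Fin n → D} (hu : Function.Injective u) (h : Spec (.of D) ⟶ (prodPB n).left)
    (hh : h ≫ (prodPB n).hom = Spec.map (CommRingCat.ofHom c))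
    (ρ : ∀ B : Subsets n, Coord B.1 B.2 → D) (j : ∀ B : Subsets n, Coord B.1 B.2)
    (hρ : ∀ B, Coords (h ≫ prodPB.proj B) fun i ↦ (Scheme.ΓSpecIso (.of D)).inv (ρ B i))
    (hr : ∀ (B : Subsets n) i,
      u (base B.1 B.2) - u i.1 = ρ B i * (u (base B.1 B.2) - u (j B).1)) :
    ∃ l : Spec (.of D) ⟶ MBar n, l ≫ MBar.ι n = h := by
  have hι := IsFractionRing.injective D (FractionRing D)
  obtain ⟨ψ, key⟩ := ConfRing.exists_comp_toProd hι c hu hh hρ hr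
  -- As `D` embeds in its fraction field, `h` has the same kernel as its generic point, and the
  -- latter factors through the space of configurations.
  have hker : (MBar.ι n).ker ≤ h.ker := by
    have h1 : (Spec.map (CommRingCat.ofHom (algebraMap D (FractionRing D))) ≫ h).ker = h.ker := by
      rw [Scheme.Hom.ker_comp, ker_specMap_eq_bot hι, Scheme.IdealSheafData.map_bot]
    rw [← h1, key]
    refine le_trans (le_of_eq ?_) (Scheme.Hom.le_ker_comp _ _)
    exact Scheme.IdealSheafData.ker_subschemeι _
  exact ⟨IsClosedImmersion.lift (MBar.ι n) h hker, IsClosedImmersion.lift_fac _ _ _⟩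

end MBarLift

/-! ### The morphism from `Qcirc` to `MBar` -/

section QcircLift

variable {n : ℕ}

/-- The morphism to `ℙ(ℂ^B / ℂ)` given by the `μ_ijk`. -/
def Qcirc.toPB (B : Subsets n) : (Qcirc n).toScheme ⟶ PB B.1 B.2 :=
  (Qcirc.exists_toPB B.1 B.2).choose

lemma Qcirc.toPB_str (B : Subsets n) : Qcirc.toPB B ≫ PS.str _ ℂ = Qcirc.str n :=
  (Qcirc.exists_toPB B.1 B.2).choose_spec.1

lemma Qcirc.coords_toPB (B : Subsets n) {T : Scheme.{0}} (t : T ⟶ (Qcirc n).toScheme)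
    (s : Coord B.1 B.2 → Γ(T, ⊤)) (hs : Ideal.span (Set.range s) = ⊤) (h : PBRel B.1 B.2 t s) :
    Coords (t ≫ Qcirc.toPB B) s :=
  (Qcirc.exists_toPB B.1 B.2).choose_spec.2 t s hs h

lemma Qcirc.exists_toProd : ∃ φ : (Qcirc n).toScheme ⟶ (prodPB n).left,
    φ ≫ (prodPB n).hom = Qcirc.str n ∧ ∀ B, φ ≫ prodPB.proj B = Qcirc.toPB B :=
  prodPB.exists_lift (Qcirc.str n) Qcirc.toPB Qcirc.toPB_str

/-- Over a local ring, a point of `𝒬_n` comes from a configuration of distinct points of a local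
domain. -/
lemma Qcirc.exists_domain {T : Scheme.{0}} [IsLocalRing Γ(T, ⊤)] (t : T ⟶ (Qcirc n).toScheme)
    {m : Indices n × Fin 2 → Γ(T, ⊤)} (H : LCoords (t ≫ Qcirc.toLines n) m) :
    ∃ (D : Type) (_ : CommRing D) (_ : IsDomain D) (c : ℂ →+* D) (φ : D →+* Γ(T, ⊤))
      (u : Fin n → D), IsLocalHom φ ∧ φ.comp c = scalars (t ≫ Qcirc.str n) ∧
      Function.Injective u ∧ ∀ i j k, i ≠ j → IsUnit (muExt (muPart m) i j k 1) →
        ∃ ρ, u i - u k = ρ * (u i - u j) ∧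
          φ ρ = muExt (muPart m) i j k 0 * Ring.inverse (muExt (muPart m) i j k 1) := by
  obtain ⟨D, _, hD, c, φ, u, -, hφ, hc, hinj, hgood⟩ := RatioSystem.exists_lifts
    (scalars (t ≫ Qcirc.str n)) (muSystem (Qcirc.muRel t H)
      fun i j k ↦ isUnit_or_of_span_eq_top (H.span_muExt i j k)) Finset.univ
  exact ⟨D, inferInstance, hD, c, φ, u, hφ, hc, fun i j h ↦ hinj (by simp) (by simp) h,
    fun i j k hij hk ↦ hgood i (by simp) j (by simp) k (by simp) hij hk⟩

lemma Qcirc.exists_farthest {T : Scheme.{0}} [IsLocalRing Γ(T, ⊤)] (t : T ⟶ (Qcirc n).toScheme)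
    {m : Indices n × Fin 2 → Γ(T, ⊤)} (H : LCoords (t ≫ Qcirc.toLines n) m) (B : Subsets n) :
    ∃ j : Coord B.1 B.2, ∀ i : Coord B.1 B.2,
      IsUnit (muExt (muPart m) (base B.1 B.2) j.1 i.1 1) :=
  exists_farthest_coord (muSystem (Qcirc.muRel t H)
    fun i j k ↦ isUnit_or_of_span_eq_top (H.span_muExt i j k)) B.1 B.2

lemma Qcirc.coords_toPB_ratio {T : Scheme.{0}} (t : T ⟶ (Qcirc n).toScheme)
    {m : Indices n × Fin 2 → Γ(T, ⊤)} (H : LCoords (t ≫ Qcirc.toLines n) m) (B : Subsets n)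
    (j : Coord B.1 B.2)
    (hj : ∀ i : Coord B.1 B.2, IsUnit (muExt (muPart m) (base B.1 B.2) j.1 i.1 1)) :
    Coords (t ≫ Qcirc.toPB B) fun i ↦ muExt (muPart m) (base B.1 B.2) j.1 i.1 0 *
      Ring.inverse (muExt (muPart m) (base B.1 B.2) j.1 i.1 1) := by
  refine Qcirc.coords_toPB B t _ (span_eq_top_of_isUnit j ?_) (pbRel_ratio t H j hj)
  rw [muExt_right _ j.2.2.symm, muExt_right _ j.2.2.symm, Ring.inverse_one, mul_one]
  exact isUnit_one

/-- The ratios are lifted to a domain `D` with distinct `u_i`. The lifted ratios relative to the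
farthest point of each `B` define a `D`-point of the product, which lies in `MBar`; the given point
is its image under `D → Γ(T, ⊤)`. -/
lemma Qcirc.exists_toMBar_of_isLocalRing {T : Scheme.{0}} [IsLocalRing Γ(T, ⊤)]
    (t : T ⟶ (Qcirc n).toScheme) {m : Indices n × Fin 2 → Γ(T, ⊤)}
    (H : LCoords (t ≫ Qcirc.toLines n) m) {φ : (Qcirc n).toScheme ⟶ (prodPB n).left}
    (hφ : φ ≫ (prodPB n).hom = Qcirc.str n) (hφB : ∀ B, φ ≫ prodPB.proj B = Qcirc.toPB B) :
    ∃ l : T ⟶ MBar n, l ≫ MBar.ι n = t ≫ φ := by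
  obtain ⟨D, _, _, c, f, u, hf, hc, hu, hgood⟩ := Qcirc.exists_domain t H
  choose j hj using Qcirc.exists_farthest t H
  choose ρ hρ hρ' using fun B i ↦ hgood _ _ _ (j B).2.2.symm (hj B i)
  -- The coordinate with index `j B` maps to `1`, so it is a unit of `D` because `f` is local.
  have hspan : ∀ B, Ideal.span (Set.range fun i ↦ (Scheme.ΓSpecIso (.of D)).inv (ρ B i)) = ⊤ := by
    intro B
    refine span_eq_top_of_isUnit (j B) (IsUnit.map (Scheme.ΓSpecIso (.of D)).inv.hom ?_)
    rw [← isUnit_map_iff f, hρ', muExt_right _ (j B).2.2.symm, muExt_right _ (j B).2.2.symm,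
      Ring.inverse_one, mul_one]
    exact isUnit_one
  obtain ⟨h, hh, hhB⟩ : ∃ h : Spec (.of D) ⟶ (prodPB n).left,
      h ≫ (prodPB n).hom = Spec.map (CommRingCat.ofHom c) ∧ ∀ B, h ≫ prodPB.proj B =
        ofCoords (Spec.map (CommRingCat.ofHom c)) _ (hspan B) :=
    prodPB.exists_lift (Spec.map (CommRingCat.ofHom c)) (fun B ↦ ofCoords _ _ (hspan B))
      fun B ↦ ofCoords_str _ _ _
  have hcoords : ∀ B, Coords (h ≫ prodPB.proj B) fun i ↦ (Scheme.ΓSpecIso (.of D)).inv (ρ B i) :=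
    fun B ↦ by rw [hhB]; exact coords_ofCoords _ _ _
  obtain ⟨l, hl⟩ := MBar.exists_lift_of_isDomain c hu h hh ρ j hcoords hρ
  refine ⟨(T.toSpecΓ ≫ Spec.map (CommRingCat.ofHom f)) ≫ l, ?_⟩
  rw [Category.assoc, hl]
  have hS : ((T.toSpecΓ ≫ Spec.map (CommRingCat.ofHom f)) ≫ h) ≫ (prodPB n).hom =
      (t ≫ φ) ≫ (prodPB n).hom := by
    rw [Category.assoc, hh, Category.assoc, Category.assoc, hφ,
      eq_toSpecΓ_comp_scalars (t ≫ Qcirc.str n), ← hc, CommRingCat.ofHom_comp, Spec.map_comp]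
  refine prodPB.hom_ext hS fun B ↦ ?_
  have h1 := (hcoords B).comp (T.toSpecΓ ≫ Spec.map (CommRingCat.ofHom f))
  have h2 := Qcirc.coords_toPB_ratio t H B (j B) (hj B)
  rw [← hφB, ← Category.assoc] at h2
  rw [← Category.assoc] at h1
  refine h1.ext h2 ?_ fun i k ↦ ?_
  · rw [prodPB.comp_proj_str, prodPB.comp_proj_str]
    exact hS
  · have h3 := fun i ↦ (pull_toSpecΓ_comp f (ρ B i)).trans (hρ' B i)
    exact (congrArg (· * _) (h3 i)).trans ((mul_comm _ _).trans (congrArg (· * _) (h3 k)).symm)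

instance (A : CommRingCat.{0}) [IsLocalRing A] : IsLocalRing Γ(Spec A, ⊤) :=
  (Scheme.ΓSpecIso A).symm.commRingCatIsoToRingEquiv.isLocalRing

lemma Qcirc.exists_toMBar : ∃ φ : (Qcirc n).toScheme ⟶ MBar n,
    (φ ≫ MBar.ι n) ≫ (prodPB n).hom = Qcirc.str n ∧
      ∀ B, (φ ≫ MBar.ι n) ≫ prodPB.proj B = Qcirc.toPB B := by
  obtain ⟨φ, hφ, hφB⟩ := Qcirc.exists_toProd (n := n)
  obtain ⟨l, hl⟩ := exists_lift_of_stalks (MBar.ι n) φ fun x ↦ by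
    obtain ⟨m, hm, -⟩ := exists_lcoords_of_isLocalRing
      ((Qcirc n).toScheme.fromSpecStalk x ≫ Qcirc.toLines n)
    exact Qcirc.exists_toMBar_of_isLocalRing _ hm hφ hφB
  exact ⟨l, by rw [hl, hφ], fun B ↦ by rw [hl, hφB]⟩

end QcircLift

/-! ### The morphism from `Qcirc` to the blowup and to the deformed line bundle -/

section ToE

lemma Blowup.toPS_str {R : Type} [CommRing R] (I : Ideal R) {k σ : Type} [CommRing k] [Algebra k R]
    (t : σ → R) (ht : ∀ i, t i ∈ I) (hI : I ≤ Ideal.span (Set.range t)) :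
    Blowup.toPS (k := k) I t ht hI ≫ PS.str σ k =
      Blowup.toSpec I ≫ Spec.map (CommRingCat.ofHom (algebraMap k R)) := by
  refine hom_ext_of_opens fun x ↦ ?_
  obtain ⟨i, hi⟩ := exists_mem_basicOpen_X (Blowup.toPS (k := k) I t ht hI x)
  have hU : ((Blowup.toPS (k := k) I t ht hI ⁻¹ᵁ
      Proj.basicOpen (stdGrading σ k) (MvPolynomial.X i)).ι ≫
      Blowup.toPS (k := k) I t ht hI) ⁻¹ᵁ
        Proj.basicOpen (stdGrading σ k) (MvPolynomial.X i) = ⊤ :=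
    Scheme.Opens.ι_preimage_self _
  refine ⟨Blowup.toPS (k := k) I t ht hI ⁻¹ᵁ Proj.basicOpen (stdGrading σ k) (MvPolynomial.X i),
    hi, ?_⟩
  generalize Blowup.toPS (k := k) I t ht hI ⁻¹ᵁ
    Proj.basicOpen (stdGrading σ k) (MvPolynomial.X i) = U at hU
  obtain ⟨f, -, hf1, hf2⟩ := exists_rees_chart I t ht hI U.ι hU
  rw [← Category.assoc, hf2, ← Category.assoc (h := Spec.map _), hf1, PS.str]
  simp only [Category.assoc]
  rw [Proj.awayι_toSpecZero_assoc, ← Spec.map_comp, ← Spec.map_comp, ← Spec.map_comp,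
    ← CommRingCat.ofHom_comp]
  exact congrArg (fun z ↦ U.toScheme.toSpecΓ ≫ Spec.map z) (CommRingCat.hom_ext (RingHom.ext
    fun c ↦ congrArg f (away_map_reesConst (k := k) I t ht (MvPolynomial.X i) c)))

variable {n : ℕ} (hn : 2 ≤ n)

lemma E.toPt_str : E.toPt n hn ≫ PS.str _ ℂ =
    E.toCf n ≫ Spec.map (CommRingCat.ofHom (algebraMap ℂ (CfRing n))) :=
  Blowup.toPS_str _ _ _ _

lemma E.hom_ext {T : Scheme.{0}} {a a' : T ⟶ E n} (h1 : a ≫ E.toCf n = a' ≫ E.toCf n)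
    (h2 : a ≫ E.toPt n hn = a' ≫ E.toPt n hn) : a = a' :=
  Blowup.hom_ext _ _ _ _ h1 h2

/-- The set of all indices. -/
abbrev univSubset (hn : 2 ≤ n) : Subsets n := ⟨Finset.univ, univ_nontrivial n hn⟩

/-- Converse of `Qcirc.coords_toPB`: on stalks, arbitrary coordinates are proportional to the ratios
relative to a farthest point, and those satisfy the relations. -/
lemma Qcirc.pbRel_of_coords (B : Subsets n) {T : Scheme.{0}} {t : T ⟶ (Qcirc n).toScheme}
    {s : Coord B.1 B.2 → Γ(T, ⊤)} (hs : Coords (t ≫ Qcirc.toPB B) s) : PBRel B.1 B.2 t s := by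
  intro T' u m hm i j
  refine eq_of_pull_fromSpecStalk fun x ↦ ?_
  have hm' := hm.comp (T'.fromSpecStalk x)
  rw [← Category.assoc, ← Category.assoc] at hm'
  obtain ⟨l, hl⟩ := Qcirc.exists_farthest ((T'.fromSpecStalk x ≫ u) ≫ t) hm' B
  have h1 := Qcirc.coords_toPB_ratio _ hm' B l hl
  rw [Category.assoc] at h1
  have h2 := (hs.comp (T'.fromSpecStalk x ≫ u)).mul_eq_mul h1
  have h3 := pbRel_ratio _ hm' l hl (𝟙 _) (fun p ↦ pull (T'.fromSpecStalk x) (m p))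
    (by rw [Category.id_comp]; exact hm') i j
  simp only [pull_comp] at h2
  simp only [map_mul, map_muExt (pull (T'.fromSpecStalk x))]
  simp only [show ∀ a, pull (𝟙 (Spec (T'.presheaf.stalk x))) a = a from fun a ↦ by
    simp [pull]] at h3
  refine eq_of_span_eq_top h1.1 fun q ↦ ?_
  have h4 := h2 i q
  have h5 := h2 j q
  change _ * (_ * muExt (fun p ↦ pull (T'.fromSpecStalk x) (muPart m p)) _ _ _ 1) =
    _ * (muExt (fun p ↦ pull (T'.fromSpecStalk x) (muPart m p)) _ _ _ 0 * _)
  change _ * muExt (fun p ↦ pull (T'.fromSpecStalk x) (muPart m p)) _ _ _ 1 =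
    muExt (fun p ↦ pull (T'.fromSpecStalk x) (muPart m p)) _ _ _ 0 * _ at h3
  linear_combination muExt (fun p ↦ pull (T'.fromSpecStalk x) (muPart m p)) (base B.1 B.2)
    j.1 i.1 1 * h4 - muExt (fun p ↦ pull (T'.fromSpecStalk x) (muPart m p)) (base B.1 B.2)
    j.1 i.1 0 * h5 + pull (T'.fromSpecStalk x) (pull u (s q)) * h3

/-- Both `s` and the family `δ_bi` satisfy `x_i = μ_bji x_j`, and the coordinates of `μ_bji`
generate the unit ideal. These are exactly the equations required by `E.exists_lift`. -/
lemma Qcirc.mul_delta {T : Scheme.{0}} {t : T ⟶ (Qcirc n).toScheme}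
    {s : Coord (univSubset hn).1 (univSubset hn).2 → Γ(T, ⊤)}
    (hs : Coords (t ≫ Qcirc.toPB (univSubset hn)) s)
    (i j : Coord (univSubset hn).1 (univSubset hn).2) :
    s j * scalars (t ≫ Qcirc.toCf n) (originDelta n hn i) =
      s i * scalars (t ≫ Qcirc.toCf n) (originDelta n hn j) := by
  refine eq_of_pull_opens fun x ↦ ?_
  obtain ⟨U, hx, m, hm, -⟩ := exists_local_lcoords (t ≫ Qcirc.toLines n) x
  refine ⟨U, hx, ?_⟩
  have h1 := Qcirc.pbRel_of_coords _ hs U.ι m hm i j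
  rw [← Category.assoc] at hm
  have h2 := Qcirc.muExt_mul_delta _ hm i.1 j.2.2.symm
  rw [← originDelta_eq hn i, ← originDelta_eq hn j, Category.assoc, scalars_comp] at h2
  rw [map_mul, map_mul]
  change _ * pull U.ι _ = _ * pull U.ι _ at h2
  refine eq_of_span_pair_eq_top (hm.span_muExt (origin n hn) j.1 i.1) ?_ ?_
  · linear_combination -pull U.ι (s i) * h2 -
      pull U.ι (scalars (t ≫ Qcirc.toCf n) (originDelta n hn i)) * h1
  · linear_combination -pull U.ι (s j) * h2 -
      pull U.ι (scalars (t ≫ Qcirc.toCf n) (originDelta n hn j)) * h1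

lemma Qcirc.exists_toE : ∃ a : (Qcirc n).toScheme ⟶ E n, a ≫ E.toCf n = Qcirc.toCf n ∧
    a ≫ E.toPt n hn = Qcirc.toPB (univSubset hn) := by
  choose U hU j s hsj hs using exists_local_coords (Qcirc.toPB (univSubset hn))
  choose a ha ha' using fun x ↦ E.exists_lift hn ((U x).ι ≫ Qcirc.toCf n) (s x) (j x) (hsj x)
    fun i ↦ by rw [← Qcirc.mul_delta hn (hs x) i (j x), hsj, one_mul]
  have ha2 : ∀ x, a x ≫ E.toPt n hn = (U x).ι ≫ Qcirc.toPB (univSubset hn) := by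
    intro x
    refine (ha' x).ext (hs x) ?_ fun i j ↦ mul_comm _ _
    rw [Category.assoc, E.toPt_str, ← Category.assoc, ha, Category.assoc, Category.assoc,
      Qcirc.toPB_str]
    rfl
  obtain ⟨φ, hφ⟩ := exists_glue U (fun x ↦ ⟨x, hU x⟩) a fun x y ↦ by
    refine E.hom_ext hn ?_ ?_
    · rw [Category.assoc, Category.assoc, ha, ha, Scheme.homOfLE_ι_assoc, Scheme.homOfLE_ι_assoc]
    · rw [Category.assoc, Category.assoc, ha2, ha2, Scheme.homOfLE_ι_assoc,
        Scheme.homOfLE_ι_assoc]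
  refine ⟨φ, hom_ext_of_opens fun x ↦ ⟨U x, hU x, ?_⟩, hom_ext_of_opens fun x ↦ ⟨U x, hU x, ?_⟩⟩
  · rw [← Category.assoc, hφ, ha]
  · rw [← Category.assoc, hφ, ha2]

/-- The projection of the deformed line bundle to `M̄_{n+1}`. -/
def MTilde.toMBar : MTilde n hn ⟶ MBar n := pullback.fst (MBar.collapse n hn) (E.toPt n hn)

/-- The projection of the deformed line bundle to `ℰ_{n+1}`. -/
def MTilde.toE : MTilde n hn ⟶ E n := pullback.snd (MBar.collapse n hn) (E.toPt n hn)

lemma MTilde.toE_toCf : MTilde.toE hn ≫ E.toCf n = MTilde.toCf n hn := rfl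

lemma MTilde.condition :
    (MTilde.toMBar hn ≫ MBar.ι n) ≫ prodPB.proj (univSubset hn) = MTilde.toE hn ≫ E.toPt n hn :=
  (Category.assoc _ _ _).trans pullback.condition

lemma MTilde.exists_lift {T : Scheme.{0}} (f : T ⟶ MBar n) (a : T ⟶ E n)
    (h : (f ≫ MBar.ι n) ≫ prodPB.proj (univSubset hn) = a ≫ E.toPt n hn) :
    ∃ l : T ⟶ MTilde n hn, l ≫ MTilde.toMBar hn = f ∧ l ≫ MTilde.toE hn = a := by
  have h' : f ≫ MBar.collapse n hn = a ≫ E.toPt n hn := (Category.assoc _ _ _).symm.trans h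
  exact ⟨pullback.lift f a h', pullback.lift_fst _ _ h', pullback.lift_snd _ _ h'⟩

lemma MTilde.hom_ext {T : Scheme.{0}} {f g : T ⟶ MTilde n hn}
    (h : f ≫ MTilde.toMBar hn = g ≫ MTilde.toMBar hn)
    (h' : f ≫ MTilde.toE hn = g ≫ MTilde.toE hn) : f = g :=
  pullback.hom_ext h h'

/-- There is a morphism from the open locus of `𝒬_n` to the deformed line bundle. -/
lemma Qcirc.exists_toMTilde : ∃ f : (Qcirc n).toScheme ⟶ MTilde n hn,
    f ≫ MTilde.toCf n hn = Qcirc.toCf n ∧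
      ∀ B, ((f ≫ MTilde.toMBar hn) ≫ MBar.ι n) ≫ prodPB.proj B = Qcirc.toPB B := by
  obtain ⟨φ, -, hφ⟩ := Qcirc.exists_toMBar (n := n)
  obtain ⟨a, ha, ha'⟩ := Qcirc.exists_toE hn
  obtain ⟨l, hl, hl'⟩ := MTilde.exists_lift hn φ a (by rw [ha', hφ])
  exact ⟨l, by rw [← MTilde.toE_toCf, ← Category.assoc, hl', ha], fun B ↦ by rw [hl, hφ]⟩

end ToE

/-! ### Identities between configurations extend to `MBar` -/

section Relations

variable {n : ℕ}

/-- An expression in the coordinates on the product of the `ℙ(ℂ^B / ℂ)`, natural in the ring of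
coefficients, whose vanishing depends only on the point, and which vanishes on configurations. -/
structure ConfRelation (n : ℕ) where
  /-- The expression. -/
  F : ∀ {A : Type} [CommRing A], (∀ B : Subsets n, Coord B.1 B.2 → A) → A
  map : ∀ {A A' : Type} [CommRing A] [CommRing A'] (f : A →+* A')
    (e : ∀ B : Subsets n, Coord B.1 B.2 → A), f (F e) = F fun B i ↦ f (e B i)
  scale : ∀ {A : Type} [CommRing A] (e : ∀ B : Subsets n, Coord B.1 B.2 → A) (l : Subsets n → Aˣ),
    F e = 0 → F (fun B i ↦ l B * e B i) = 0
  conf : ∀ {A : Type} [CommRing A] (u : Fin n → A),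
    F (fun B i ↦ u i.1 - u (base B.1 B.2)) = 0

namespace ConfRelation

variable (P : ConfRelation n)

lemma eq_zero_of_coords {T : Scheme.{0}} {h : T ⟶ (prodPB n).left}
    {e e' : ∀ B : Subsets n, Coord B.1 B.2 → Γ(T, ⊤)}
    (he : ∀ B, Coords (h ≫ prodPB.proj B) (e B)) (he' : ∀ B, Coords (h ≫ prodPB.proj B) (e' B))
    (h0 : P.F e = 0) : P.F e' = 0 := by
  choose l hl using fun B ↦ exists_unit_mul (he B).1 (he' B).1 ((he B).mul_eq_mul (he' B))
  rw [show e' = fun B i ↦ (l B : Γ(T, ⊤)) * e B i from funext fun B ↦ funext (hl B)]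
  exact P.scale e l h0

lemma topIso_inv_app {T : Scheme.{0}} (h : T ⟶ (prodPB n).left) (W : (prodPB n).left.Opens)
    (c : ∀ B : Subsets n, Coord B.1 B.2 → Γ(W, ⊤)) :
    (h ⁻¹ᵁ W).topIso.inv (h.app W (W.topIso.hom (P.F c))) =
      P.F fun B i ↦ pull (h ∣_ W) (c B i) := by
  rw [← pull_restrict, ← P.map]
  congr 1
  exact ConcreteCategory.congr_hom W.topIso.hom_inv_id _

lemma coords_restrict {T : Scheme.{0}} (h : T ⟶ (prodPB n).left) {W : (prodPB n).left.Opens}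
    {c : ∀ B : Subsets n, Coord B.1 B.2 → Γ(W, ⊤)}
    (hc : ∀ B, Coords (W.ι ≫ prodPB.proj B) (c B)) (B : Subsets n) :
    Coords (((h ⁻¹ᵁ W).ι ≫ h) ≫ prodPB.proj B) fun i ↦ pull (h ∣_ W) (c B i) := by
  have := (hc B).comp (h ∣_ W)
  rw [← Category.assoc, morphismRestrict_ι] at this
  exact this

/-- Here and in `pull_eq_zero` the expression at a `T`-point is translated into a local function on
the ambient product, where it can be tested for membership in an ideal sheaf. -/
lemma app_eq_zero {T : Scheme.{0}} {h : T ⟶ (prodPB n).left} {W : (prodPB n).left.Opens}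
    {c : ∀ B : Subsets n, Coord B.1 B.2 → Γ(W, ⊤)}
    (hc : ∀ B, Coords (W.ι ≫ prodPB.proj B) (c B))
    {e : ∀ B : Subsets n, Coord B.1 B.2 → Γ(T, ⊤)}
    (he : ∀ B, Coords (h ≫ prodPB.proj B) (e B)) (h0 : P.F e = 0) :
    h.app W (W.topIso.hom (P.F c)) = 0 := by
  apply (ConcreteCategory.bijective_of_isIso (h ⁻¹ᵁ W).topIso.inv).1
  refine (P.topIso_inv_app h W c).trans (Eq.trans ?_ (map_zero _).symm)
  refine P.eq_zero_of_coords (e := fun B i ↦ pull (h ⁻¹ᵁ W).ι (e B i)) (fun B ↦ ?_)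
    (coords_restrict h hc) ?_
  · have := (he B).comp (h ⁻¹ᵁ W).ι
    rw [← Category.assoc] at this
    exact this
  · rw [← P.map, h0, map_zero]

lemma pull_eq_zero {T : Scheme.{0}} {h : T ⟶ (prodPB n).left} {W : (prodPB n).left.Opens}
    {c : ∀ B : Subsets n, Coord B.1 B.2 → Γ(W, ⊤)}
    (hc : ∀ B, Coords (W.ι ≫ prodPB.proj B) (c B))
    {e : ∀ B : Subsets n, Coord B.1 B.2 → Γ(T, ⊤)}
    (he : ∀ B, Coords (h ≫ prodPB.proj B) (e B))
    (h0 : h.app W (W.topIso.hom (P.F c)) = 0) : pull (h ⁻¹ᵁ W).ι (P.F e) = 0 := by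
  rw [P.map]
  refine P.eq_zero_of_coords (coords_restrict h hc) (fun B ↦ ?_) ?_
  · have := (he B).comp (h ⁻¹ᵁ W).ι
    rw [← Category.assoc] at this
    exact this
  · refine (P.topIso_inv_app h W c).symm.trans ?_
    rw [h0]
    exact map_zero _

instance : IsSeparated (prodPB n).hom :=
  isSeparated_pi _ fun B ↦ inferInstanceAs (IsSeparated (PS.str (Coord B.1 B.2) ℂ))

instance : QuasiCompact (ConfRing.toProd n) := by
  have : QuasiCompact (ConfRing.toProd n ≫ (prodPB n).hom) := by
    rw [ConfRing.toProd_hom]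
    infer_instance
  exact QuasiCompact.of_comp (ConfRing.toProd n) (prodPB n).hom

lemma exists_affine_coords (y : (prodPB n).left) :
    ∃ W : (prodPB n).left.affineOpens, y ∈ W.1 ∧
      ∃ c : ∀ B : Subsets n, Coord B.1 B.2 → Γ(W.1, ⊤),
        ∀ B, Coords (W.1.ι ≫ prodPB.proj B) (c B) := by
  choose U hU j s _ hs using fun B : Subsets n ↦ exists_local_coords (prodPB.proj B) y
  have hy : y ∈ (⨅ B, U B : (prodPB n).left.Opens) := by
    change y ∈ ((⨅ B, U B : (prodPB n).left.Opens) : Set (prodPB n).left)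
    rw [TopologicalSpace.Opens.coe_iInf]
    exact Set.mem_iInter.2 hU
  obtain ⟨W, hyW, hW⟩ := exists_affine_of_mem hy
  refine ⟨W, hyW, fun B i ↦ pull ((prodPB n).left.homOfLE (hW.trans (iInf_le U B))) (s B i),
    fun B ↦ ?_⟩
  have := (hs B).comp ((prodPB n).left.homOfLE (hW.trans (iInf_le U B)))
  rw [← Category.assoc, Scheme.homOfLE_ι] at this
  exact this

/-- The relations which hold on configurations hold on `M̄_{n+1}`. -/
theorem eq_zero {T : Scheme.{0}} (t : T ⟶ MBar n)
    {e : ∀ B : Subsets n, Coord B.1 B.2 → Γ(T, ⊤)}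
    (he : ∀ B, Coords ((t ≫ MBar.ι n) ≫ prodPB.proj B) (e B)) : P.F e = 0 := by
  refine eq_of_pull_opens fun x ↦ ?_
  obtain ⟨W, hxW, c, hc⟩ := exists_affine_coords ((t ≫ MBar.ι n) x)
  refine ⟨(t ≫ MBar.ι n) ⁻¹ᵁ W.1, hxW, ?_⟩
  rw [map_zero]
  refine P.pull_eq_zero hc he ?_
  have h1 : (ConfRing.toProd n).app W (W.1.topIso.hom (P.F c)) = 0 := by
    refine P.app_eq_zero hc (e := fun B i ↦ (Scheme.ΓSpecIso (.of (ConfRing n))).inv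
      (ConfRing.u n i.1 - ConfRing.u n (base B.1 B.2))) (fun B ↦ ?_) ?_
    · rw [ConfRing.toProd_proj]
      exact coords_ofCoords _ _ _
    · have := P.map (Scheme.ΓSpecIso (.of (ConfRing n))).inv.hom
        (fun B i ↦ ConfRing.u n i.1 - ConfRing.u n (base B.1 B.2))
      rw [P.conf, map_zero] at this
      exact this.symm
  -- The ideal of the closure is the kernel of the morphism from the space of configurations, on
  -- which the expression vanishes.
  have h2 : W.1.topIso.hom (P.F c) ∈ (MBar.ι n).ker.ideal W := by
    have h3 : (MBar.ι n).ker = (ConfRing.toProd n).ker := Scheme.IdealSheafData.ker_subschemeι _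
    rw [h3, Scheme.Hom.ker_apply]
    exact h1
  rw [Scheme.Hom.ker_apply] at h2
  rw [Scheme.Hom.comp_app]
  exact (congrArg (t.app _) h2).trans (map_zero _)

end ConfRelation

/-- The coordinates `u_i - u_b` for all `i ∈ B`, including the base point `b`. -/
def coordExt {A : Type} [CommRing A] {B : Subsets n} (e : Coord B.1 B.2 → A) (i : Fin n) : A :=
  if h : i ∈ B.1 ∧ i ≠ base B.1 B.2 then e ⟨i, h⟩ else 0

lemma coordExt_base {A : Type} [CommRing A] {B : Subsets n} (e : Coord B.1 B.2 → A) :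
    coordExt e (base B.1 B.2) = 0 := dif_neg fun h ↦ h.2 rfl

lemma coordExt_coord {A : Type} [CommRing A] {B : Subsets n} (e : Coord B.1 B.2 → A)
    (i : Coord B.1 B.2) : coordExt e i.1 = e i := dif_pos i.2

lemma map_coordExt {A A' : Type} [CommRing A] [CommRing A'] (f : A →+* A') {B : Subsets n}
    (e : Coord B.1 B.2 → A) (i : Fin n) : f (coordExt e i) = coordExt (fun i ↦ f (e i)) i := by
  unfold coordExt
  split_ifs <;> simp

lemma coordExt_mul {A : Type} [CommRing A] {B : Subsets n} (e : Coord B.1 B.2 → A) (l : A)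
    (i : Fin n) : coordExt (fun i ↦ l * e i) i = l * coordExt e i := by
  unfold coordExt
  split_ifs <;> simp

lemma coordExt_conf {A : Type} [CommRing A] {B : Subsets n} (u : Fin n → A) {i : Fin n}
    (hi : i ∈ B.1) : coordExt (B := B) (fun i ↦ u i.1 - u (base B.1 B.2)) i =
      u i - u (base B.1 B.2) := by
  unfold coordExt
  split_ifs with h
  · rfl
  · rw [not_and, not_not] at h
    rw [h hi, sub_self]

/-- The proportionality of `u|_B` and `u|_{B'}` on `B ∩ B'`. -/
def ConfRelation.proportional {B B' : Subsets n} {i j k l : Fin n} (hi : i ∈ B.1) (hj : j ∈ B.1)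
    (hk : k ∈ B.1) (hl : l ∈ B.1) (hi' : i ∈ B'.1) (hj' : j ∈ B'.1) (hk' : k ∈ B'.1)
    (hl' : l ∈ B'.1) : ConfRelation n where
  F e := (coordExt (e B) i - coordExt (e B) j) * (coordExt (e B') k - coordExt (e B') l) -
    (coordExt (e B) k - coordExt (e B) l) * (coordExt (e B') i - coordExt (e B') j)
  map f e := by simp only [map_sub, map_mul, map_coordExt]
  scale e l h := by
    simp only [coordExt_mul]
    linear_combination ((l B).1 * (l B').1) * h
  conf u := by
    simp only [coordExt_conf u hi, coordExt_conf u hj, coordExt_conf u hk, coordExt_conf u hl,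
      coordExt_conf u hi', coordExt_conf u hj', coordExt_conf u hk', coordExt_conf u hl']
    ring

/-- The multiplicativity of the ratios. -/
def ConfRelation.multiplicative {B B' B'' : Subsets n} {i j k l : Fin n} (hi : i ∈ B.1)
    (hj : j ∈ B.1) (hk : k ∈ B.1) (hi' : i ∈ B'.1) (hk' : k ∈ B'.1) (hl' : l ∈ B'.1)
    (hi'' : i ∈ B''.1) (hj'' : j ∈ B''.1) (hl'' : l ∈ B''.1) : ConfRelation n where
  F e := (coordExt (e B) i - coordExt (e B) k) * (coordExt (e B') i - coordExt (e B') l) *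
      (coordExt (e B'') i - coordExt (e B'') j) -
    (coordExt (e B'') i - coordExt (e B'') l) * (coordExt (e B) i - coordExt (e B) j) *
      (coordExt (e B') i - coordExt (e B') k)
  map f e := by simp only [map_sub, map_mul, map_coordExt]
  scale e l h := by
    simp only [coordExt_mul]
    linear_combination ((l B).1 * (l B').1 * (l B'').1) * h
  conf u := by
    simp only [coordExt_conf u hi, coordExt_conf u hj, coordExt_conf u hk, coordExt_conf u hi',
      coordExt_conf u hk', coordExt_conf u hl', coordExt_conf u hi'', coordExt_conf u hj'',
      coordExt_conf u hl'']
    ring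

end Relations

/-! ### The coordinates `μ_ijk` on the deformed line bundle -/

section ToQ

variable {n : ℕ}

/-- The homogeneous coordinates of the ratio `(u_i - u_k) / (u_i - u_j)`. -/
def ratioPair {A : Type} [CommRing A] {B : Subsets n} (e : Coord B.1 B.2 → A) (i j k : Fin n)
    (a : Fin 2) : A :=
  if a = 0 then coordExt e i - coordExt e k else coordExt e i - coordExt e j

lemma ratioPair_zero {A : Type} [CommRing A] {B : Subsets n} (e : Coord B.1 B.2 → A)
    (i j k : Fin n) : ratioPair e i j k 0 = coordExt e i - coordExt e k := rfl

lemma ratioPair_one {A : Type} [CommRing A] {B : Subsets n} (e : Coord B.1 B.2 → A)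
    (i j k : Fin n) : ratioPair e i j k 1 = coordExt e i - coordExt e j := rfl

lemma map_ratioPair {A A' : Type} [CommRing A] [CommRing A'] (f : A →+* A') {B : Subsets n}
    (e : Coord B.1 B.2 → A) (i j k : Fin n) (a : Fin 2) :
    f (ratioPair e i j k a) = ratioPair (fun x ↦ f (e x)) i j k a := by
  unfold ratioPair
  split_ifs <;> rw [map_sub, map_coordExt, map_coordExt]

lemma ratioPair_mul {A : Type} [CommRing A] {B : Subsets n} {e e' : Coord B.1 B.2 → A}
    (h : ∀ x y, e x * e' y = e y * e' x) (i j k : Fin n) :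
    ratioPair e i j k 0 * ratioPair e' i j k 1 = ratioPair e i j k 1 * ratioPair e' i j k 0 := by
  have h1 : ∀ x y, coordExt e x * coordExt e' y = coordExt e y * coordExt e' x := by
    intro x y
    unfold coordExt
    split_ifs <;> simp [h]
  simp only [ratioPair_zero, ratioPair_one]
  linear_combination -h1 i j - h1 k i + h1 k j

/-- The set of the three indices of a triple. -/
def tripleSet (c : Triples n) : Subsets n :=
  ⟨{c.1.1, c.1.2.1, c.1.2.2}, by
    refine ⟨c.1.1, by simp, c.1.2.1, by simp, c.2.1⟩⟩

lemma mem_tripleSet (c : Triples n) : c.1.1 ∈ (tripleSet c).1 ∧ c.1.2.1 ∈ (tripleSet c).1 ∧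
    c.1.2.2 ∈ (tripleSet c).1 := by
  simp [tripleSet]

/-- For a three-element set, the differences from one point to the other two generate all the
differences, so numerator and denominator have no common zero. This is why `μ_ijk` is defined
through `B = {i, j, k}`. -/
lemma span_ratioPair {A : Type} [CommRing A] (c : Triples n)
    {e : Coord (tripleSet c).1 (tripleSet c).2 → A} (he : Ideal.span (Set.range e) = ⊤) :
    Ideal.span (Set.range (ratioPair e c.1.1 c.1.2.1 c.1.2.2)) = ⊤ := by
  set J := Ideal.span (Set.range (ratioPair e c.1.1 c.1.2.1 c.1.2.2)) with hJ
  have h1 : ∀ x ∈ (tripleSet c).1, coordExt e c.1.1 - coordExt e x ∈ J := by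
    intro x hx
    simp only [tripleSet, Finset.mem_insert, Finset.mem_singleton] at hx
    obtain rfl | rfl | rfl := hx
    · rw [sub_self]
      exact J.zero_mem
    · exact Ideal.subset_span ⟨1, rfl⟩
    · exact Ideal.subset_span ⟨0, rfl⟩
  rw [eq_top_iff, ← he, Ideal.span_le]
  rintro _ ⟨x, rfl⟩
  have h2 := J.sub_mem (h1 _ ((tripleSet c).1.min'_mem (tripleSet c).2.nonempty)) (h1 _ x.2.1)
  have h3 : coordExt e ((tripleSet c).1.min' (tripleSet c).2.nonempty) = 0 := coordExt_base e
  rw [coordExt_coord, h3] at h2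
  simpa using h2

variable (hn : 2 ≤ n)

/-- The components of the morphism from the deformed line bundle to the product of the
`ℙ(ℂ^B / ℂ)`. -/
def MTilde.toPB (B : Subsets n) : MTilde n hn ⟶ PB B.1 B.2 :=
  (MTilde.toMBar hn ≫ MBar.ι n) ≫ prodPB.proj B

lemma MTilde.toPB_str (B : Subsets n) : MTilde.toPB hn B ≫ PS.str _ ℂ =
    MTilde.toCf n hn ≫ Spec.map (CommRingCat.ofHom (algebraMap ℂ (CfRing n))) := by
  have h1 : (MTilde.toMBar hn ≫ MBar.ι n) ≫ (prodPB n).hom =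
      MTilde.toCf n hn ≫ Spec.map (CommRingCat.ofHom (algebraMap ℂ (CfRing n))) := by
    rw [← prodPB.comp_proj_str _ (univSubset hn), MTilde.condition, Category.assoc]
    exact (congrArg (MTilde.toE hn ≫ ·) (E.toPt_str hn)).trans (Category.assoc _ _ _).symm
  rw [MTilde.toPB, prodPB.comp_proj_str, h1]

lemma MTilde.relation (P : ConfRelation n) {T : Scheme.{0}} (t : T ⟶ MTilde n hn)
    {e : ∀ B : Subsets n, Coord B.1 B.2 → Γ(T, ⊤)}
    (he : ∀ B, Coords (t ≫ MTilde.toPB hn B) (e B)) : P.F e = 0 := by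
  refine P.eq_zero (t ≫ MTilde.toMBar hn) fun B ↦ ?_
  have := he B
  rw [MTilde.toPB, ← Category.assoc, ← Category.assoc] at this
  exact this

lemma MTilde.exists_mu (c : Triples n) :
    ∃ φ : MTilde n hn ⟶ PS (Fin 2) Base,
      φ ≫ PS.str _ Base =
        MTilde.toCf n hn ≫ Spec.map (CommRingCat.ofHom (algebraMap Base (CfRing n))) ∧
      ∀ {T : Scheme.{0}} (t : T ⟶ MTilde n hn)
        (e : Coord (tripleSet c).1 (tripleSet c).2 → Γ(T, ⊤)),
        Coords (t ≫ MTilde.toPB hn (tripleSet c)) e →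
          Coords (t ≫ φ) (ratioPair e c.1.1 c.1.2.1 c.1.2.2) := by
  let R : ∀ {T : Scheme.{0}}, (T ⟶ MTilde n hn) → (Fin 2 → Γ(T, ⊤)) → Prop := fun {T} t s ↦
    ∀ {T' : Scheme.{0}} (u : T' ⟶ T) (e : Coord (tripleSet c).1 (tripleSet c).2 → Γ(T', ⊤)),
      Coords (u ≫ t ≫ MTilde.toPB hn (tripleSet c)) e →
        pull u (s 0) * ratioPair e c.1.1 c.1.2.1 c.1.2.2 1 =
          pull u (s 1) * ratioPair e c.1.1 c.1.2.1 c.1.2.2 0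
  have hR : ∀ {T : Scheme.{0}} (t : T ⟶ MTilde n hn)
      (e : Coord (tripleSet c).1 (tripleSet c).2 → Γ(T, ⊤)),
      Coords (t ≫ MTilde.toPB hn (tripleSet c)) e →
        R t (ratioPair e c.1.1 c.1.2.1 c.1.2.2) := by
    intro T t e he T' u e' he'
    rw [map_ratioPair, map_ratioPair]
    exact ratioPair_mul ((he.comp u).mul_eq_mul he') _ _ _
  have hpull : ∀ {T'' T : Scheme.{0}} (u : T'' ⟶ T) (t : T ⟶ MTilde n hn) (s : Fin 2 → Γ(T, ⊤)),
      R t s → R (u ≫ t) fun i ↦ pull u (s i) := by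
    intro T'' T u t s h T' u' e he
    have he' : Coords ((u' ≫ u) ≫ t ≫ MTilde.toPB hn (tripleSet c)) e := by
      simpa only [Category.assoc] using he
    have := h (u' ≫ u) e he'
    rw [pull_comp, pull_comp] at this
    exact this
  have hprop : ∀ {T : Scheme.{0}} (t : T ⟶ MTilde n hn) (s s' : Fin 2 → Γ(T, ⊤)), R t s → R t s' →
      Ideal.span (Set.range s) = ⊤ → Ideal.span (Set.range s') = ⊤ →
      ∀ i j, s i * s' j = s j * s' i := by
    intro T t s s' h h' _ _
    have h01 : s 0 * s' 1 = s 1 * s' 0 := by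
      refine eq_of_pull_opens fun x ↦ ?_
      obtain ⟨U, hx, _, e, -, he⟩ := exists_local_coords (t ≫ MTilde.toPB hn (tripleSet c)) x
      refine ⟨U, hx, ?_⟩
      have h1 := h U.ι e he
      have h2 := h' U.ι e he
      rw [map_mul, map_mul]
      refine eq_of_span_pair_eq_top (span_ratioPair c he.1) ?_ ?_
      · linear_combination pull U.ι (s' 0) * h1 - pull U.ι (s 0) * h2
      · linear_combination pull U.ι (s' 1) * h1 - pull U.ι (s 1) * h2
    intro i j
    fin_cases i <;> fin_cases j
    · rfl
    · exact h01
    · exact h01.symm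
    · rfl
  have hloc : ∀ x : MTilde n hn, ∃ U : (MTilde n hn).Opens, x ∈ U ∧ ∃ s : Fin 2 → Γ(U, ⊤),
      Ideal.span (Set.range s) = ⊤ ∧ R U.ι s := by
    intro x
    obtain ⟨U, hx, _, e, -, he⟩ := exists_local_coords (MTilde.toPB hn (tripleSet c)) x
    exact ⟨U, hx, _, span_ratioPair c he.1, hR U.ι e he⟩
  obtain ⟨φ, hφ, hφ'⟩ := exists_of_coords
    (MTilde.toCf n hn ≫ Spec.map (CommRingCat.ofHom (algebraMap Base (CfRing n)))) R hpull hprop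
    hloc
  exact ⟨φ, hφ, fun t e he ↦ hφ' t _ (span_ratioPair c he.1) (hR t e he)⟩

/-- The morphism from the deformed line bundle to `ℙ¹` given by `μ_ijk`. -/
def MTilde.mu (c : Triples n) : MTilde n hn ⟶ PS (Fin 2) Base := (MTilde.exists_mu hn c).choose

lemma MTilde.mu_str (c : Triples n) : MTilde.mu hn c ≫ PS.str _ Base =
    MTilde.toCf n hn ≫ Spec.map (CommRingCat.ofHom (algebraMap Base (CfRing n))) :=
  (MTilde.exists_mu hn c).choose_spec.1

lemma MTilde.coords_mu (c : Triples n) {T : Scheme.{0}} (t : T ⟶ MTilde n hn)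
    {e : Coord (tripleSet c).1 (tripleSet c).2 → Γ(T, ⊤)}
    (he : Coords (t ≫ MTilde.toPB hn (tripleSet c)) e) :
    Coords (t ≫ MTilde.mu hn c) (ratioPair e c.1.1 c.1.2.1 c.1.2.2) :=
  (MTilde.exists_mu hn c).choose_spec.2 t e he

lemma MTilde.exists_toLines : ∃ h : MTilde n hn ⟶ (lines Base (Indices n)).left,
    h ≫ forgetMu n = MTilde.toCf n hn ≫ CfRing.toLines n ∧
      ∀ c, h ≫ lines.proj (.inr c) = MTilde.mu hn c := by
  obtain ⟨h, h1, h2⟩ := lines.exists_lift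
    (MTilde.toCf n hn ≫ Spec.map (CommRingCat.ofHom (algebraMap Base (CfRing n))))
    (C := Indices n) (fun c ↦ c.elim
      (fun p ↦ (MTilde.toCf n hn ≫ CfRing.toLines n) ≫ lines.proj p) (MTilde.mu hn)) (by
      rintro (p | c)
      · change ((MTilde.toCf n hn ≫ CfRing.toLines n) ≫ lines.proj p) ≫ _ = _
        rw [Category.assoc, lines.proj_str, Category.assoc, CfRing.toLines_hom]
      · exact MTilde.mu_str hn c)
  refine ⟨h, lines.hom_ext ?_ fun p ↦ ?_, fun c ↦ h2 (.inr c)⟩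
  · rw [Category.assoc, forgetMu_hom, h1, Category.assoc, CfRing.toLines_hom]
  · rw [Category.assoc, forgetMu_proj]
    exact h2 (.inl p)

lemma E.mul_eq_mul {T : Scheme.{0}} {a : T ⟶ E n}
    {s : Coord (Finset.univ : Finset (Fin n)) (univ_nontrivial n hn) → Γ(T, ⊤)}
    (hs : Coords (a ≫ E.toPt n hn) s) (i j) :
    s i * scalars (a ≫ E.toCf n) (originDelta n hn j) =
      s j * scalars (a ≫ E.toCf n) (originDelta n hn i) :=
  Blowup.mul_eq_mul _ _ _ _ hs i j

/-- The blowup makes `δ_bx` proportional to the coordinates of `u|_[n]`. Up to the unit `1 - ε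
δ_bi`, the functions `δ_ij` and `δ_ik` are differences of these, and `u|_B` is proportional to
`u|_[n]` on `B`. The unit and the unimodular family of coordinates are then cancelled. -/
lemma MTilde.ratio_mul_delta {T : Scheme.{0}} (t : T ⟶ MTilde n hn)
    {e : ∀ B : Subsets n, Coord B.1 B.2 → Γ(T, ⊤)}
    (he : ∀ B, Coords (t ≫ MTilde.toPB hn B) (e B)) {B : Subsets n} {i j k : Fin n} (hi : i ∈ B.1)
    (hj : j ∈ B.1) (hk : k ∈ B.1) :
    (coordExt (e B) i - coordExt (e B) k) * scalars (t ≫ MTilde.toCf n hn) (deltaFn i j) =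
      (coordExt (e B) i - coordExt (e B) j) * scalars (t ≫ MTilde.toCf n hn) (deltaFn i k) := by
  set κ := scalars (t ≫ MTilde.toCf n hn) with hκ
  set E := e (univSubset hn)
  have hE := he (univSubset hn)
  have h1 : ∀ (x : Fin n) (y : Coord (univSubset hn).1 (univSubset hn).2),
      E y * κ (deltaFn (origin n hn) x) = coordExt E x * κ (deltaFn (origin n hn) y.1) := by
    intro x y
    by_cases hx : x = origin n hn
    · rw [hx, deltaFn_self, map_zero, mul_zero]
      have : coordExt E (origin n hn) = 0 := coordExt_base E
      rw [this, zero_mul]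
    · rw [MTilde.toPB, MTilde.condition, ← Category.assoc] at hE
      have h2 := MauWoodward.E.mul_eq_mul hn hE y ⟨x, Finset.mem_univ _, hx⟩
      rw [originDelta_eq hn, originDelta_eq hn] at h2
      have h3 : (t ≫ MTilde.toE hn) ≫ MauWoodward.E.toCf n = t ≫ MTilde.toCf n hn :=
        Category.assoc _ _ _
      rw [h3] at h2
      exact h2.trans (congrArg (· * _) (coordExt_coord E ⟨x, Finset.mem_univ _, hx⟩).symm)
  have h4 : ∀ x y, κ (deltaFn x y) * (1 - κ (algebraMap Base (CfRing n) eps) *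
      κ (deltaFn (origin n hn) x)) = κ (deltaFn (origin n hn) y) - κ (deltaFn (origin n hn) x) := by
    intro x y
    have := congrArg κ (deltaFn_mul (origin n hn) x y)
    simpa only [map_mul, map_sub, map_one] using this
  have h5 : (coordExt (e B) i - coordExt (e B) k) * (coordExt E i - coordExt E j) -
      (coordExt (e B) i - coordExt (e B) j) * (coordExt E i - coordExt E k) = 0 :=
    MTilde.relation hn (.proportional (B := B) (B' := univSubset hn) hi hk hi hj
      (Finset.mem_univ _) (Finset.mem_univ _) (Finset.mem_univ _) (Finset.mem_univ _)) t he
  have h6 : IsUnit (1 - κ (algebraMap Base (CfRing n) eps) * κ (deltaFn (origin n hn) i)) := by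
    have := (isUnit_one_sub_deltaFn (origin n hn) i).map κ
    rwa [map_sub, map_mul, map_one] at this
  refine h6.mul_left_cancel (eq_of_span_eq_top (he (univSubset hn)).1 fun y ↦ ?_)
  linear_combination E y * (coordExt (e B) i - coordExt (e B) k) * h4 i j -
    E y * (coordExt (e B) i - coordExt (e B) j) * h4 i k +
    (coordExt (e B) i - coordExt (e B) k) * (h1 j y - h1 i y) -
    (coordExt (e B) i - coordExt (e B) j) * (h1 k y - h1 i y) -
    κ (deltaFn (origin n hn) y.1) * h5

end ToQ

/-! ### The morphism from the deformed line bundle to `Qcirc` -/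

section FromMTilde

variable {n : ℕ} (hn : 2 ≤ n)

lemma MTilde.eval_muEquations {T : Scheme.{0}} (t : T ⟶ MTilde n hn)
    {e : ∀ B : Subsets n, Coord B.1 B.2 → Γ(T, ⊤)}
    (he : ∀ B, Coords (t ≫ MTilde.toPB hn B) (e B)) (g : Base →+* Γ(T, ⊤))
    {m : Triples n × Fin 2 → Γ(T, ⊤)}
    (hm : ∀ c, m c = ratioPair (e (tripleSet c.1)) c.1.1.1 c.1.1.2.1 c.1.1.2.2 c.2)
    {f : MvPolynomial (Triples n × Fin 2) Base} (hf : f ∈ muEquations n) :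
    MvPolynomial.eval₂ g m f = 0 := by
  obtain ((⟨i, j, k, hij, hik, hjk, rfl⟩ | ⟨i, j, k, hij, hik, hjk, rfl⟩) |
    ⟨i, j, k, l, hij, hik, hil, hjk, hjl, hkl, rfl⟩) := hf
  · simp only [MvPolynomial.eval₂_sub, MvPolynomial.eval₂_mul, MvPolynomial.eval₂_X, hm,
      ratioPair_zero, ratioPair_one]
    obtain ⟨h1, h2, h3⟩ := mem_tripleSet (tr i j k hij hik hjk)
    obtain ⟨h1', h2', h3'⟩ := mem_tripleSet (tr i k j hik hij hjk.symm)
    exact MTilde.relation hn (.proportional h1 h3 h1 h2 h1' h2' h1' h3') t he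
  · simp only [MvPolynomial.eval₂_sub, MvPolynomial.eval₂_add, MvPolynomial.eval₂_mul,
      MvPolynomial.eval₂_X, hm, ratioPair_zero, ratioPair_one]
    obtain ⟨h1, h2, h3⟩ := mem_tripleSet (tr i j k hij hik hjk)
    obtain ⟨h1', h2', h3'⟩ := mem_tripleSet (tr j i k hij.symm hjk hik)
    have h := MTilde.relation hn (.proportional h1 h3 h1 h2 h2' h3' h2' h1') t he
    change (_ - _) * (_ - _) - (_ - _) * (_ - _) = (0 : Γ(T, ⊤)) at h
    linear_combination -h
  · simp only [MvPolynomial.eval₂_sub, MvPolynomial.eval₂_mul, MvPolynomial.eval₂_X, hm,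
      ratioPair_zero, ratioPair_one]
    obtain ⟨h1, h2, h3⟩ := mem_tripleSet (tr i j k hij hik hjk)
    obtain ⟨h1', h2', h3'⟩ := mem_tripleSet (tr i k l hik hil hkl)
    obtain ⟨h1'', h2'', h3''⟩ := mem_tripleSet (tr i j l hij hil hjl)
    exact MTilde.relation hn (.multiplicative h1 h2 h3 h1' h2' h3' h1'' h2'' h3'') t he

lemma MTilde.exists_toQ : ∃ l : MTilde n hn ⟶ Q n,
    (l ≫ Q.ι n) ≫ forgetMu n = MTilde.toCf n hn ≫ CfRing.toLines n ∧
      ∀ c, (l ≫ Q.ι n) ≫ lines.proj (.inr c) = MTilde.mu hn c := by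
  obtain ⟨h, h1, h2⟩ := MTilde.exists_toLines hn
  suffices ∃ l, l ≫ Q.ι n = h by
    obtain ⟨l, rfl⟩ := this
    exact ⟨l, h1, h2⟩
  refine exists_lift_vanishingSheaf (fun _ ↦ isMultihomogeneous_of_mem_mwEquations) h fun x ↦ ?_
  set t := (MTilde n hn).fromSpecStalk x
  choose a e _ he using fun B ↦ exists_coords_of_isLocalRing (t ≫ MTilde.toPB hn B)
  -- The coordinates are `ν = [1 : δ]` and `μ_ijk = [u_i - u_k : u_i - u_j]`, the differences being
  -- taken in `{i, j, k}`.
  let s : Indices n × Fin 2 → Γ(Spec ((MTilde n hn).presheaf.stalk x), ⊤) := fun p ↦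
    p.1.elim (fun c ↦ if p.2 = 0 then 1 else scalars (t ≫ MTilde.toCf n hn) (delta c))
      fun c ↦ ratioPair (e (tripleSet c)) c.1.1 c.1.2.1 c.1.2.2 p.2
  have hf : (t ≫ h) ≫ forgetMu n = (t ≫ MTilde.toCf n hn) ≫ CfRing.toLines n := by
    rw [Category.assoc, h1, Category.assoc]
  refine ⟨s, ?_, ?_⟩
  · rintro (c | c)
    · have := CfRing.coords (t ≫ MTilde.toCf n hn) c
      rw [← hf, Category.assoc, forgetMu_proj] at this
      exact this
    · have := MTilde.coords_mu hn c t (he (tripleSet c))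
      rw [← h2, ← Category.assoc] at this
      exact this
  · rintro f ((⟨f, hf', rfl⟩ | ⟨f, hf', rfl⟩) | ⟨i, j, k, hij, hik, hjk, rfl⟩)
    · rw [evalSections_eq, MvPolynomial.eval₂_rename, ← forgetMu_hom, ← Category.assoc, hf]
      exact eval_nuEquations_toLines _ hf'
    · rw [evalSections_eq, MvPolynomial.eval₂_rename]
      exact MTilde.eval_muEquations hn t he _ (fun _ ↦ rfl) hf'
    · obtain ⟨h1, h2, h3⟩ := mem_tripleSet (tr i j k hij hik hjk)
      have h4 := MTilde.ratio_mul_delta hn t he h1 h2 h3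
      rw [deltaFn_of_ne hij, deltaFn_of_ne hik] at h4
      rw [evalSections_eq]
      simp only [MvPolynomial.eval₂_sub, MvPolynomial.eval₂_mul, MvPolynomial.eval₂_X]
      change _ * 1 * scalars (t ≫ MTilde.toCf n hn) _ - 1 * _ *
        scalars (t ≫ MTilde.toCf n hn) _ = 0
      rw [mul_one, one_mul, sub_eq_zero]
      exact h4

/-- There is a morphism from the deformed line bundle to the open locus of `𝒬_n`. -/
lemma MTilde.exists_toQcirc : ∃ g : MTilde n hn ⟶ (Qcirc n).toScheme,
    g ≫ Qcirc.toCf n = MTilde.toCf n hn ∧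
      ∀ c, (g ≫ Qcirc.toLines n) ≫ lines.proj (.inr c) = MTilde.mu hn c := by
  obtain ⟨l, hl, hl'⟩ := MTilde.exists_toQ hn
  have hrange : Set.range l ⊆ Set.range (Qcirc n).ι := by
    rw [Scheme.Opens.range_ι]
    rintro _ ⟨x, rfl⟩
    change (Q.ι n ≫ forgetMu n) (l x) ∈ nuOpen n
    rw [← Scheme.Hom.comp_apply, ← Category.assoc, hl, Scheme.Hom.comp_apply]
    exact toLines_mem_nuOpen _
  have h1 : IsOpenImmersion.lift (Qcirc n).ι l hrange ≫ Qcirc.toLines n = l ≫ Q.ι n := by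
    rw [Qcirc.toLines, ← Category.assoc, IsOpenImmersion.lift_fac]
  refine ⟨IsOpenImmersion.lift (Qcirc n).ι l hrange, ?_, fun c ↦ ?_⟩
  · rw [← cancel_mono (CfRing.toLines n), Category.assoc, Qcirc.toCf_toLines, ← Category.assoc, h1,
      hl]
  · rw [h1, hl']

end FromMTilde

/-! ### The composite on the deformed line bundle is the identity -/

section Inverse

variable {n : ℕ} (hn : 2 ≤ n)

lemma MTilde.coord_mul_muExt {g : MTilde n hn ⟶ (Qcirc n).toScheme}
    (hg : ∀ c, (g ≫ Qcirc.toLines n) ≫ lines.proj (.inr c) = MTilde.mu hn c) {T : Scheme.{0}}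
    (t : T ⟶ MTilde n hn) {B : Subsets n} {e : Coord B.1 B.2 → Γ(T, ⊤)}
    (he : Coords (t ≫ MTilde.toPB hn B) e) {m : Indices n × Fin 2 → Γ(T, ⊤)}
    (hm : LCoords (t ≫ g ≫ Qcirc.toLines n) m) (i j : Coord B.1 B.2) :
    e i * muExt (muPart m) (base B.1 B.2) j.1 i.1 1 =
      muExt (muPart m) (base B.1 B.2) j.1 i.1 0 * e j := by
  by_cases hij : j.1 = i.1
  · rw [Subtype.ext hij, muExt_right _ i.2.2.symm, muExt_right _ i.2.2.symm, mul_comm]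
  rw [muExt_of_ne _ j.2.2.symm i.2.2.symm hij, muExt_of_ne _ j.2.2.symm i.2.2.symm hij]
  set c := tr (base B.1 B.2) j.1 i.1 j.2.2.symm i.2.2.symm hij
  refine eq_of_pull_fromSpecStalk fun x ↦ ?_
  set p := T.fromSpecStalk x
  classical
  choose a e' _ he' using fun B ↦ exists_coords_of_isLocalRing ((p ≫ t) ≫ MTilde.toPB hn B)
  -- A relation on `MBar` takes coordinates for every set at once; those for `B` are the given ones,
  -- the others are chosen on the stalk.
  let E := Function.update e' B fun i ↦ pull p (e i)
  have hEB : E B = fun i ↦ pull p (e i) := Function.update_self _ _ _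
  have hE : ∀ B, Coords ((p ≫ t) ≫ MTilde.toPB hn B) (E B) := by
    intro B'
    by_cases hB : B' = B
    · subst hB
      rw [hEB, Category.assoc]
      exact he.comp p
    · rw [show E B' = e' B' from Function.update_of_ne hB _ _]
      exact he' B'
  have h1 := MTilde.coords_mu hn c (p ≫ t) (hE (tripleSet c))
  have h2 := hm.comp p (.inr c)
  rw [Category.assoc, Category.assoc, hg, ← Category.assoc] at h2
  have h3 := h2.mul_eq_mul h1 0 1
  obtain ⟨h4, h5, h6⟩ := mem_tripleSet c
  have hb : base B.1 B.2 ∈ B.1 := B.1.min'_mem B.2.nonempty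
  have h7 : (coordExt (E B) (base B.1 B.2) - coordExt (E B) i.1) *
      ratioPair (E (tripleSet c)) c.1.1 c.1.2.1 c.1.2.2 1 -
      (coordExt (E B) (base B.1 B.2) - coordExt (E B) j.1) *
      ratioPair (E (tripleSet c)) c.1.1 c.1.2.1 c.1.2.2 0 = 0 :=
    MTilde.relation hn (.proportional hb i.2.1 hb j.2.1 h4 h6 h4 h5) (p ≫ t) hE
  rw [coordExt_base, coordExt_coord, coordExt_coord, hEB] at h7
  rw [map_mul, map_mul]
  change pull p (m (.inr c, 0)) * _ = pull p (m (.inr c, 1)) * _ at h3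
  change _ * pull p (m (.inr c, 1)) = pull p (m (.inr c, 0)) * _
  refine eq_of_span_pair_eq_top h1.1 ?_ ?_
  · linear_combination -pull p (e i) * h3 - pull p (m (.inr c, 0)) * h7
  · linear_combination -pull p (e j) * h3 - pull p (m (.inr c, 1)) * h7

lemma MTilde.comp_toPB {g : MTilde n hn ⟶ (Qcirc n).toScheme}
    (hg : g ≫ Qcirc.toCf n = MTilde.toCf n hn)
    (hg' : ∀ c, (g ≫ Qcirc.toLines n) ≫ lines.proj (.inr c) = MTilde.mu hn c) (B : Subsets n) :
    g ≫ Qcirc.toPB B = MTilde.toPB hn B := by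
  refine hom_ext_of_opens fun x ↦ ?_
  obtain ⟨U, hx, _, e, -, he⟩ := exists_local_coords (MTilde.toPB hn B) x
  refine ⟨U, hx, ?_⟩
  have h1 : PBRel B.1 B.2 (U.ι ≫ g) e := by
    intro T' u m hm i j
    have h2 := he.comp u
    rw [← Category.assoc] at h2
    rw [Category.assoc, ← Category.assoc] at hm
    exact MTilde.coord_mul_muExt hn hg' (u ≫ U.ι) h2 hm i j
  have h2 := Qcirc.coords_toPB B (U.ι ≫ g) e he.1 h1
  rw [Category.assoc] at h2
  refine h2.ext he ?_ fun i j ↦ mul_comm _ _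
  rw [Category.assoc, Category.assoc, Category.assoc, Qcirc.toPB_str, MTilde.toPB_str, Qcirc.str,
    ← Category.assoc g, hg]

/-- A morphism to the deformed line bundle is determined by its components in `Cf` and in all `ℙ(ℂ^B
/ ℂ)`: for the factor `MBar` this is clear, and a point of the blowup is determined by its images in
`Cf` and in `ℙ(𝔱_n)`, the case `B = [n]`. -/
lemma MTilde.comp_eq_id {f : (Qcirc n).toScheme ⟶ MTilde n hn}
    (hf : f ≫ MTilde.toCf n hn = Qcirc.toCf n)
    (hf' : ∀ B, ((f ≫ MTilde.toMBar hn) ≫ MBar.ι n) ≫ prodPB.proj B = Qcirc.toPB B)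
    {g : MTilde n hn ⟶ (Qcirc n).toScheme} (hg : g ≫ Qcirc.toCf n = MTilde.toCf n hn)
    (hg' : ∀ c, (g ≫ Qcirc.toLines n) ≫ lines.proj (.inr c) = MTilde.mu hn c) :
    g ≫ f = 𝟙 (MTilde n hn) := by
  have h1 : (g ≫ f) ≫ MTilde.toCf n hn = MTilde.toCf n hn := by
    rw [Category.assoc, hf, hg]
  have h2 : ∀ B, (((g ≫ f) ≫ MTilde.toMBar hn) ≫ MBar.ι n) ≫ prodPB.proj B =
      MTilde.toPB hn B := by
    intro B
    rw [← MTilde.comp_toPB hn hg hg' B, ← hf' B]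
    simp only [Category.assoc]
  refine MTilde.hom_ext hn ?_ (E.hom_ext hn ?_ ?_)
  · rw [← cancel_mono (MBar.ι n)]
    refine prodPB.hom_ext ?_ fun B ↦ ?_
    · rw [← prodPB.comp_proj_str _ (univSubset hn), ← prodPB.comp_proj_str _ (univSubset hn), h2,
        Category.id_comp]
      rfl
    · rw [h2, Category.id_comp]
      rfl
  · rw [Category.id_comp, Category.assoc]
    exact h1
  · have h3 := h2 (univSubset hn)
    rw [Category.assoc, Category.assoc, ← Category.assoc (MTilde.toMBar hn), MTilde.condition,
      MTilde.toPB, MTilde.condition] at h3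
    rw [Category.id_comp, Category.assoc]
    exact h3

end Inverse

/-! ### The composite on `Qcirc` is the identity, and the theorem -/

section InverseQ

variable {n : ℕ}

/-- The coordinates on `ℙ(ℂ^B / ℂ)` were built from the ratios at the base point of `B` only. That
they also yield `μ_ijk` for arbitrary `i, j, k ∈ B` is checked on the lift to a domain, where
nonzero differences can be cancelled. -/
lemma Qcirc.ratio_mul_muExt_of_isLocalRing {T : Scheme.{0}} [IsLocalRing Γ(T, ⊤)]
    (t : T ⟶ (Qcirc n).toScheme) {m : Indices n × Fin 2 → Γ(T, ⊤)}
    (hm : LCoords (t ≫ Qcirc.toLines n) m) {B : Subsets n} {e : Coord B.1 B.2 → Γ(T, ⊤)}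
    (he : Coords (t ≫ Qcirc.toPB B) e) {i j k : Fin n} (hi : i ∈ B.1) (hj : j ∈ B.1)
    (hk : k ∈ B.1) (hij : i ≠ j) (hik : i ≠ k) :
    (coordExt e i - coordExt e k) * muExt (muPart m) i j k 1 =
      muExt (muPart m) i j k 0 * (coordExt e i - coordExt e j) := by
  obtain ⟨D, _, _, c, φ, u, hφ, hc, hu, hgood⟩ := Qcirc.exists_domain t hm
  obtain ⟨l, hl⟩ := Qcirc.exists_farthest t hm B
  choose ρ hρ hρ' using fun i : Coord B.1 B.2 ↦ hgood _ _ _ l.2.2.symm (hl i)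
  have h1 := Qcirc.coords_toPB_ratio t hm B l hl
  obtain ⟨w, hw⟩ := exists_unit_mul h1.1 he.1 (h1.mul_eq_mul he)
  have hext : ∀ x, coordExt e x = w * φ (coordExt ρ x) := by
    intro x
    rw [map_coordExt, ← coordExt_mul]
    congr 1
    funext y
    rw [hw, hρ']
  have hbl : u (base B.1 B.2) - u l.1 ≠ 0 := sub_ne_zero.2 fun h ↦ l.2.2 (hu h).symm
  have hu' : ∀ x ∈ B.1, u (base B.1 B.2) - u x = coordExt ρ x * (u (base B.1 B.2) - u l.1) := by
    intro x hx
    by_cases hxb : x = base B.1 B.2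
    · rw [hxb, coordExt_base, sub_self, zero_mul]
    · rw [show coordExt ρ x = ρ ⟨x, hx, hxb⟩ from dif_pos ⟨hx, hxb⟩]
      exact hρ ⟨x, hx, hxb⟩
  have key : ∀ {j k}, j ∈ B.1 → k ∈ B.1 → i ≠ j → IsUnit (muExt (muPart m) i j k 1) →
      (coordExt e i - coordExt e k) * muExt (muPart m) i j k 1 =
        muExt (muPart m) i j k 0 * (coordExt e i - coordExt e j) := by
    intro j k hj hk hij h
    obtain ⟨σ, hσ, hσ'⟩ := hgood i j k hij h
    have h2 : coordExt ρ i - coordExt ρ k = σ * (coordExt ρ i - coordExt ρ j) := by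
      refine mul_right_cancel₀ hbl ?_
      linear_combination -hσ - hu' i hi + hu' k hk + σ * (hu' i hi - hu' j hj)
    have h3 := congrArg φ h2
    rw [map_mul, map_sub, map_sub, hσ'] at h3
    rw [hext, hext, hext]
    linear_combination w * muExt (muPart m) i j k 1 * h3 + w * muExt (muPart m) i j k 0 *
      (φ (coordExt ρ i) - φ (coordExt ρ j)) * Ring.inverse_mul_cancel _ h
  have hR := Qcirc.muRel t hm
  obtain h | h := (muSystem hR fun i j k ↦ isUnit_or_of_span_eq_top (hm.span_muExt i j k)).total
    hij hik
  · exact key hj hk hij h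
  -- If `μ_ijk` may be infinite, then `μ_ikj` is finite, and the identity for it is inverted by
  -- means of `μ_ijk μ_ikj = 1`.
  · refine IsUnit.mul_left_cancel h ?_
    linear_combination (-muExt (muPart m) i j k 0) * key hk hj hik h -
      (coordExt e i - coordExt e k) * hR.inv hij hik

lemma Qcirc.ratio_mul_muExt {T : Scheme.{0}} (t : T ⟶ (Qcirc n).toScheme)
    {m : Indices n × Fin 2 → Γ(T, ⊤)} (hm : LCoords (t ≫ Qcirc.toLines n) m) {B : Subsets n}
    {e : Coord B.1 B.2 → Γ(T, ⊤)} (he : Coords (t ≫ Qcirc.toPB B) e) {i j k : Fin n}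
    (hi : i ∈ B.1) (hj : j ∈ B.1) (hk : k ∈ B.1) (hij : i ≠ j) (hik : i ≠ k) :
    (coordExt e i - coordExt e k) * muExt (muPart m) i j k 1 =
      muExt (muPart m) i j k 0 * (coordExt e i - coordExt e j) := by
  refine eq_of_pull_fromSpecStalk fun x ↦ ?_
  have hm' := hm.comp (T.fromSpecStalk x)
  have he' := he.comp (T.fromSpecStalk x)
  rw [← Category.assoc] at hm' he'
  simp only [map_mul, map_sub, map_coordExt, map_muExt (pull (T.fromSpecStalk x))]
  exact Qcirc.ratio_mul_muExt_of_isLocalRing _ hm' he' hi hj hk hij hik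

lemma Qcirc.toLines_proj_inr (hn : 2 ≤ n) {f : (Qcirc n).toScheme ⟶ MTilde n hn}
    (hf : f ≫ MTilde.toCf n hn = Qcirc.toCf n)
    (hf' : ∀ B, ((f ≫ MTilde.toMBar hn) ≫ MBar.ι n) ≫ prodPB.proj B = Qcirc.toPB B)
    (c : Triples n) : Qcirc.toLines n ≫ lines.proj (.inr c) = f ≫ MTilde.mu hn c := by
  refine hom_ext_of_opens fun x ↦ ?_
  obtain ⟨U, hx, m, hm, -⟩ := exists_local_lcoords (Qcirc.toLines n) x
  refine ⟨U, hx, hom_ext_of_opens fun y ↦ ?_⟩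
  obtain ⟨V, hy, _, e, -, he⟩ := exists_local_coords (U.ι ≫ Qcirc.toPB (tripleSet c)) y
  refine ⟨V, hy, ?_⟩
  have hm' := hm.comp V.ι
  rw [← Category.assoc] at hm' he
  have h1 := he
  rw [← hf'] at h1
  have h2 := MTilde.coords_mu hn c ((V.ι ≫ U.ι) ≫ f) (e := e)
    (by simpa only [MTilde.toPB, Category.assoc] using h1)
  have h3 := hm' (.inr c)
  obtain ⟨hi, hj, hk⟩ := mem_tripleSet c
  have h4 := Qcirc.ratio_mul_muExt (V.ι ≫ U.ι) hm' he hi hj hk c.2.1 c.2.2.1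
  rw [muExt_of_ne _ c.2.1 c.2.2.1 c.2.2.2, muExt_of_ne _ c.2.1 c.2.2.1 c.2.2.2] at h4
  have hS : (Qcirc.toLines n ≫ lines.proj (.inr c)) ≫ PS.str (Fin 2) Base =
      (f ≫ MTilde.mu hn c) ≫ PS.str (Fin 2) Base := by
    rw [Category.assoc, lines.proj_str, ← forgetMu_hom, ← Category.assoc, ← Qcirc.toCf_toLines,
      Category.assoc, CfRing.toLines_hom, Category.assoc, MTilde.mu_str, ← Category.assoc f, hf]
  rw [Category.assoc] at h2 h3
  rw [← Category.assoc, ← Category.assoc]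
  have h01 : muPart (fun p ↦ pull V.ι (m p)) (c, 0) * ratioPair e c.1.1 c.1.2.1 c.1.2.2 1 =
      muPart (fun p ↦ pull V.ι (m p)) (c, 1) * ratioPair e c.1.1 c.1.2.1 c.1.2.2 0 :=
    h4.symm.trans (mul_comm _ _)
  refine h3.ext h2 ?_ fun i j ↦ ?_
  · rw [Category.assoc, hS]
    simp only [Category.assoc]
  · fin_cases i <;> fin_cases j
    · exact rfl
    · exact h01
    · exact h01.symm
    · exact rfl

lemma Qcirc.comp_eq_id (hn : 2 ≤ n) {f : (Qcirc n).toScheme ⟶ MTilde n hn}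
    (hf : f ≫ MTilde.toCf n hn = Qcirc.toCf n)
    (hf' : ∀ B, ((f ≫ MTilde.toMBar hn) ≫ MBar.ι n) ≫ prodPB.proj B = Qcirc.toPB B)
    {g : MTilde n hn ⟶ (Qcirc n).toScheme} (hg : g ≫ Qcirc.toCf n = MTilde.toCf n hn)
    (hg' : ∀ c, (g ≫ Qcirc.toLines n) ≫ lines.proj (.inr c) = MTilde.mu hn c) :
    f ≫ g = 𝟙 (Qcirc n).toScheme := by
  have h1 : ((f ≫ g) ≫ Qcirc.toLines n) ≫ forgetMu n = Qcirc.toLines n ≫ forgetMu n := by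
    rw [Category.assoc, ← Qcirc.toCf_toLines, ← Category.assoc, Category.assoc f, hg, hf]
  rw [← cancel_mono (Qcirc.toLines n), Category.id_comp]
  refine lines.hom_ext ?_ ?_
  · rw [← forgetMu_hom, ← Category.assoc, h1, Category.assoc]
  · rintro (c | c)
    · rw [← forgetMu_proj, ← Category.assoc, h1, Category.assoc]
    · rw [Qcirc.toLines_proj_inr hn hf hf', ← hg', Category.assoc, Category.assoc, Category.assoc]

lemma Qcirc.exists_iso (hn : 2 ≤ n) :
    ∃ e : (Qcirc n).toScheme ≅ MTilde n hn, e.hom ≫ MTilde.toCf n hn = Qcirc.toCf n := by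
  obtain ⟨f, hf, hf'⟩ := Qcirc.exists_toMTilde hn
  obtain ⟨g, hg, hg'⟩ := MTilde.exists_toQcirc hn
  exact ⟨⟨f, g, Qcirc.comp_eq_id hn hf hf' hg hg', MTilde.comp_eq_id hn hf hf' hg hg'⟩, hf⟩

end InverseQ

end MauWoodward

end

open CategoryTheory AlgebraicGeometry MauWoodward in
theorem mainTheorem12 (n : ℕ) (hn : 2 ≤ n) :
    ∃ (c : (Cf n).toScheme ≅ Spec (.of (CfRing n))) (q : (Qcirc n).toScheme ⟶ (Cf n).toScheme)
      (e : (Qcirc n).toScheme ≅ MTilde n hn),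
      c.hom ≫ CfRing.toLines n = (Cf n).ι ≫ CfBar.ι n ∧
      q ≫ (Cf n).ι ≫ CfBar.ι n = (Qcirc n).ι ≫ Q.ι n ≫ forgetMu n ∧
      e.hom ≫ MTilde.toCf n hn = q ≫ c.hom := by
  obtain ⟨c, hc⟩ := exists_cfIso n
  obtain ⟨e, he⟩ := Qcirc.exists_iso hn
  -- The middle morphism is forced: `Cf` embeds in `(ℙ¹)^{p([n])} × 𝔸¹`, so at most one morphism to
  -- it forgets `μ`.
  refine ⟨c, Qcirc.toCf n ≫ c.inv, e, hc, ?_, ?_⟩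
  · rw [← hc, Category.assoc, Iso.inv_hom_id_assoc, Qcirc.toCf_toLines, Qcirc.toLines,
      Category.assoc]
  · rw [he, Category.assoc, Iso.inv_hom_id, Category.comp_id]
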